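/- Let $M$ be a closed connected oriented triangulated (piecewise-linear) 4-manifold with universal covering $\tilde M$. (Simplices of $\tilde M$ have distinct vertices; different simplices may share the same vertex set.) Let $f\colon\pi_1(M)\to E_4$ be a homomorphism into the group of orientation-preserving motions of $\mathbb R^4$, and let $A\mapsto \vec r_A\in\mathbb R^4$ be an $f$-equivariant placement of the vertices of $\tilde M$ for which every 4-simplex is nondegenerate. Write $i$ for triangles, $a$ for edges and $A$ for vertices of $M$; the quantities below are computed at lifts to $\tilde M$, and vectors and tensors at different lifts are identified by the rotational part of $f$. Define the following real vector spaces. * $(d\sigma)_0$: pairs of an antisymmetric tensor $d\tau_{\alpha\beta}$ and a vector $ds_\alpha$ for which $d\tau_{\alpha\beta}+\sum_{\gamma,\delta}\epsilon_{\alpha\beta\gamma\delta}(r_A)_\gamma\,ds_\delta$ gives the same bivector at all lifts of each vertex. * $(d\sigma)$: families of bivectors $(d\sigma_A)_{\alpha\beta}$, one for each vertex of $M$. * $(d\vec v_a)$: families of vectors, one for each edge of $M$, orthogonal to the edge. * $(dS_i)$, $(d\omega_i)$: real columns indexed by the triangles of $M$; $(dL_a)$, $(d\Omega_a)$: real columns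 indexed by the edges of $M$. * $\mathfrak a$: infinitesimal motions of $\mathbb R^4$ commuting with the image of $f$. * $(dx\text{ and }dg)=(dx)\oplus(dg)$: $(dx)$ consists of arbitrary displacements of the vertices of $M$, and $(dg)$ is a space of infinitesimal deformations of $f$ that is complementary, among all infinitesimal deformations of $f$ as a homomorphism into $E_4$, to those coming from conjugation. An element determines displacements of all vertices of $\tilde M$, equivariant with respect to the deformed representation. Define the following maps. * $(d\sigma)_0\to(d\sigma)$ is given by the displayed formula. * $(d\sigma)\to(d\vec v_a)$ is $(d\vec v_{AB})_\beta=\frac1{L_{AB}}\sum_\alpha l_\alpha\big((d\sigma_A)_{\alpha\beta}-(d\sigma_B)_{\alpha\beta}\big)$, with $\vec l=\overrightarrow{AB}$ and $L_{AB}=|\vec l|^2$. * $(d\vec v_a)\to(dS_i)$ is the differential at zero of four times the area of the triangle formed by the midpoints of the sides of $i$, each shifted by the deviation of its side. * $\mathfrak a\to(dx\text{ and }dg)$ takes the values of the motion at the vertices, with $dg=0$. * $(dx\text{ and }dg)\to(dL_a)$ is the differential of the squared edge lengths. * $(dL_a)\to(d\omega_i)$ is the Jacobian matrix $(\partial\omega_i/\partial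 L_a)$ at the given configuration. Here $\omega_i$ is minus the sum of the dihedral angles at $i$ of the 4-simplices containing $i$, each taken with the sign $\pm$ according to whether the placement of that 4-simplex preserves or reverses orientation. * $(dS_i)\to(d\Omega_a)$ is the transposed matrix, $(\partial\Omega_a/\partial S_i)=(\partial\omega_i/\partial L_a)^{\rm T}$. Denote by $(\cdots)$ the dual spaces, with the transposed maps between them. Then all the differentials above exist, and in both of the mutually transposed sequences $$0\leftarrow\mathfrak a^*\leftarrow(dx\text{ and }dg)^*\leftarrow(d\Omega_a)\leftarrow(dS_i)\leftarrow(d\vec v_a)\leftarrow(d\sigma)\leftarrow(d\sigma)_0\leftarrow0,$$ $$0\to\mathfrak a\to(dx\text{ and }dg)\to(dL_a)\to(d\omega_i)\to(d\vec v_a)^*\to(d\sigma)^*\to(d\sigma)_0^*\to0$$ the composition of any two consecutive maps is zero. In particular, edge deviations generated by vertex deviations give zero area differentials. Moreover, the second sequence is exact at $\mathfrak a$, $(dx\text{ and }dg)$, $(dL_a)$ and $(d\sigma)_0^*$, and the first sequence is exact at the corresponding terms $\mathfrak a^*$, $(dx\text{ and }dg)^*$, $(d\Omega_a)$ and at $(d\sigma)_0$.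 -/

import Mathlib

namespace EuclComplex

noncomputable section

/-- Four-dimensional Euclidean space. -/
abbrev E4 := EuclideanSpace ℝ (Fin 4)

/-! ### Edge paths in a partially ordered set -/

section Poset

variable {X : Type*} [PartialOrder X]

/-- Two elements are joined by an edge of the order complex. -/
def Comparable (x y : X) : Prop := x ≤ y ∨ y ≤ x

/-- Elementary homotopies of edge paths in the order complex. -/
inductive PathStep : List X → List X → Prop
  | dup (l₁ l₂ : List X) (x : X) : PathStep (l₁ ++ x :: x :: l₂) (l₁ ++ x :: l₂)
  | tri (l₁ l₂ : List X) (x y z : X) (hxy : Comparable x y) (hyz : Comparable y z)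
      (hxz : Comparable x z) : PathStep (l₁ ++ x :: y :: z :: l₂) (l₁ ++ x :: z :: l₂)

variable (X) in
/-- The order complex is nonempty and connected. -/
def PosetConnected : Prop :=
  Nonempty X ∧ ∀ x y : X, Relation.ReflTransGen Comparable x y

variable (X) in
/-- The order complex is connected, and every closed edge path is homotopic to a constant path
(triviality of the edge-path group). -/
def PosetSimplyConnected : Prop :=
  PosetConnected X ∧
    ∀ (x : X) (l : List X), List.IsChain Comparable l → l.head? = some x → l.getLast? = some x →
      Relation.EqvGen PathStep l [x]

end Poset

/-! ### Triangulated closed four-manifolds, given by their universal coverings -/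

/-- A triangulation of a compact space `M`, described on its universal covering. `P` is the set of
simplices of the covering, ordered by "is a face of"; `V` is its set of vertices; `Γ = π₁(M)` acts
by deck transformations, so that the simplices of `M` are the `Γ`-orbits in `P`.
A simplex of the covering has distinct vertices, and each nonempty set of its vertices spans
exactly one of its faces; different simplices are allowed to have the same vertices. -/
structure Triangulation (Γ V P : Type*) [Group Γ] [MulAction Γ V] [PartialOrder P]
    [MulAction Γ P] where
  /-- the vertices of a simplex -/
  verts : P → Finset V
  verts_nonempty : ∀ p, (verts p).Nonempty
  verts_mono : ∀ p q, q ≤ p → verts q ⊆ verts p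
  existsUnique_face : ∀ p (S : Finset V), S ⊆ verts p → S.Nonempty → ∃! q, q ≤ p ∧ verts q = S
  existsUnique_vertex : ∀ v : V, ∃! p, verts p = {v}
  smul_mono : ∀ (g : Γ) (p q : P), q ≤ p → g • q ≤ g • p
  smul_mem_verts : ∀ (g : Γ) (p : P) (v : V), g • v ∈ verts (g • p) ↔ v ∈ verts p
  /-- the action is free -/
  free : ∀ (g : Γ) (p : P), g • p = p → g = 1
  /-- `M` has finitely many simplices -/
  finite_quotient : Finite (MulAction.orbitRel.Quotient Γ P)
  /-- the covering is simply connected -/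
  simplyConnected : PosetSimplyConnected P

variable {Γ V P : Type*} [Group Γ] [MulAction Γ V] [PartialOrder P] [MulAction Γ P]

namespace Triangulation

variable (T : Triangulation Γ V P)

/-- The `k`-dimensional simplices of the universal covering. -/
abbrev Cell (k : ℕ) : Type _ := {p : P // (T.verts p).card = k + 1}

open Classical in
theorem verts_smul (g : Γ) (p : P) : T.verts (g • p) = (T.verts p).image (g • ·) := by
  ext v
  simp only [Finset.mem_image]
  constructor
  · intro hv
    refine ⟨g⁻¹ • v, ?_, by simp⟩
    rw [← T.smul_mem_verts g]
    simpa using hv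
  · rintro ⟨w, hw, rfl⟩
    exact (T.smul_mem_verts g p w).2 hw

theorem card_verts_smul (g : Γ) (p : P) : (T.verts (g • p)).card = (T.verts p).card := by
  classical
  rw [T.verts_smul, Finset.card_image_of_injective _ (MulAction.injective g)]

instance (k : ℕ) : MulAction Γ (T.Cell k) where
  smul g p := ⟨g • p.1, by rw [T.card_verts_smul]; exact p.2⟩
  one_smul p := Subtype.ext (one_smul Γ p.1)
  mul_smul g h p := Subtype.ext (mul_smul g h p.1)

/-- The `k`-dimensional simplices of `M`. -/
abbrev Face (k : ℕ) : Type _ := MulAction.orbitRel.Quotient Γ (T.Cell k)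

/-- The simplex of `M` covered by a given simplex. -/
def proj {k : ℕ} (p : T.Cell k) : T.Face k := Quotient.mk _ p

/-- A chosen simplex of the universal covering lying over a simplex of `M`. -/
def lift {k : ℕ} (p : T.Face k) : T.Cell k := Quotient.out p

instance (k : ℕ) : Finite (T.Face k) := by
  have := T.finite_quotient
  let φ : T.Face k → MulAction.orbitRel.Quotient Γ P :=
    fun p => Quotient.mk _ (T.lift p).1
  refine Finite.of_injective φ ?_
  intro p q h
  have h' : (MulAction.orbitRel Γ P).r (T.lift p).1 (T.lift q).1 := Quotient.exact h
  obtain ⟨g, hg⟩ := h'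
  rw [← Quotient.out_eq p, ← Quotient.out_eq q]
  exact Quotient.sound ⟨g, Subtype.ext hg⟩

instance (k : ℕ) : Fintype (T.Face k) := Fintype.ofFinite _

/-- The face of the simplex `p` spanned by a nonempty set of its vertices. -/
def face (p : P) (S : Finset V) (h : S ⊆ T.verts p) (hS : S.Nonempty) : P :=
  Classical.choose (T.existsUnique_face p S h hS)

theorem verts_face (p : P) (S : Finset V) (h : S ⊆ T.verts p) (hS : S.Nonempty) :
    T.verts (T.face p S h hS) = S :=
  (Classical.choose_spec (T.existsUnique_face p S h hS)).1.2

open Classical in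
/-- The edge of the simplex `s` that joins its vertices `u` and `w`. -/
def edge {k : ℕ} (s : T.Cell k) (u w : T.verts s.1) (h : u ≠ w) : T.Cell 1 :=
  ⟨T.face s.1 {u.1, w.1}
      (by
        intro x hx
        rcases Finset.mem_insert.1 hx with rfl | hx
        · exact u.2
        · rw [Finset.mem_singleton.1 hx]; exact w.2)
      (Finset.insert_nonempty _ _),
    by rw [T.verts_face]; exact Finset.card_pair (fun e => h (Subtype.ext e))⟩

open Classical in
/-- The side of the triangle `i` opposite to its vertex `c`. -/
def side (i : T.Cell 2) (c : T.verts i.1) : T.Cell 1 :=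
  ⟨T.face i.1 ((T.verts i.1).erase c.1) (Finset.erase_subset _ _)
      (by rw [← Finset.card_pos, Finset.card_erase_of_mem c.2, i.2]; norm_num),
    by rw [T.verts_face, Finset.card_erase_of_mem c.2, i.2]⟩

/-- The triangulated space is a closed four-dimensional manifold: it is locally finite and of pure
dimension four, every tetrahedron lies in exactly two 4-simplices, and the links of triangles,
edges and vertices are respectively a circle, a 2-sphere and a 3-sphere. The link of `p` is the
complex of all simplices strictly above `p`; inductively it is a closed manifold of dimension
one, two or three, and such a manifold is a sphere if and only if it is connected and, in
dimensions two and three, simply connected. -/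
structure IsClosedManifold : Prop where
  finite_star : ∀ p : P, (Set.Ici p).Finite
  pure : ∀ p : P, ∃ s : T.Cell 4, p ≤ s.1
  card_le : ∀ p : P, (T.verts p).card ≤ 5
  two_sided : ∀ f : T.Cell 3, {s : T.Cell 4 | f.1 < s.1}.ncard = 2
  link_triangle : ∀ i : T.Cell 2, PosetConnected (Set.Ioi i.1)
  link_edge : ∀ a : T.Cell 1, PosetSimplyConnected (Set.Ioi a.1)
  link_vertex : ∀ v : T.Cell 0, PosetSimplyConnected (Set.Ioi v.1)

/-- An orientation of `M`: a positive ordering of the vertices of every 4-simplex. Simplices with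
a common tetrahedron induce opposite orientations of it (replacing a vertex turns a positive
ordering into a negative one), and deck transformations preserve the orientation. -/
structure Orientation where
  ord : T.Cell 4 → Fin 5 → V
  injective : ∀ s, Function.Injective (ord s)
  mem_verts : ∀ s i, ord s i ∈ T.verts s.1
  coherent : ∀ (s t : T.Cell 4) (f : T.Cell 3), s ≠ t → f.1 < s.1 → f.1 < t.1 →
    ∀ τ : Equiv.Perm (Fin 5), (∀ i, ord s i ∈ T.verts f.1 → ord t (τ i) = ord s i) →
      Equiv.Perm.sign τ = -1
  invariant : ∀ (g : Γ) (s : T.Cell 4) (τ : Equiv.Perm (Fin 5)),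
    (∀ i, ord (g • s) (τ i) = g • ord s i) → Equiv.Perm.sign τ = 1

/-- A homomorphism `f : π₁(M) → E₄` into the group of (orientation-preserving) motions of `ℝ⁴`,
together with an equivariant placement of the vertices of the universal covering in `ℝ⁴` for which
all 4-simplices are nondegenerate. -/
structure Placement where
  rep : Γ →* (E4 ≃ᵃⁱ[ℝ] E4)
  rep_det : ∀ g, LinearMap.det ((rep g).linearIsometryEquiv.toLinearEquiv : E4 →ₗ[ℝ] E4) = 1
  pos : V → E4
  equivariant : ∀ (g : Γ) (v : V), pos (g • v) = rep g (pos v)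
  nondegenerate : ∀ s : T.Cell 4, AffineIndependent ℝ (fun v : T.verts s.1 => pos v)

end Triangulation

/-! ### Dihedral angles and areas -/

section Simplex

variable {ι : Type*} [Fintype ι]

open Classical in
/-- The Cayley–Menger matrix of a simplex with squared edge lengths `D`. -/
def cayleyMenger (D : ι → ι → ℝ) : Matrix (Option ι) (Option ι) ℝ :=
  Matrix.of fun a b => match a, b with
    | none, none => 0
    | none, some _ => 1
    | some _, none => 1
    | some u, some w => D u w

open Classical in
/-- The dihedral angle between the two facets opposite to the vertices `j` and `k`, as a function
of the squared edge lengths; `dihedralAngle_eq_angle` identifies it geometrically. -/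
def dihedralAngle (D : ι → ι → ℝ) (j k : ι) : ℝ :=
  Real.arccos ((cayleyMenger D)⁻¹ (some j) (some k) /
    √((cayleyMenger D)⁻¹ (some j) (some j) * (cayleyMenger D)⁻¹ (some k) (some k)))

/-- The area of a triangle by Heron's formula
`16 S² = (a² + b² + c²)² - 2 (a⁴ + b⁴ + c⁴)`. -/
def heronArea (q : ι → E4) : ℝ :=
  √(((∑ u, ∑ w, ‖q u - q w‖ ^ 2) / 2) ^ 2 - ∑ u, ∑ w, ‖q u - q w‖ ^ 4) / 4

open Classical in
/-- The barycentric coordinates of a nondegenerate 4-simplex, with their gradients. -/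
theorem exists_barycentric (p : ι → E4) (hp : AffineIndependent ℝ p) (hc : Fintype.card ι = 5) :
    ∃ (n : ι → E4) (c : ι → ℝ), (∑ m, c m = 1) ∧ (∑ m, n m = 0) ∧
      (∀ x : E4, ∑ m, (inner ℝ (n m) x + c m) • p m = x) ∧
      ∀ m i, inner ℝ (n m) (p i) + c m = if m = i then 1 else 0 := by
  have htop : affineSpan ℝ (Set.range p) = ⊤ := by
    rw [hp.affineSpan_eq_top_iff_card_eq_finrank_add_one, hc]
    simp
  let b : AffineBasis ι ℝ E4 := ⟨p, hp, htop⟩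
  have hb : ∀ i, b i = p i := fun i => rfl
  let n : ι → E4 := fun m => (InnerProductSpace.toDual ℝ E4).symm
    (LinearMap.toContinuousLinearMap (b.coord m).linear)
  have hn : ∀ m x, inner ℝ (n m) x = (b.coord m).linear x := fun m x => by
    simp [n]
  have hco : ∀ m x, inner ℝ (n m) x + b.coord m 0 = b.coord m x := fun m x => by
    rw [hn]
    have := (b.coord m).map_vadd 0 x
    simpa using this.symm
  have hsum : ∀ x, ∑ m, b.coord m x = 1 := fun x => b.sum_coord_apply_eq_one x
  refine ⟨n, fun m => b.coord m 0, hsum 0, ?_, ?_, ?_⟩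
  · refine ext_inner_right ℝ fun x => ?_
    rw [sum_inner, inner_zero_left]
    have h1 := hsum x
    rw [Finset.sum_congr rfl fun m _ => (hco m x).symm, Finset.sum_add_distrib, hsum 0] at h1
    linarith
  · intro x
    rw [Finset.sum_congr rfl fun m _ => by rw [hco m x]]
    exact b.linear_combination_coord_eq_self x
  · intro m i
    rw [hco, ← hb, b.coord_apply]

open Classical in
/-- The inverse of the Cayley–Menger matrix consists, up to the factor `-1/2`, of the scalar
products of the gradients of the barycentric coordinates. -/
theorem cayleyMenger_inv (p : ι → E4) (n : ι → E4) (c : ι → ℝ) (hc : ∑ m, c m = 1)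
    (hn : ∑ m, n m = 0) (hx : ∀ x : E4, ∑ m, (inner ℝ (n m) x + c m) • p m = x)
    (hi : ∀ m i, inner ℝ (n m) (p i) + c m = if m = i then 1 else 0) :
    IsUnit (cayleyMenger fun u w => ‖p u - p w‖ ^ 2).det ∧
    ∀ j k, (cayleyMenger fun u w => ‖p u - p w‖ ^ 2)⁻¹ (some j) (some k) =
      -(1 / 2) * inner ℝ (n j) (n k) := by
  set D : ι → ι → ℝ := fun u w => ‖p u - p w‖ ^ 2 with hD
  set w : E4 := ∑ m, ‖p m‖ ^ 2 • n m with hw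
  set e : ι → ℝ := fun k => c k + inner ℝ w (n k) / 2 with he
  -- the weighted sums of squared distances
  have hpt : ∀ y x : E4, ∑ m, inner ℝ (n m) x * inner ℝ y (p m) = inner ℝ y x := by
    intro y x
    have h1 := congrArg (fun z => inner ℝ y z) (hx x)
    have h0 := congrArg (fun z => inner ℝ y z) (hx 0)
    simp only [inner_sum, inner_smul_right, inner_zero_right, zero_add] at h1 h0
    simp only [add_mul, Finset.sum_add_distrib] at h1
    rw [h0] at h1
    linarith
  have hp0 : ∀ y : E4, ∑ m, c m * inner ℝ y (p m) = 0 := by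
    intro y
    have h0 := congrArg (fun z => inner ℝ y z) (hx 0)
    simpa only [inner_sum, inner_smul_right, inner_zero_right, zero_add] using h0
  have hDe : ∀ i m, D i m = ‖p i‖ ^ 2 - 2 * inner ℝ (p i) (p m) + ‖p m‖ ^ 2 := fun i m =>
    norm_sub_sq_real (p i) (p m)
  have hn' : ∀ x : E4, ∑ m, inner ℝ (n m) x = 0 := fun x => by
    rw [← sum_inner, hn, inner_zero_left]
  have hw' : ∀ x : E4, ∑ m, ‖p m‖ ^ 2 * inner ℝ (n m) x = inner ℝ w x := fun x => by
    rw [hw, sum_inner]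
    exact Finset.sum_congr rfl fun m _ => by rw [inner_smul_left]; simp
  have hDn : ∀ i (x : E4), ∑ m, D i m * inner ℝ (n m) x = -2 * inner ℝ (p i) x + inner ℝ w x := by
    intro i x
    have : ∀ m, D i m * inner ℝ (n m) x = ‖p i‖ ^ 2 * inner ℝ (n m) x
        - 2 * (inner ℝ (n m) x * inner ℝ (p i) (p m)) + ‖p m‖ ^ 2 * inner ℝ (n m) x := fun m => by
      rw [hDe]; ring
    rw [Finset.sum_congr rfl fun m _ => this m, Finset.sum_add_distrib, Finset.sum_sub_distrib,
      ← Finset.mul_sum, ← Finset.mul_sum, hn', hpt, hw']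
    ring
  have hDc : ∀ i, ∑ m, D i m * c m = ‖p i‖ ^ 2 + ∑ m, ‖p m‖ ^ 2 * c m := by
    intro i
    have : ∀ m, D i m * c m = ‖p i‖ ^ 2 * c m - 2 * (c m * inner ℝ (p i) (p m))
        + ‖p m‖ ^ 2 * c m := fun m => by rw [hDe]; ring
    rw [Finset.sum_congr rfl fun m _ => this m, Finset.sum_add_distrib, Finset.sum_sub_distrib,
      ← Finset.mul_sum, ← Finset.mul_sum, hc, hp0]
    ring
  have hwp : ∀ i, inner ℝ w (p i) = ‖p i‖ ^ 2 - ∑ m, ‖p m‖ ^ 2 * c m := by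
    intro i
    rw [← hw']
    have : ∀ m, ‖p m‖ ^ 2 * inner ℝ (n m) (p i) =
        (if m = i then ‖p m‖ ^ 2 else 0) - ‖p m‖ ^ 2 * c m := fun m => by
      have := hi m i
      rw [eq_sub_of_add_eq this]
      split_ifs <;> ring
    rw [Finset.sum_congr rfl fun m _ => this m, Finset.sum_sub_distrib]
    simp
  set N : Matrix (Option ι) (Option ι) ℝ := Matrix.of fun a b => match a, b with
    | none, none => -(2 * ∑ m, ‖p m‖ ^ 2 * c m + inner ℝ w w / 2)
    | none, some k => e k
    | some j, none => e j
    | some j, some k => -(1 / 2) * inner ℝ (n j) (n k) with hN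
  have hmul : cayleyMenger D * N = 1 := by
    ext a b
    rw [Matrix.mul_apply, Fintype.sum_option]
    rcases a with _ | i <;> rcases b with _ | k
    · simp only [cayleyMenger, hN, Matrix.of_apply, he]
      have h2 : ∑ m, inner ℝ w (n m) = 0 := by rw [← inner_sum, hn, inner_zero_right]
      simp only [zero_mul, one_mul, Finset.sum_add_distrib, ← Finset.sum_div, h2, hc]
      simp
    · simp only [cayleyMenger, hN, Matrix.of_apply, ← Finset.mul_sum, one_mul, hn']
      simp
    · simp only [cayleyMenger, hN, Matrix.of_apply, he, mul_add, Finset.sum_add_distrib, hDc]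
      have h3 : ∑ m, D i m * (inner ℝ w (n m) / 2) = (-2 * inner ℝ (p i) w + inner ℝ w w) / 2 := by
        rw [← hDn, Finset.sum_div]
        exact Finset.sum_congr rfl fun m _ => by rw [real_inner_comm]; ring
      rw [h3, real_inner_comm w (p i), hwp]
      simp
      ring
    · simp only [cayleyMenger, hN, Matrix.of_apply, he]
      have h4 : ∑ m, D i m * (-(1 / 2) * inner ℝ (n m) (n k)) =
          -(1 / 2) * (-2 * inner ℝ (p i) (n k) + inner ℝ w (n k)) := by
        rw [← hDn, Finset.mul_sum]
        exact Finset.sum_congr rfl fun m _ => by ring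
      rw [h4]
      have h5 := hi k i
      rw [real_inner_comm] at h5
      simp only [Matrix.one_apply, Option.some.injEq]
      rw [show (if i = k then (1 : ℝ) else 0) = if k = i then 1 else 0 by simp [eq_comm], ← h5]
      ring
  refine ⟨(Matrix.isUnit_iff_isUnit_det _).1 (IsUnit.of_mul_eq_one _ hmul), fun j k => ?_⟩
  rw [Matrix.inv_eq_right_inv hmul]
  rfl

open Classical in
/-- For the squared edge lengths of a nondegenerate 4-simplex, `dihedralAngle` is the angle
between the perpendiculars from the vertices `j` and `k` to the plane of the opposite triangle. -/
theorem dihedralAngle_eq_angle (p : ι → E4) (hp : AffineIndependent ℝ p)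
    (hc : Fintype.card ι = 5) (j k : ι) (hjk : j ≠ k) (a b : E4)
    (ha : a ∈ affineSpan ℝ (p '' {j, k}ᶜ)) (hb : b ∈ affineSpan ℝ (p '' {j, k}ᶜ))
    (hpa : ∀ m, m ≠ j → m ≠ k → inner ℝ (p j - a) (p m - a) = 0)
    (hpb : ∀ m, m ≠ j → m ≠ k → inner ℝ (p k - b) (p m - b) = 0) :
    dihedralAngle (fun u w => ‖p u - p w‖ ^ 2) j k =
      InnerProductGeometry.angle (p j - a) (p k - b) := by
  obtain ⟨n, c, h1, h2, h3, h4⟩ := exists_barycentric p hp hc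
  obtain ⟨-, hinv⟩ := cayleyMenger_inv p n c h1 h2 h3 h4
  -- a function of the plane of the triangle is determined by its values at the vertices
  have hspan : ∀ x ∈ affineSpan ℝ (p '' {j, k}ᶜ), ∀ (v : E4) (r : ℝ),
      (∀ m, m ≠ j → m ≠ k → inner ℝ v (p m) + r = 0) → inner ℝ v x + r = 0 := by
    intro x hx v r hv
    refine affineSpan_induction (p := fun x => inner ℝ v x + r = 0) hx ?_ ?_
    · rintro _ ⟨m, hm, rfl⟩
      simp only [Set.mem_compl_iff, Set.mem_insert_iff, Set.mem_singleton_iff, not_or] at hm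
      exact hv m hm.1 hm.2
    · intro t u v' w hu hv hw
      simp only [vsub_eq_sub, vadd_eq_add, inner_add_right, inner_smul_right, inner_sub_right]
      have e1 := hu; have e2 := hv; have e3 := hw
      linear_combination t * e1 - t * e2 + e3
  have hnj : ∀ x ∈ affineSpan ℝ (p '' {j, k}ᶜ), inner ℝ (n j) x + c j = 0 := fun x hx =>
    hspan x hx _ _ fun m hm _ => by rw [h4, if_neg (Ne.symm hm)]
  have hnk : ∀ x ∈ affineSpan ℝ (p '' {j, k}ᶜ), inner ℝ (n k) x + c k = 0 := fun x hx =>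
    hspan x hx _ _ fun m _ hm => by rw [h4, if_neg (Ne.symm hm)]
  set u := p j - a with hu
  set w := p k - b with hw
  have hju : inner ℝ (n j) u = 1 := by
    rw [hu, inner_sub_right]; have := h4 j j; have := hnj a ha; simp at *; linarith
  have hku : inner ℝ (n k) u = 0 := by
    rw [hu, inner_sub_right]; have := h4 k j; have := hnk a ha; simp [hjk.symm] at *; linarith
  have hjw : inner ℝ (n j) w = 0 := by
    rw [hw, inner_sub_right]; have := h4 j k; have := hnj b hb; simp [hjk] at *; linarith
  have hkw : inner ℝ (n k) w = 1 := by
    rw [hw, inner_sub_right]; have := h4 k k; have := hnk b hb; simp at *; linarith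
  have hua : ∀ x ∈ affineSpan ℝ (p '' {j, k}ᶜ), inner ℝ u x = inner ℝ u a := fun x hx => by
    have := hspan x hx u (-inner ℝ u a) fun m hm hm' => by
      have := hpa m hm hm'; rw [inner_sub_right] at this; linarith
    linarith
  have hwb : ∀ x ∈ affineSpan ℝ (p '' {j, k}ᶜ), inner ℝ w x = inner ℝ w b := fun x hx => by
    have := hspan x hx w (-inner ℝ w b) fun m hm hm' => by
      have := hpb m hm hm'; rw [inner_sub_right] at this; linarith
    linarith
  have hgen : ∀ (v z : E4) (d : ℝ), (∀ x ∈ affineSpan ℝ (p '' {j, k}ᶜ), inner ℝ v x = d) →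
      inner ℝ v z = inner ℝ (n j) z * (inner ℝ v (p j) - d)
        + inner ℝ (n k) z * (inner ℝ v (p k) - d) := by
    intro v z d hd
    have e1 := congrArg (fun x => inner ℝ v x) (h3 z)
    have e0 := congrArg (fun x => inner ℝ v x) (h3 0)
    simp only [inner_sum, inner_smul_right, inner_zero_right, zero_add] at e1 e0
    have e2 : ∑ m, inner ℝ (n m) z * (inner ℝ v (p m) - d) = inner ℝ v z := by
      have : ∑ m, inner ℝ (n m) z = 0 := by rw [← sum_inner, h2, inner_zero_left]
      simp only [mul_sub, Finset.sum_sub_distrib, ← Finset.sum_mul, this]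
      simp only [add_mul, Finset.sum_add_distrib, e0] at e1
      linarith
    rw [← e2, ← Finset.sum_subset (Finset.subset_univ {j, k}), Finset.sum_pair hjk]
    intro m _ hm
    simp only [Finset.mem_insert, Finset.mem_singleton, not_or] at hm
    rw [hd (p m) (subset_affineSpan ℝ _ ⟨m, by simp [hm], rfl⟩), sub_self, mul_zero]
  have huj : inner ℝ u (p j) - inner ℝ u a = inner ℝ u u := by rw [← inner_sub_right]
  have huk : inner ℝ u (p k) - inner ℝ u a = inner ℝ u w := by
    rw [← hua b hb, ← inner_sub_right]
  have hwk : inner ℝ w (p k) - inner ℝ w b = inner ℝ w w := by rw [← inner_sub_right]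
  have hwj : inner ℝ w (p j) - inner ℝ w b = inner ℝ w u := by
    rw [← hwb a ha, ← inner_sub_right]
  have q1 := hgen u (n j) _ hua
  have q2 := hgen u (n k) _ hua
  have q3 := hgen w (n j) _ hwb
  have q4 := hgen w (n k) _ hwb
  rw [huj, huk, real_inner_comm (n j) u, hju, real_inner_comm (n j) (n k)] at q1
  rw [huj, huk, real_inner_comm (n k) u, hku] at q2
  rw [hwj, hwk, real_inner_comm (n k) w, hkw] at q4
  have hA : 0 < inner ℝ (n j) (n j) := real_inner_self_pos.2 fun h => by simp [h] at hju
  have hC : 0 < inner ℝ (n k) (n k) := real_inner_self_pos.2 fun h => by simp [h] at hkw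
  have hU : 0 < inner ℝ u u := real_inner_self_pos.2 fun h => by simp [h] at hju
  rw [dihedralAngle, InnerProductGeometry.angle, hinv, hinv, hinv, norm_eq_sqrt_real_inner u,
    norm_eq_sqrt_real_inner w]
  rw [real_inner_comm u w] at q4
  generalize inner ℝ (n j) (n j) = A at *
  generalize inner ℝ (n j) (n k) = B at *
  generalize inner ℝ (n k) (n k) = C at *
  generalize inner ℝ u u = U at *
  generalize inner ℝ u w = S at *
  generalize inner ℝ w w = W at *
  congr 1
  obtain ⟨t, rfl⟩ : ∃ t, U = t * C := ⟨U / C, by field_simp⟩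
  have ht : 0 < t := pos_of_mul_pos_left hU hC.le
  have hS : S = -(t * B) := by
    have : C * (S + t * B) = 0 := by linear_combination -q2
    rcases mul_eq_zero.1 this with h | h
    · exact absurd h hC.ne'
    · linarith
  have hW : W = t * A := by
    have : C * (W - t * A) = 0 := by linear_combination q1 - q4
    rcases mul_eq_zero.1 this with h | h
    · exact absurd h hC.ne'
    · linarith
  subst hS hW
  have hAC : 0 < √A * √C := mul_pos (Real.sqrt_pos.2 hA) (Real.sqrt_pos.2 hC)
  have e1 : √(-(1 / 2) * A * (-(1 / 2) * C)) = √A * √C / 2 := by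
    rw [← Real.sqrt_mul hA.le, show -(1 / 2) * A * (-(1 / 2) * C) = A * C / 2 ^ 2 by ring,
      Real.sqrt_div (mul_pos hA hC).le, Real.sqrt_sq (by norm_num)]
  have e2 : √(t * C) * √(t * A) = t * (√A * √C) := by
    rw [Real.sqrt_mul ht.le, Real.sqrt_mul ht.le]
    linear_combination (√A * √C) * Real.mul_self_sqrt ht.le
  rw [e1, e2]
  field_simp

end Simplex

/-! ### The spaces and the maps of the two sequences -/

/-- The totally antisymmetric tensor. -/
def leviCivita (a b c d : Fin 4) : ℝ :=
  Matrix.det (Matrix.of fun i j : Fin 4 => if ![a, b, c, d] i = j then (1 : ℝ) else 0)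

namespace Triangulation.Placement

variable {T : Triangulation Γ V P} (R : T.Placement)

/-- The rotational part of the motion assigned to `g`. -/
def rot (g : Γ) : E4 ≃ₗᵢ[ℝ] E4 := (R.rep g).linearIsometryEquiv

/-- The matrix of the rotational part. -/
def rotMatrix (g : Γ) : Matrix (Fin 4) (Fin 4) ℝ :=
  Matrix.of fun i j => R.rot g (EuclideanSpace.single j 1) i

/-- The Lie algebra `𝔢₄` of infinitesimal motions `x ↦ A x + b`, with `A` antisymmetric. -/
def _root_.EuclComplex.motions : Submodule ℝ (E4 →ᵃ[ℝ] E4) where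
  carrier := {ξ | ∀ x : E4, inner ℝ (ξ.linear x) x = 0}
  add_mem' := by
    intro a b ha hb x
    simp [inner_add_left, ha x, hb x]
  zero_mem' := by intro x; simp
  smul_mem' := by
    intro c a ha x
    simp [inner_smul_left, ha x]

/-- The subalgebra `𝔞` of infinitesimal motions that commute with the image of the
representation. -/
def commutant : Submodule ℝ (E4 →ᵃ[ℝ] E4) where
  carrier := {ξ | ξ ∈ motions ∧ ∀ (g : Γ) (x : E4), ξ (R.rep g x) = R.rot g (ξ x)}
  add_mem' := by
    rintro a b ⟨ha, ha'⟩ ⟨hb, hb'⟩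
    exact ⟨motions.add_mem ha hb, fun g x => by simp [ha' g x, hb' g x]⟩
  zero_mem' := ⟨motions.zero_mem, fun g x => by simp⟩
  smul_mem' := by
    rintro c a ⟨ha, ha'⟩
    exact ⟨motions.smul_mem c ha, fun g x => by simp [ha' g x]⟩

/-- Infinitesimal deformations of the representation: the motion assigned to `g` moves with
velocity `c g (y)` at the point `y` of its image, and the homomorphism property is preserved. -/
def deformations : Submodule ℝ (Γ → E4 →ᵃ[ℝ] E4) where
  carrier := {c | (∀ g, c g ∈ motions) ∧
    ∀ (g h : Γ) (x : E4),
      c (g * h) (R.rep g (R.rep h x)) =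
        c g (R.rep g (R.rep h x)) + R.rot g (c h (R.rep h x))}
  add_mem' := by
    rintro a b ⟨ha, ha'⟩ ⟨hb, hb'⟩
    refine ⟨fun g => motions.add_mem (ha g) (hb g), fun g h x => ?_⟩
    simp only [Pi.add_apply, AffineMap.coe_add, ha' g h x, hb' g h x, map_add]
    abel
  zero_mem' := ⟨fun g => motions.zero_mem, fun g h x => by simp⟩
  smul_mem' := by
    rintro r a ⟨ha, ha'⟩
    refine ⟨fun g => motions.smul_mem r (ha g), fun g h x => ?_⟩
    simp only [Pi.smul_apply, AffineMap.coe_smul, ha' g h x, map_smul, smul_add]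

/-- The infinitesimal deformations that come from conjugating the representation by motions. -/
def conjugations : Submodule ℝ (Γ → E4 →ᵃ[ℝ] E4) where
  carrier := {c | ∃ ξ ∈ motions, ∀ (g : Γ) (x : E4),
    c g (R.rep g x) = ξ (R.rep g x) - R.rot g (ξ x)}
  add_mem' := by
    rintro a b ⟨ξ, hξ, ha⟩ ⟨η, hη, hb⟩
    refine ⟨ξ + η, motions.add_mem hξ hη, fun g x => ?_⟩
    simp only [Pi.add_apply, AffineMap.coe_add, ha g x, hb g x, map_add]
    abel
  zero_mem' := ⟨0, motions.zero_mem, fun g x => by simp⟩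
  smul_mem' := by
    rintro r a ⟨ξ, hξ, ha⟩
    refine ⟨r • ξ, motions.smul_mem r hξ, fun g x => ?_⟩
    simp only [Pi.smul_apply, AffineMap.coe_smul, ha g x, map_smul, smul_sub]

/-- `G` is a space `(dg)` of differentials of the parameters of the representation: it contains
exactly one representative of each infinitesimal deformation modulo conjugation. -/
def IsParameterSpace (G : Submodule ℝ (Γ → E4 →ᵃ[ℝ] E4)) : Prop :=
  G ⊓ R.conjugations = ⊥ ∧ G ⊔ R.conjugations = R.deformations

/-- The space `(dx and dg)`: differentials of the positions of all lifts of the vertices that are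
compatible with a deformation of the representation from `(dg)`. (The values of `dx` at one lift of
each vertex of `M`, together with `dg`, are arbitrary and determine the rest.) -/
def positionSpace (G : Submodule ℝ (Γ → E4 →ᵃ[ℝ] E4)) :
    Submodule ℝ ((V → E4) × (Γ → E4 →ᵃ[ℝ] E4)) where
  carrier := {y | y.2 ∈ G ∧
    ∀ (g : Γ) (v : V), y.1 (g • v) = R.rot g (y.1 v) + y.2 g (R.pos (g • v))}
  add_mem' := by
    rintro a b ⟨ha, ha'⟩ ⟨hb, hb'⟩
    refine ⟨G.add_mem ha hb, fun g v => ?_⟩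
    simp only [Prod.fst_add, Prod.snd_add, Pi.add_apply, AffineMap.coe_add, ha' g v, hb' g v,
      map_add]
    abel
  zero_mem' := ⟨G.zero_mem, fun g v => by simp⟩
  smul_mem' := by
    rintro r a ⟨ha, ha'⟩
    refine ⟨G.smul_mem r ha, fun g v => ?_⟩
    simp only [Prod.smul_fst, Prod.smul_snd, Pi.smul_apply, AffineMap.coe_smul, ha' g v,
      map_smul, smul_add]

/-- The map `𝔞 → (dx and dg)`. -/
def motionToPosition (G : Submodule ℝ (Γ → E4 →ᵃ[ℝ] E4)) :
    R.commutant →ₗ[ℝ] R.positionSpace G where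
  toFun ξ := ⟨(fun v => ξ.1 (R.pos v), 0), G.zero_mem, fun g v => by
    simp only [R.equivariant, ξ.2.2 g, Pi.zero_apply, AffineMap.coe_zero, add_zero]⟩
  map_add' ξ η := by ext <;> simp
  map_smul' r ξ := by ext <;> simp

/-- The map `(dx and dg) → (dL_a)`: the differential of the squared edge lengths
(`dL_{AB} = 2 ⟨r_A - r_B, dx_A - dx_B⟩`, the two orders of `A, B` giving equal terms). -/
def positionToLength (G : Submodule ℝ (Γ → E4 →ᵃ[ℝ] E4)) :
    R.positionSpace G →ₗ[ℝ] (T.Face 1 → ℝ) where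
  toFun y a := ∑ u ∈ T.verts (T.lift a).1, ∑ w ∈ T.verts (T.lift a).1,
    inner ℝ (R.pos u - R.pos w) (y.1.1 u - y.1.1 w)
  map_add' y z := by
    funext a
    simp only [Submodule.coe_add, Prod.fst_add, Pi.add_apply, ← Finset.sum_add_distrib,
      ← inner_add_right]
    refine Finset.sum_congr rfl fun u _ => Finset.sum_congr rfl fun w _ => ?_
    congr 1
    abel
  map_smul' r y := by
    funext a
    simp only [Submodule.coe_smul, Prod.smul_fst, Pi.smul_apply, smul_eq_mul, RingHom.id_apply,
      Finset.mul_sum, ← smul_sub, inner_smul_right]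

/-- The squared lengths of the edges of `M`. -/
def sqLength (a : T.Face 1) : ℝ :=
  (∑ u ∈ T.verts (T.lift a).1, ∑ w ∈ T.verts (T.lift a).1, ‖R.pos u - R.pos w‖ ^ 2) / 2

/-- The sign of a 4-simplex: whether its placement in `ℝ⁴` preserves the orientation. -/
def simplexSign (o : T.Orientation) (s : T.Cell 4) : ℝ :=
  Real.sign (Matrix.det (Matrix.of fun i j : Fin 4 =>
    (R.pos (o.ord s i.succ) - R.pos (o.ord s 0)) j))

open Classical in
/-- The squared distances between the vertices of `s`, for given squared edge lengths `L`. -/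
def _root_.EuclComplex.Triangulation.sqDist (T : Triangulation Γ V P) (L : T.Face 1 → ℝ)
    (s : T.Cell 4) (u w : T.verts s.1) : ℝ :=
  if h : u = w then 0 else L (T.proj (T.edge s u w h))

open Classical in
/-- The dihedral angle of `s` at its triangle `i`, for given squared edge lengths. The vertices of
`s` outside `i` form a pair, counted in both orders. -/
def _root_.EuclComplex.Triangulation.angleAt (T : Triangulation Γ V P) (L : T.Face 1 → ℝ)
    (s : T.Cell 4) (i : T.Cell 2) : ℝ :=
  (∑ x ∈ (Finset.univ.filter fun v : T.verts s.1 => v.1 ∉ T.verts i.1).offDiag,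
    dihedralAngle (T.sqDist L s) x.1 x.2) / 2

/-- The deficit angle `ω_i` (defined modulo `2π`) at the triangles of `M`, as a function of
arbitrary squared edge lengths: minus the sum of the dihedral angles, taken with signs. -/
def deficit (o : T.Orientation) (L : T.Face 1 → ℝ) (i : T.Face 2) : ℝ :=
  -∑ᶠ (s : T.Cell 4) (_ : (T.lift i).1 < s.1), R.simplexSign o s * T.angleAt L s (T.lift i)

/-- The map `(dL_a) → (dω_i)` with matrix `(∂ω_i/∂L_a)`. -/
def lengthToDeficit (o : T.Orientation) : (T.Face 1 → ℝ) →ₗ[ℝ] (T.Face 2 → ℝ) :=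
  (fderiv ℝ (R.deficit o) R.sqLength).toLinearMap

open Classical in
/-- The map `(dS_i) → (dΩ_a)`, whose matrix `(∂Ω_a/∂S_i)` is the transpose of
`(∂ω_i/∂L_a)`. -/
def areaToDual (o : T.Orientation) : (T.Face 2 → ℝ) →ₗ[ℝ] (T.Face 1 → ℝ) :=
  (LinearMap.toMatrix' (R.lengthToDeficit o)).transpose.mulVecLin

/-- The space `(dσ)` of vertex deviations: bivectors at the vertices of `M`, that is, families of
bivectors at the vertices of the covering which the deck transformations carry into each other. -/
def vertexDeviations : Submodule ℝ (V → Matrix (Fin 4) (Fin 4) ℝ) where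
  carrier := {σ | (∀ v, (σ v).transpose = -σ v) ∧
    ∀ (g : Γ) (v : V), σ (g • v) = R.rotMatrix g * σ v * (R.rotMatrix g).transpose}
  add_mem' := by
    rintro a b ⟨ha, ha'⟩ ⟨hb, hb'⟩
    refine ⟨fun v => ?_, fun g v => ?_⟩
    · simp only [Pi.add_apply, Matrix.transpose_add, ha v, hb v, neg_add]
    · simp only [Pi.add_apply, ha' g v, hb' g v, Matrix.mul_add, Matrix.add_mul]
  zero_mem' := ⟨fun v => by simp, fun g v => by simp⟩
  smul_mem' := by
    rintro r a ⟨ha, ha'⟩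
    refine ⟨fun v => ?_, fun g v => ?_⟩
    · simp only [Pi.smul_apply, Matrix.transpose_smul, ha v, smul_neg]
    · simp only [Pi.smul_apply, ha' g v, Matrix.mul_smul, Matrix.smul_mul]

/-- The family of bivectors `dτ_{αβ} + ∑ ε_{αβγδ} (r_A)_γ ds_δ`. -/
def trivialFamily : (Matrix (Fin 4) (Fin 4) ℝ × E4) →ₗ[ℝ] (V → Matrix (Fin 4) (Fin 4) ℝ) where
  toFun y v := Matrix.of fun α β =>
    y.1 α β + ∑ γ, ∑ δ, leviCivita α β γ δ * R.pos v γ * y.2 δ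
  map_add' y z := by
    funext v
    ext α β
    simp only [Prod.fst_add, Prod.snd_add, Matrix.add_apply, PiLp.add_apply, mul_add,
      Finset.sum_add_distrib, Matrix.of_apply, Pi.add_apply]
    ring
  map_smul' r y := by
    funext v
    ext α β
    simp only [Prod.smul_fst, Prod.smul_snd, Matrix.smul_apply, PiLp.smul_apply, smul_eq_mul,
      Matrix.of_apply, Pi.smul_apply, RingHom.id_apply, mul_add, Finset.mul_sum]
    congr 1
    refine Finset.sum_congr rfl fun γ _ => Finset.sum_congr rfl fun δ _ => by ring

/-- The space `(dσ)₀`: pairs of an antisymmetric tensor `dτ` and a vector `ds` whose family of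
bivectors is correctly determined, i.e. is the same at all inverse images of a vertex of `M`
after the transformation to a common coordinate system. -/
def trivialDeviations : Submodule ℝ (Matrix (Fin 4) (Fin 4) ℝ × E4) where
  carrier := {y | y.1.transpose = -y.1 ∧ R.trivialFamily y ∈ R.vertexDeviations}
  add_mem' := by
    rintro a b ⟨ha, ha'⟩ ⟨hb, hb'⟩
    refine ⟨?_, ?_⟩
    · simp only [Prod.fst_add, Matrix.transpose_add, ha, hb, neg_add]
    · rw [map_add]; exact R.vertexDeviations.add_mem ha' hb'
  zero_mem' := ⟨by simp, by rw [map_zero]; exact R.vertexDeviations.zero_mem⟩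
  smul_mem' := by
    rintro r a ⟨ha, ha'⟩
    refine ⟨?_, ?_⟩
    · simp only [Prod.smul_fst, Matrix.transpose_smul, ha, smul_neg]
    · rw [map_smul]; exact R.vertexDeviations.smul_mem r ha'

/-- The map `(dσ)₀ → (dσ)`. -/
def trivialToVertex : R.trivialDeviations →ₗ[ℝ] R.vertexDeviations :=
  (R.trivialFamily.comp R.trivialDeviations.subtype).codRestrict _ fun y => y.2.2

/-- The space `(dv_a)` of edge deviations: vectors at the edges of `M`, orthogonal to the edges. -/
def edgeDeviations : Submodule ℝ (T.Cell 1 → E4) where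
  carrier := {w | (∀ a, ∀ x ∈ T.verts a.1, ∀ y ∈ T.verts a.1,
      inner ℝ (w a) (R.pos y - R.pos x) = 0) ∧
    ∀ (g : Γ) (a : T.Cell 1), w (g • a) = R.rot g (w a)}
  add_mem' := by
    rintro a b ⟨ha, ha'⟩ ⟨hb, hb'⟩
    refine ⟨fun e x hx y hy => ?_, fun g e => ?_⟩
    · simp only [Pi.add_apply, inner_add_left, ha e x hx y hy, hb e x hx y hy, add_zero]
    · simp only [Pi.add_apply, ha' g e, hb' g e, map_add]
  zero_mem' := ⟨fun e x _ y _ => by simp, fun g e => by simp⟩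
  smul_mem' := by
    rintro r a ⟨ha, ha'⟩
    refine ⟨fun e x hx y hy => ?_, fun g e => ?_⟩
    · simp only [Pi.smul_apply, inner_smul_left, ha e x hx y hy, mul_zero]
    · simp only [Pi.smul_apply, ha' g e, map_smul]

/-- The deviation of an edge generated by deviations of its two ends: the sum over the ends `A`,
with `B` the other end, of `(1/L_{AB}) ∑_α l_α (dσ_A)_{αβ}`, where `l` is the vector from `A` to
`B`. (The terms with `A = B` vanish.) -/
def edgeFormula (σ : V → Matrix (Fin 4) (Fin 4) ℝ) (a : T.Cell 1) : E4 :=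
  ∑ A ∈ T.verts a.1, ∑ B ∈ T.verts a.1,
    WithLp.toLp 2 fun β =>
      1 / ‖R.pos B - R.pos A‖ ^ 2 * ∑ α, (R.pos B - R.pos A) α * σ A α β

theorem rot_apply (g : Γ) (x : E4) (i : Fin 4) :
    R.rot g x i = ∑ j, R.rotMatrix g i j * x j := by
  have hx : x = ∑ j, x j • EuclideanSpace.single j (1 : ℝ) := by
    ext k
    simp [Pi.single_apply]
  conv_lhs => rw [hx]
  simp only [map_sum, map_smul, WithLp.ofLp_sum, Finset.sum_apply, PiLp.smul_apply, smul_eq_mul,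
    rotMatrix, Matrix.of_apply, mul_comm]

theorem rotMatrix_transpose_mul (g : Γ) :
    (R.rotMatrix g).transpose * R.rotMatrix g = 1 := by
  ext i j
  have h := (R.rot g).inner_map_map (EuclideanSpace.single i (1 : ℝ))
    (EuclideanSpace.single j (1 : ℝ))
  rw [EuclideanSpace.inner_single_left] at h
  simp only [PiLp.inner_apply, RCLike.inner_apply, conj_trivial] at h
  simp only [Matrix.mul_apply, Matrix.transpose_apply, rotMatrix, Matrix.of_apply,
    Matrix.one_apply]
  rw [Finset.sum_congr rfl fun k _ => mul_comm _ _, h]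
  simp

theorem edgeFormula_mem {σ : V → Matrix (Fin 4) (Fin 4) ℝ} (hσ : σ ∈ R.vertexDeviations) :
    R.edgeFormula σ ∈ R.edgeDeviations := by
  classical
  obtain ⟨hs, he⟩ := hσ
  refine ⟨fun a x hx y hy => ?_, fun g a => ?_⟩
  · rw [edgeFormula, sum_inner]
    refine Finset.sum_eq_zero fun A hA => ?_
    rw [sum_inner]
    refine Finset.sum_eq_zero fun B hB => ?_
    have key : ∀ l : E4, ∑ β, (∑ α, l α * σ A α β) * l β = 0 := by
      intro l
      have hab : ∀ α β, σ A β α = -σ A α β := fun α β => by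
        have := congrFun (congrFun (hs A) α) β
        simpa using this
      have h1 : ∑ β, (∑ α, l α * σ A α β) * l β = -∑ β, (∑ α, l α * σ A α β) * l β := by
        conv_lhs =>
          simp only [Finset.sum_mul]
          rw [Finset.sum_comm]
        rw [← Finset.sum_neg_distrib]
        refine Finset.sum_congr rfl fun α _ => ?_
        rw [Finset.sum_mul, ← Finset.sum_neg_distrib]
        refine Finset.sum_congr rfl fun β _ => ?_
        rw [hab β α]
        ring
      linarith
    have key2 : ∀ c : ℝ, inner ℝ (WithLp.toLp 2 fun β =>
        1 / ‖R.pos B - R.pos A‖ ^ 2 * ∑ α, (R.pos B - R.pos A) α * σ A α β : E4)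
        (c • (R.pos B - R.pos A)) = 0 := by
      intro c
      rw [inner_smul_right]
      simp only [PiLp.inner_apply, RCLike.inner_apply, conj_trivial]
      have := key (R.pos B - R.pos A)
      have h2 : ∑ β, (R.pos B - R.pos A) β *
          (1 / ‖R.pos B - R.pos A‖ ^ 2 * ∑ α, (R.pos B - R.pos A) α * σ A α β) =
          1 / ‖R.pos B - R.pos A‖ ^ 2 *
            ∑ β, (∑ α, (R.pos B - R.pos A) α * σ A α β) * (R.pos B - R.pos A) β := by
        rw [Finset.mul_sum]
        exact Finset.sum_congr rfl fun β _ => by ring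
      rw [h2, this]
      simp
    by_cases hAB : A = B
    · subst hAB
      rw [sub_self] at *
      have h0 : (WithLp.toLp 2 fun β => 1 / ‖(0 : E4)‖ ^ 2 * ∑ α, (0 : E4) α * σ A α β : E4) = 0 := by
        ext β
        simp
      rw [h0, inner_zero_left]
    · have hpair : T.verts a.1 = {A, B} := by
        symm
        apply Finset.eq_of_subset_of_card_le
        · intro z hz
          rcases Finset.mem_insert.1 hz with rfl | hz
          · exact hA
          · rw [Finset.mem_singleton.1 hz]; exact hB
        · rw [a.2, Finset.card_pair hAB]
      rw [hpair] at hx hy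
      simp only [Finset.mem_insert, Finset.mem_singleton] at hx hy
      have : ∃ c : ℝ, R.pos y - R.pos x = c • (R.pos B - R.pos A) := by
        rcases hx with rfl | rfl <;> rcases hy with rfl | rfl
        · exact ⟨0, by simp⟩
        · exact ⟨1, by simp⟩
        · exact ⟨-1, by simp⟩
        · exact ⟨0, by simp⟩
      obtain ⟨c, hc⟩ := this
      rw [hc]
      exact key2 c
  · have hinj : Set.InjOn (g • · : V → V) (T.verts a.1) := (MulAction.injective g).injOn
    have hv : T.verts (g • a).1 = (T.verts a.1).image (g • ·) := T.verts_smul g a.1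
    rw [edgeFormula, hv, Finset.sum_image hinj, edgeFormula, map_sum]
    refine Finset.sum_congr rfl fun A _ => ?_
    rw [Finset.sum_image hinj, map_sum]
    refine Finset.sum_congr rfl fun B _ => ?_
    have hd : R.pos (g • B) - R.pos (g • A) = R.rot g (R.pos B - R.pos A) := by
      rw [R.equivariant, R.equivariant, ← vsub_eq_sub, ← vsub_eq_sub]
      exact ((R.rep g).map_vsub _ _).symm
    rw [hd, (R.rot g).norm_map, he g A]
    set l := R.pos B - R.pos A
    ext β
    rw [R.rot_apply]
    have h3 : Matrix.vecMul (R.rot g l) (R.rotMatrix g * σ A * (R.rotMatrix g).transpose) =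
        (R.rotMatrix g).mulVec (Matrix.vecMul l (σ A)) := by
      have h4 : (R.rot g l : Fin 4 → ℝ) = Matrix.vecMul l (R.rotMatrix g).transpose := by
        funext i
        rw [R.rot_apply, Matrix.vecMul_transpose]
        rfl
      rw [h4, Matrix.vecMul_vecMul, ← Matrix.mul_assoc, ← Matrix.mul_assoc,
        R.rotMatrix_transpose_mul, Matrix.one_mul, ← Matrix.vecMul_vecMul,
        Matrix.vecMul_transpose]
    have h5 := congrFun h3 β
    simp only [Matrix.vecMul, Matrix.mulVec, dotProduct] at h5
    change 1 / ‖l‖ ^ 2 * _ = _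
    rw [h5, Finset.mul_sum]
    refine Finset.sum_congr rfl fun j _ => ?_
    change _ = _ * (1 / ‖l‖ ^ 2 * _)
    ring

/-- The map `(dσ) → (dv_a)`. -/
def vertexToEdge : R.vertexDeviations →ₗ[ℝ] R.edgeDeviations where
  toFun σ := ⟨R.edgeFormula σ.1, R.edgeFormula_mem σ.2⟩
  map_add' σ τ := by
    apply Subtype.ext
    funext a
    ext β
    simp only [edgeFormula, Submodule.coe_add, Pi.add_apply, Matrix.add_apply, mul_add,
      Finset.sum_add_distrib, PiLp.add_apply, WithLp.ofLp_sum, Finset.sum_apply]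
  map_smul' r σ := by
    apply Subtype.ext
    funext a
    ext β
    simp only [edgeFormula, Submodule.coe_smul, Pi.smul_apply, Matrix.smul_apply, smul_eq_mul,
      PiLp.smul_apply, WithLp.ofLp_sum, Finset.sum_apply, RingHom.id_apply, Finset.mul_sum]
    refine Finset.sum_congr rfl fun A _ => Finset.sum_congr rfl fun B _ =>
      Finset.sum_congr rfl fun α _ => by ring

open Classical in
/-- The midpoint of the side of the triangle `i` opposite to its vertex `c`. -/
def sideMidpoint (i : T.Cell 2) (c : T.verts i.1) : E4 :=
  (1 / 2 : ℝ) • ∑ A ∈ (T.verts i.1).erase c.1, R.pos A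

/-- The area of the triangle `i` when its sides have deviations `w`: four times the area of the
triangle formed by the midpoints of the sides, each shifted by the deviation of its side. -/
def deviatedArea (i : T.Cell 2) (w : T.verts i.1 → E4) : ℝ :=
  4 * heronArea fun c => R.sideMidpoint i c + w c

/-- The map `(dv_a) → (dS_i)`: the differential of the areas at zero deviations. -/
def edgeToArea : R.edgeDeviations →ₗ[ℝ] (T.Face 2 → ℝ) where
  toFun w i := fderiv ℝ (R.deviatedArea (T.lift i)) 0 fun c => w.1 (T.side (T.lift i) c)
  map_add' w z := by
    funext i
    rw [Pi.add_apply, ← map_add]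
    rfl
  map_smul' r w := by
    funext i
    rw [RingHom.id_apply, Pi.smul_apply, ← map_smul]
    rfl

end Triangulation.Placement

/-- The transpose of a linear map with values in a space of columns: an operator from columns to
the dual space. In any basis of `W`, the standard basis of columns and the dual basis, its matrix
is the transpose of that of `φ`. -/
def columnTranspose {W ι : Type*} [AddCommGroup W] [Module ℝ W] [Fintype ι]
    (φ : W →ₗ[ℝ] (ι → ℝ)) : (ι → ℝ) →ₗ[ℝ] Module.Dual ℝ W where
  toFun y := 
    { toFun := fun w => y ⬝ᵥ φ w
      map_add' := fun a b => by rw [map_add, dotProduct_add]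
      map_smul' := fun r a => by rw [map_smul, dotProduct_smul, RingHom.id_apply] }
  map_add' y z := by ext w; simp [add_dotProduct]
  map_smul' r y := by ext w; simp [smul_dotProduct]

end

end EuclComplex

open EuclComplex

/-!
The exactness of the two sequences is infinitesimal rigidity, local and global. A nondegenerate
simplex is infinitesimally rigid (`exists_motion`), and an infinitesimal motion is determined by its
values on a tetrahedron (`motion_ext`). Since any two 4-simplices are joined by a chain of
4-simplices with common tetrahedra (`adjacent_connected`), velocities of the vertices of the
covering that preserve all edge lengths come from one infinitesimal motion
(`exists_motion_eq_pos`). This gives exactness at `(dx and dg)`, and it also produces the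
deformation of the representation belonging to a family of displacements (`exists_deformation`).

All statements about the deficit angles rest on one formula. A deformation `dL` of the edge lengths
is realized on every 4-simplex `s` by an affine velocity field `A s` (`exists_strain`). On a
tetrahedron `f` the fields of its two 4-simplices differ by an infinitesimal motion; a `LocalFields`
records these jumps, relative to a comparison field on `f`, as motions `m f s`. The differential of
a dihedral angle is the difference of the angular velocities of its two faces (`gradient_rate_eq`,
`exists_hasFDerivAt_dihedralAngle`). Hence `dω_i` is, up to the area factor, the sum of the jumps of
angular velocity over the tetrahedra around the triangle `i`, with the signs `flagSign`
(`lengthToDeficit_apply`). The signs are opposite on the two sides of a tetrahedron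
(`flagSign_coherent`), on the two tetrahedra between a triangle and a 4-simplex, and on the two
triangles between an edge and a tetrahedron. It follows that the sum of jumps around `i` is the
infinitesimal rotation around the plane of `i` with angular velocity proportional to `dω_i`
(`LocalFields.inner_jumpSum`). Consequences:

* If `dL` comes from displacements of the vertices, the fields agree on tetrahedra and the sums
  cancel (`lengthToDeficit_comp_positionToLength`).
* The sums of jumps around all triangles containing a given edge cancel
  (`LocalFields.sum_jumpSum`). This is a vector relation between the `dω_i` at each edge
  (`sum_lengthToDeficit_mul`), and Heron's formula turns it into the vanishing of `∑ dω_i dS_i` for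
  the area differentials generated by edge deviations (`dotProduct_lengthToDeficit`).
* If `dω = 0`, the sum of jumps around each triangle vanishes. Around a triangle the jumps can then
  be removed by infinitesimal motions of the 4-simplices, because the link is a circle
  (`exists_coboundary`, `LocalFields.exists_hasJumps_triangle`). Simple connectivity of the links of
  edges and vertices and of the covering itself extends this to all 4-simplices
  (`PosetSimplyConnected.exists_potential`, `exists_hasJumps`). The corrected fields agree on
  tetrahedra, so they define displacements of the vertices with differential `dL`
  (`exists_displacement`), which after subtraction of one infinitesimal motion lie in `(dx and dg)`
  (`exact_positionToLength`).

The remaining compositions are identities for bivectors, and the statements about dual spaces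
follow by transposition (`exact_columnTranspose_dualMap`, `exact_areaToDual`).
-/

namespace EuclComplex

noncomputable section

/-! ### The volume form of four-space and antisymmetric operators -/

theorem inner_eq_sum_four (x y : E4) :
    inner ℝ x y = x 0 * y 0 + x 1 * y 1 + x 2 * y 2 + x 3 * y 3 := by
  simp only [PiLp.inner_apply, RCLike.inner_apply, conj_trivial, Fin.sum_univ_four]
  ring

/-- The volume form of four-space: the determinant of four vectors. -/
def vol (a b c d : E4) : ℝ :=
  Matrix.det (Matrix.of ![a.ofLp, b.ofLp, c.ofLp, d.ofLp])

theorem vol_eq (a b c d : E4) : vol a b c d =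
    (a 0 * b 1 - a 1 * b 0) * (c 2 * d 3 - c 3 * d 2)
    - (a 0 * b 2 - a 2 * b 0) * (c 1 * d 3 - c 3 * d 1)
    + (a 0 * b 3 - a 3 * b 0) * (c 1 * d 2 - c 2 * d 1)
    + (a 1 * b 2 - a 2 * b 1) * (c 0 * d 3 - c 3 * d 0)
    - (a 1 * b 3 - a 3 * b 1) * (c 0 * d 2 - c 2 * d 0)
    + (a 2 * b 3 - a 3 * b 2) * (c 0 * d 1 - c 1 * d 0) := by
  simp [vol, Matrix.det_succ_row_zero, Fin.sum_univ_succ, Fin.succAbove]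
  ring

/-- The volume form as a linear function of its last argument. -/
def volLast (a b c : E4) : E4 →ₗ[ℝ] ℝ where
  toFun d := vol a b c d
  map_add' x y := by simp only [vol_eq, PiLp.add_apply]; ring
  map_smul' r x := by simp only [vol_eq, PiLp.smul_apply, smul_eq_mul, RingHom.id_apply]; ring

theorem volLast_apply (a b c d : E4) : volLast a b c d = vol a b c d := rfl

theorem vol_swap_last (a b c d : E4) : vol a b d c = -vol a b c d := by
  simp only [vol_eq]; ring

theorem vol_swap_middle (a b c d : E4) : vol a c b d = -vol a b c d := by
  simp only [vol_eq]; ring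

/-- Cramer's rule for four vectors. -/
theorem vol_smul_eq (a b c d x : E4) : vol a b c d • x =
    vol x b c d • a + vol a x c d • b + vol a b x d • c + vol a b c x • d := by
  ext i
  simp only [vol_eq, PiLp.add_apply, PiLp.smul_apply, smul_eq_mul]
  fin_cases i <;> simp <;> ring

/-- The Gram determinant formula for two orthogonal pairs of vectors. -/
theorem vol_sq_of_orthogonal {a b c d : E4} (hac : inner ℝ a c = 0) (had : inner ℝ a d = 0)
    (hbc : inner ℝ b c = 0) (hbd : inner ℝ b d = 0) :
    vol a b c d ^ 2 = (inner ℝ a a * inner ℝ b b - inner ℝ a b ^ 2) *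
      (inner ℝ c c * inner ℝ d d - inner ℝ c d ^ 2) := by
  have h : vol a b c d ^ 2 = Matrix.det (Matrix.of
      ![![inner ℝ a a, inner ℝ a b, inner ℝ a c, inner ℝ a d],
        ![inner ℝ b a, inner ℝ b b, inner ℝ b c, inner ℝ b d],
        ![inner ℝ c a, inner ℝ c b, inner ℝ c c, inner ℝ c d],
        ![inner ℝ d a, inner ℝ d b, inner ℝ d c, inner ℝ d d]]) := by
    rw [sq, vol]
    conv_lhs => rw [← Matrix.det_transpose, Matrix.det_transpose]
    nth_rewrite 2 [← Matrix.det_transpose]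
    rw [← Matrix.det_mul]
    congr 1
    ext i j
    simp only [Matrix.mul_apply, Matrix.transpose_apply, Fin.sum_univ_four]
    fin_cases i <;> fin_cases j <;>
      simp [-inner_self_eq_norm_sq_to_K, inner_eq_sum_four]
  rw [h, real_inner_comm a c, real_inner_comm a d, real_inner_comm b c, real_inner_comm b d,
    hac, had, hbc, hbd, real_inner_comm a b, real_inner_comm c d]
  simp [Matrix.det_succ_row_zero, Fin.sum_univ_succ, Fin.succAbove]
  ring

/-- A vector whose exterior product with `a` vanishes is orthogonal to everything that is
orthogonal to `a`. -/
theorem inner_eq_zero_of_vol_eq_zero {a v w : E4} (ha : a ≠ 0)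
    (h : ∀ x y, vol a v x y = 0) (hw : inner ℝ a w = 0) : inner ℝ v w = 0 := by
  have key : ∀ i j : Fin 4, a i * v j = a j * v i := by
    have e : ∀ i j : Fin 4, vol a v (EuclideanSpace.single i 1) (EuclideanSpace.single j 1) = 0 :=
      fun i j => h _ _
    have e01 := e 0 1; have e02 := e 0 2; have e03 := e 0 3
    have e12 := e 1 2; have e13 := e 1 3; have e23 := e 2 3
    simp [vol_eq] at e01 e02 e03 e12 e13 e23
    intro i j
    fin_cases i <;> fin_cases j <;> simp <;> linarith
  have h2 : inner ℝ a a * inner ℝ v w = 0 := by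
    have : inner ℝ a a * inner ℝ v w = inner ℝ a v * inner ℝ a w := by
      simp only [inner_eq_sum_four]
      have k01 := key 0 1; have k02 := key 0 2; have k03 := key 0 3
      have k12 := key 1 2; have k13 := key 1 3; have k23 := key 2 3
      linear_combination (w 0 * a 1 - w 1 * a 0) * (-k01) + (w 0 * a 2 - w 2 * a 0) * (-k02)
        + (w 0 * a 3 - w 3 * a 0) * (-k03) + (w 1 * a 2 - w 2 * a 1) * (-k12)
        + (w 1 * a 3 - w 3 * a 1) * (-k13) + (w 2 * a 3 - w 3 * a 2) * (-k23)
    rw [this, hw, mul_zero]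
  rcases mul_eq_zero.1 h2 with h3 | h3
  · exact absurd (inner_self_eq_zero.1 h3) ha
  · exact h3

/-- The component of `y` orthogonal to two vectors. -/
def perp (l₁ l₂ y : E4) : E4 := (Submodule.span ℝ {l₁, l₂})ᗮ.starProjection y

theorem inner_left_perp (l₁ l₂ y : E4) : inner ℝ l₁ (perp l₁ l₂ y) = 0 :=
  Submodule.inner_right_of_mem_orthogonal (Submodule.subset_span (by simp))
    (Submodule.starProjection_apply_mem _ _)

theorem inner_right_perp (l₁ l₂ y : E4) : inner ℝ l₂ (perp l₁ l₂ y) = 0 :=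
  Submodule.inner_right_of_mem_orthogonal (Submodule.subset_span (by simp))
    (Submodule.starProjection_apply_mem _ _)

theorem exists_perp_eq (l₁ l₂ y : E4) :
    ∃ a b : ℝ, perp l₁ l₂ y = y - a • l₁ - b • l₂ := by
  have h := Submodule.starProjection_add_starProjection_orthogonal
    (K := Submodule.span ℝ {l₁, l₂}) y
  have hm : (Submodule.span ℝ {l₁, l₂}).starProjection y ∈ Submodule.span ℝ {l₁, l₂} :=
    Submodule.starProjection_apply_mem _ _
  obtain ⟨a, b, hab⟩ := Submodule.mem_span_pair.1 hm
  refine ⟨a, b, ?_⟩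
  rw [sub_sub, hab, perp]
  exact eq_sub_of_add_eq' h

/-- The component of an operator along the plane orthogonal to `l₁` and `l₂`. -/
def normalRate (l₁ l₂ : E4) (X : E4 →ₗ[ℝ] E4) : ℝ :=
  (∑ i : Fin 4, vol l₁ l₂ (EuclideanSpace.single i 1) (X (EuclideanSpace.single i 1))) / 2

/-- Antisymmetric operators. -/
def IsSkew (X : E4 →ₗ[ℝ] E4) : Prop := ∀ x, inner ℝ (X x) x = 0

theorem IsSkew.inner_comm {X : E4 →ₗ[ℝ] E4} (h : IsSkew X) (x y : E4) :
    inner ℝ (X x) y = -inner ℝ (X y) x := by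
  have h1 := h (x + y)
  simp only [map_add, inner_add_left, inner_add_right, h x, h y] at h1
  linarith

theorem IsSkew.exists_coords {X : E4 →ₗ[ℝ] E4} (h : IsSkew X) :
    ∃ a b c d e f : ℝ, ∀ x : E4, X x 0 = a * x 1 + b * x 2 + c * x 3 ∧
      X x 1 = -a * x 0 + d * x 2 + e * x 3 ∧ X x 2 = -b * x 0 - d * x 1 + f * x 3 ∧
      X x 3 = -c * x 0 - e * x 1 - f * x 2 := by
  let s : Fin 4 → E4 := fun i => EuclideanSpace.single i 1
  have hs : ∀ i (x : E4), inner ℝ x (s i) = x i := fun i x => by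
    simp [s, EuclideanSpace.inner_single_right]
  have hk : ∀ (i : Fin 4) (x : E4), X x i = -inner ℝ (X (s i)) x := fun i x => by
    rw [← h.inner_comm, hs]
  have hd : ∀ i j, X (s i) j = -X (s j) i := fun i j => by rw [hk, hs]
  have h0 : ∀ i, X (s i) i = 0 := fun i => by have := hd i i; linarith
  refine ⟨X (s 1) 0, X (s 2) 0, X (s 3) 0, X (s 2) 1, X (s 3) 1, X (s 3) 2, fun x => ?_⟩
  simp only [hk _ x, inner_eq_sum_four, h0]
  rw [hd 0 1, hd 0 2, hd 0 3, hd 1 2, hd 1 3, hd 2 3]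
  refine ⟨?_, ?_, ?_, ?_⟩ <;> ring

/-- An antisymmetric operator rotates all the vectors of the plane orthogonal to `l₁` and `l₂` at
the same rate. -/
theorem IsSkew.vol_apply {X : E4 →ₗ[ℝ] E4} (h : IsSkew X) {l₁ l₂ y : E4}
    (h₁ : inner ℝ l₁ y = 0) (h₂ : inner ℝ l₂ y = 0) :
    vol l₁ l₂ y (X y) = inner ℝ y y * normalRate l₁ l₂ X := by
  obtain ⟨a, b, c, d, e, f, hX⟩ := h.exists_coords
  simp only [normalRate, Fin.sum_univ_four, vol_eq, hX, inner_eq_sum_four] at *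
  simp
  -- the coefficients are the products of `l₂` and `l₁` with the Hodge dual of `X` at `y`
  linear_combination
    -(l₂ 0 * (f * y 1 - e * y 2 + d * y 3) + l₂ 1 * (-f * y 0 + c * y 2 - b * y 3)
      + l₂ 2 * (e * y 0 - c * y 1 + a * y 3) + l₂ 3 * (-d * y 0 + b * y 1 - a * y 2)) * h₁
    + (l₁ 0 * (f * y 1 - e * y 2 + d * y 3) + l₁ 1 * (-f * y 0 + c * y 2 - b * y 3)
      + l₁ 2 * (e * y 0 - c * y 1 + a * y 3) + l₁ 3 * (-d * y 0 + b * y 1 - a * y 2)) * h₂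

/-- An antisymmetric operator that annihilates two independent vectors is determined by its
component along the orthogonal plane. -/
theorem IsSkew.inner_apply_eq {X : E4 →ₗ[ℝ] E4} (h : IsSkew X) {l₁ l₂ a b : E4}
    (hV : vol l₁ l₂ a b ≠ 0) (h₁ : X l₁ = 0) (h₂ : X l₂ = 0) (x y : E4) :
    (inner ℝ l₁ l₁ * inner ℝ l₂ l₂ - inner ℝ l₁ l₂ ^ 2) * inner ℝ (X x) y =
      normalRate l₁ l₂ X * vol l₁ l₂ x y := by
  have step : ∀ x y, vol l₁ l₂ a b * inner ℝ (X x) y =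
      vol l₁ l₂ x b * inner ℝ (X a) y + vol l₁ l₂ a x * inner ℝ (X b) y := by
    intro x y
    have := congrArg (fun z => inner ℝ (X z) y) (vol_smul_eq l₁ l₂ a b x)
    simpa [inner_add_left, inner_smul_left, h₁, h₂] using this
  have key : ∀ x y, inner ℝ (X x) y = inner ℝ (X a) b / vol l₁ l₂ a b * vol l₁ l₂ x y := by
    intro x y
    have e1 := step x y
    have e2 := step y a
    have e3 := step y b
    rw [h a] at e2
    rw [h b] at e3
    have e4 := h.inner_comm y a
    have e5 := h.inner_comm y b
    have e6 := h.inner_comm b a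
    -- the Plücker relation of two vectors in a plane
    have pl : vol l₁ l₂ x b * vol l₁ l₂ a y - vol l₁ l₂ y b * vol l₁ l₂ a x =
        vol l₁ l₂ a b * vol l₁ l₂ x y := by
      have := congrArg (fun z => vol l₁ l₂ z y) (vol_smul_eq l₁ l₂ a b x)
      have p : vol l₁ l₂ (vol l₁ l₂ a b • x) y = vol l₁ l₂ a b * vol l₁ l₂ x y := by
        simp only [vol_eq, PiLp.smul_apply, smul_eq_mul]; ring
      have q : vol l₁ l₂ (vol x l₂ a b • l₁ + vol l₁ x a b • l₂ + vol l₁ l₂ x b • a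
          + vol l₁ l₂ a x • b) y =
          vol l₁ l₂ x b * vol l₁ l₂ a y + vol l₁ l₂ a x * vol l₁ l₂ b y := by
        generalize vol x l₂ a b = t1
        generalize vol l₁ x a b = t2
        generalize vol l₁ l₂ x b = t3
        generalize vol l₁ l₂ a x = t4
        simp only [vol_eq, PiLp.add_apply, PiLp.smul_apply, smul_eq_mul]; ring
      simp only [p, q] at this
      rw [this, vol_swap_last l₁ l₂ b y]
      ring
    rw [div_mul_eq_mul_div, eq_div_iff hV]
    apply mul_left_cancel₀ hV
    rw [e4] at e2
    rw [e5] at e3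
    rw [e6] at e2
    linear_combination vol l₁ l₂ a b * e1 - vol l₁ l₂ x b * e2 - vol l₁ l₂ a x * e3 +
      inner ℝ (X a) b * pl
  set κ := inner ℝ (X a) b / vol l₁ l₂ a b
  have hs : ∀ i (x : E4), inner ℝ x (EuclideanSpace.single i (1 : ℝ)) = x i := fun i x => by
    simp [EuclideanSpace.inner_single_right]
  have hX : ∀ i j, X (EuclideanSpace.single i 1) j =
      κ * vol l₁ l₂ (EuclideanSpace.single i 1) (EuclideanSpace.single j 1) := fun i j => by
    rw [← hs, key]
  have hn : normalRate l₁ l₂ X =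
      κ * (inner ℝ l₁ l₁ * inner ℝ l₂ l₂ - inner ℝ l₁ l₂ ^ 2) := by
    simp only [normalRate, Fin.sum_univ_four]
    rw [vol_eq _ _ _ (X _), vol_eq _ _ _ (X _), vol_eq _ _ _ (X _), vol_eq _ _ _ (X _)]
    simp only [hX]
    simp [-inner_self_eq_norm_sq_to_K, vol_eq, inner_eq_sum_four]
    ring
  rw [key, hn]
  ring

/-! ### Infinitesimal motions -/

/-- An operator that is antisymmetric on a subspace can be changed outside of it to become
antisymmetric: `C P - (Q C P)ᵀ`, with the projections `P`, `Q` to the subspace and its orthogonal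
complement. -/
theorem exists_isSkew_eqOn (U : Submodule ℝ E4) (C : E4 →ₗ[ℝ] E4)
    (h : ∀ x ∈ U, inner ℝ (C x) x = 0) : ∃ X : E4 →ₗ[ℝ] E4, IsSkew X ∧ ∀ x ∈ U, X x = C x := by
  let p : E4 →ₗ[ℝ] E4 := U.starProjection.toLinearMap
  let q : E4 →ₗ[ℝ] E4 := Uᗮ.starProjection.toLinearMap
  refine ⟨C ∘ₗ p - LinearMap.adjoint (q ∘ₗ C ∘ₗ p), fun x => ?_, fun x hx => ?_⟩
  · have hx : x = p x + q x := (Submodule.starProjection_add_starProjection_orthogonal x).symm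
    have hpU : p x ∈ U := Submodule.starProjection_apply_mem _ _
    simp only [LinearMap.sub_apply, inner_sub_left, LinearMap.adjoint_inner_left,
      LinearMap.comp_apply]
    have h1 : inner ℝ x (q (C (p x))) = inner ℝ (q x) (C (p x)) :=
      (Submodule.inner_starProjection_left_eq_right Uᗮ x (C (p x))).symm
    have h2 : inner ℝ (C (p x)) x = inner ℝ (C (p x)) (p x + q x) := by rw [← hx]
    rw [h1, h2, inner_add_right, h _ hpU, real_inner_comm (q x)]
    ring
  · have hp : p x = x := Submodule.starProjection_eq_self_iff.2 hx
    have h0 : LinearMap.adjoint (q ∘ₗ C ∘ₗ p) x = 0 := by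
      refine ext_inner_right ℝ fun y => ?_
      rw [LinearMap.adjoint_inner_left, inner_zero_left]
      exact Submodule.inner_right_of_mem_orthogonal hx (Submodule.starProjection_apply_mem _ _)
    rw [LinearMap.sub_apply, h0, sub_zero, LinearMap.comp_apply, hp]

/-- An antisymmetric operator on four-space that annihilates a hyperplane is zero: its rank is
at most one, hence zero. -/
theorem IsSkew.eq_zero_of_finrank {X : E4 →ₗ[ℝ] E4} (h : IsSkew X) (U : Submodule ℝ E4)
    (hU : 3 ≤ Module.finrank ℝ U) (hX : ∀ x ∈ U, X x = 0) : X = 0 := by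
  have hr : Module.finrank ℝ (LinearMap.range X) ≤ 1 := by
    have h1 := LinearMap.finrank_range_add_finrank_ker X
    have h2 : Module.finrank ℝ U ≤ Module.finrank ℝ (LinearMap.ker X) :=
      Submodule.finrank_mono fun x hx => LinearMap.mem_ker.2 (hX x hx)
    have h3 : Module.finrank ℝ E4 = 4 := by simp
    omega
  obtain ⟨v, hv⟩ := finrank_le_one_iff.1 hr
  by_contra hne
  obtain ⟨y, hy⟩ : ∃ y, X y ≠ 0 := by
    by_contra! h0
    exact hne (LinearMap.ext h0)
  obtain ⟨c, hc⟩ := hv ⟨X y, LinearMap.mem_range_self X y⟩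
  obtain ⟨d, hd⟩ := hv ⟨X (X y), LinearMap.mem_range_self X _⟩
  have hc' : c • (v : E4) = X y := congrArg Subtype.val hc
  have hd' : d • (v : E4) = X (X y) := congrArg Subtype.val hd
  have hc0 : c ≠ 0 := by
    rintro rfl
    exact hy (by rw [← hc', zero_smul])
  have h2 : c • X (X y) = d • X y := by rw [← hd', ← hc', smul_comm]
  have h3 : X (X y) = 0 := by
    have h4 := h (X y)
    have h5 : c * inner ℝ (X (X y)) (X y) = d * inner ℝ (X y) (X y) := by
      have := congrArg (fun z => inner ℝ z (X y)) h2
      simpa [inner_smul_left] using this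
    rw [h4, mul_zero] at h5
    rcases mul_eq_zero.1 h5.symm with h6 | h6
    · rw [h6, zero_smul] at h2
      exact (smul_eq_zero.1 h2).resolve_left hc0
    · exact absurd (inner_self_eq_zero.1 h6) hy
  have h7 := h.inner_comm y (X y)
  rw [h3, inner_zero_left, neg_zero] at h7
  exact hy (inner_self_eq_zero.1 h7)

theorem isSkew_of_mem_motions {ξ : E4 →ᵃ[ℝ] E4} (h : ξ ∈ motions) : IsSkew ξ.linear := h

theorem affineMap_sub (ξ : E4 →ᵃ[ℝ] E4) (x y : E4) : ξ x - ξ y = ξ.linear (x - y) := by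
  have := ξ.linearMap_vsub x y
  simpa using this.symm

theorem inner_motion_sub {ξ : E4 →ᵃ[ℝ] E4} (h : ξ ∈ motions) (x y : E4) :
    inner ℝ (x - y) (ξ x - ξ y) = 0 := by
  rw [affineMap_sub, real_inner_comm]
  exact h _

/-- An infinitesimal motion that vanishes on a nondegenerate simplex of dimension at least three
is zero. -/
theorem motion_eq_zero {ι : Type*} [Fintype ι] {p : ι → E4} (hp : AffineIndependent ℝ p)
    (hc : 4 ≤ Fintype.card ι) {ξ : E4 →ᵃ[ℝ] E4} (hξ : ξ ∈ motions) (h : ∀ u, ξ (p u) = 0) :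
    ξ = 0 := by
  have hl : ξ.linear = 0 := by
    refine (isSkew_of_mem_motions hξ).eq_zero_of_finrank (vectorSpan ℝ (Set.range p)) ?_ ?_
    · obtain ⟨n, hn⟩ : ∃ n, Fintype.card ι = n + 1 := ⟨Fintype.card ι - 1, by omega⟩
      rw [hp.finrank_vectorSpan hn]
      omega
    · intro x hx
      rw [vectorSpan] at hx
      refine Submodule.span_induction ?_ (map_zero _) ?_ ?_ hx
      · rintro _ ⟨_, ⟨u, rfl⟩, _, ⟨w, rfl⟩, rfl⟩
        change ξ.linear (p u - p w) = 0
        rw [← affineMap_sub, h, h, sub_zero]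
      · intro x y _ _ hx hy
        rw [map_add, hx, hy, add_zero]
      · intro c x _ hx
        rw [map_smul, hx, smul_zero]
  have hne : Nonempty ι := Fintype.card_pos_iff.1 (by omega)
  obtain ⟨u⟩ := hne
  ext1 x
  have := affineMap_sub ξ x (p u)
  rw [h, sub_zero, hl] at this
  simpa using this

theorem motion_ext {ι : Type*} [Fintype ι] {p : ι → E4} (hp : AffineIndependent ℝ p)
    (hc : 4 ≤ Fintype.card ι) {ξ η : E4 →ᵃ[ℝ] E4} (hξ : ξ ∈ motions) (hη : η ∈ motions)
    (h : ∀ u, ξ (p u) = η (p u)) : ξ = η :=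
  sub_eq_zero.1 <| motion_eq_zero hp hc (motions.sub_mem hξ hη) fun u => by
    simp [h u]

/-- Velocities of the vertices of a nondegenerate simplex extend to an affine field. -/
theorem exists_linearMap_eq {ι : Type*} [Nonempty ι] {p : ι → E4} (hp : AffineIndependent ℝ p)
    (r : ι → E4) : ∃ C : E4 →ₗ[ℝ] E4, ∀ u w, C (p u - p w) = r u - r w := by
  obtain ⟨i⟩ := ‹Nonempty ι›
  have hli := (affineIndependent_iff_linearIndependent_vsub ℝ p i).1 hp
  obtain ⟨C, hC⟩ := ((Module.Basis.span hli).constr ℝ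
    (fun x : {x // x ≠ i} => r x - r i)).exists_extend
  have hCv : ∀ x : {x // x ≠ i}, C (p x - p i) = r x - r i := fun x => by
    have h1 := congrArg (fun F => F (Module.Basis.span hli x)) hC
    simp only [Module.Basis.constr_basis, LinearMap.comp_apply, Submodule.subtype_apply] at h1
    rw [← h1, Module.Basis.span_apply]
    rfl
  have hCu : ∀ u, C (p u - p i) = r u - r i := fun u => by
    by_cases hu : u = i
    · subst hu; simp
    · exact hCv ⟨u, hu⟩
  refine ⟨C, fun u w => ?_⟩
  rw [← sub_sub_sub_cancel_right (p u) (p w) (p i), map_sub, hCu, hCu, sub_sub_sub_cancel_right]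

/-- Infinitesimal rigidity of a nondegenerate simplex: velocities of its vertices that do not
change the lengths of its edges extend to an infinitesimal motion of the space. -/
theorem exists_motion {ι : Type*} [Nonempty ι] {p : ι → E4} (hp : AffineIndependent ℝ p)
    (r : ι → E4) (h : ∀ u w, inner ℝ (p u - p w) (r u - r w) = 0) :
    ∃ ξ ∈ motions, ∀ u, ξ (p u) = r u := by
  obtain ⟨C, hC⟩ := exists_linearMap_eq hp r
  obtain ⟨i⟩ := ‹Nonempty ι›
  have hCu : ∀ u, C (p u - p i) = r u - r i := fun u => hC u i
  set v : {x // x ≠ i} → E4 := fun x => p x -ᵥ p i with hv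
  have hpol : ∀ u w, inner ℝ (C (p u - p i)) (p w - p i) +
      inner ℝ (C (p w - p i)) (p u - p i) = 0 := by
    intro u w
    have e1 := h u i
    have e2 := h w i
    have e3 := h u w
    rw [hCu, hCu]
    rw [← sub_sub_sub_cancel_right (p u) (p w) (p i),
      ← sub_sub_sub_cancel_right (r u) (r w) (r i)] at e3
    simp only [inner_sub_left (p u - p i), inner_sub_right _ (r u - r i)] at e3
    rw [e1, e2] at e3
    rw [real_inner_comm (p w - p i), real_inner_comm (p u - p i)]
    linarith
  have hU : ∀ x ∈ Submodule.span ℝ (Set.range v), inner ℝ (C x) x = 0 := by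
    have hb : ∀ x ∈ Submodule.span ℝ (Set.range v), ∀ y ∈ Submodule.span ℝ (Set.range v),
        inner ℝ (C x) y + inner ℝ (C y) x = 0 := by
      intro x hx y hy
      refine Submodule.span_induction₂ (p := fun x y _ _ =>
        inner ℝ (C x) y + inner ℝ (C y) x = 0) ?_ ?_ ?_ ?_ ?_ ?_ ?_ hx hy
      · rintro _ _ ⟨a, rfl⟩ ⟨b, rfl⟩
        exact hpol a b
      · intro y _; simp
      · intro y _; simp
      · intro x y z _ _ _ h1 h2
        simp only [map_add, inner_add_left, inner_add_right]
        linarith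
      · intro x y z _ _ _ h1 h2
        simp only [map_add, inner_add_left, inner_add_right]
        linarith
      · intro c x y _ _ h1
        simp only [map_smul, inner_smul_left, inner_smul_right, RCLike.conj_to_real, ← mul_add, h1,
          mul_zero]
      · intro c x y _ _ h1
        simp only [map_smul, inner_smul_left, inner_smul_right, RCLike.conj_to_real, ← mul_add, h1,
          mul_zero]
    intro x hx
    have := hb x hx x hx
    linarith
  obtain ⟨X, hX, hXC⟩ := exists_isSkew_eqOn _ C hU
  refine ⟨X.toAffineMap + AffineMap.const ℝ E4 (r i - X (p i)), fun x => ?_, fun u => ?_⟩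
  · simpa using hX x
  · have h1 : X (p u - p i) = r u - r i := by
      by_cases hu : u = i
      · subst hu; simp
      · rw [← hCu]
        exact hXC _ (Submodule.subset_span ⟨⟨u, hu⟩, rfl⟩)
    rw [map_sub] at h1
    simp only [AffineMap.coe_add, Pi.add_apply, LinearMap.coe_toAffineMap, AffineMap.const_apply]
    rw [← sub_eq_zero]
    rw [← sub_eq_zero] at h1
    rw [← h1]
    abel

/-! ### The differential of a dihedral angle -/

section Dihedral

variable {ι : Type*}

/-- The linear part of the Cayley–Menger matrix as a function of the squared edge lengths. -/
def cayleyMengerLinear : (ι → ι → ℝ) →ₗ[ℝ] Matrix (Option ι) (Option ι) ℝ where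
  toFun D := Matrix.of fun a b => match a, b with
    | some u, some w => D u w
    | _, _ => 0
  map_add' D E := by ext (_ | a) (_ | b) <;> simp
  map_smul' r D := by ext (_ | a) (_ | b) <;> simp

theorem cayleyMenger_eq (D : ι → ι → ℝ) :
    cayleyMenger D = cayleyMengerLinear D + cayleyMenger 0 := by
  ext (_ | a) (_ | b) <;> simp [cayleyMenger, cayleyMengerLinear]

variable [Fintype ι]

open Classical in
open scoped Matrix.Norms.Operator in
theorem hasFDerivAt_cayleyMenger_inv (D : ι → ι → ℝ) (h : IsUnit (cayleyMenger D).det)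
    (a b : Option ι) : ∃ F : (ι → ι → ℝ) →L[ℝ] ℝ,
      HasFDerivAt (fun D => (cayleyMenger D)⁻¹ a b) F D ∧
      ∀ d, F d = -∑ u, ∑ w, (cayleyMenger D)⁻¹ a (some u) * d u w *
        (cayleyMenger D)⁻¹ (some w) b := by
  obtain ⟨U, hU⟩ := (Matrix.isUnit_iff_isUnit_det _).2 h
  have hinv : (↑U⁻¹ : Matrix (Option ι) (Option ι) ℝ) = (cayleyMenger D)⁻¹ := by
    rw [Matrix.coe_units_inv, hU]
  have h1 : HasFDerivAt (fun D : ι → ι → ℝ => cayleyMenger D)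
      (LinearMap.toContinuousLinearMap cayleyMengerLinear) D := by
    have : (fun D : ι → ι → ℝ => cayleyMenger D) = fun D =>
        LinearMap.toContinuousLinearMap (cayleyMengerLinear (ι := ι)) D + cayleyMenger 0 := by
      funext D
      exact cayleyMenger_eq D
    rw [this]
    exact (ContinuousLinearMap.hasFDerivAt _).add_const _
  have h2 := hasFDerivAt_ringInverse (𝕜 := ℝ) U
  rw [hU] at h2
  have h3 := h2.comp D h1
  let E : Matrix (Option ι) (Option ι) ℝ →L[ℝ] ℝ :=
    LinearMap.toContinuousLinearMap (Matrix.entryLinearMap ℝ ℝ a b)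
  have h4 := (E.hasFDerivAt (x := (Ring.inverse (cayleyMenger D)))).comp D h3
  refine ⟨_, h4.congr_of_eventuallyEq (Filter.Eventually.of_forall fun D => ?_), fun d => ?_⟩
  · simp only [Matrix.nonsing_inv_eq_ringInverse]
    rfl
  · rw [hinv]
    change (-((cayleyMenger D)⁻¹ * cayleyMengerLinear d * (cayleyMenger D)⁻¹)) a b = _
    rw [Matrix.neg_apply]
    congr 1
    simp only [Matrix.mul_apply, Finset.sum_mul]
    rw [Finset.sum_comm]
    rw [Fintype.sum_option]
    have z : ∀ x, cayleyMengerLinear d none x = 0 := fun x => rfl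
    have z' : ∀ x, cayleyMengerLinear d x none = 0 := fun x => by cases x <;> rfl
    have z2 : ∀ x y, cayleyMengerLinear d (some x) (some y) = d x y := fun x y => rfl
    simp only [z, mul_zero, zero_mul, Finset.sum_const_zero, zero_add, Fintype.sum_option, z', z2]

/-- The derivative of the inverse Cayley–Menger matrix in the direction of a deformation with
velocity field `x ↦ A x`: the gradients `n` of the barycentric coordinates move with velocities
`-Aᵀ n`. -/
theorem sum_gradient_mul {p n : ι → E4} {c : ι → ℝ} (hn : ∑ m, n m = 0)
    (hx : ∀ x : E4, ∑ m, (inner ℝ (n m) x + c m) • p m = x) (A : E4 →ₗ[ℝ] E4) {d : ι → ι → ℝ}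
    (hd : ∀ u w, inner ℝ (p u - p w) (A (p u - p w)) = d u w / 2) (j k : ι) :
    -∑ u, ∑ w, (-(1 / 2) * inner ℝ (n j) (n u)) * d u w * (-(1 / 2) * inner ℝ (n w) (n k)) =
      (inner ℝ (n j) (A (n k)) + inner ℝ (n k) (A (n j))) / 2 := by
  have hs : ∀ y : E4, ∑ m, inner ℝ (n m) y = 0 := fun y => by
    rw [← sum_inner, hn, inner_zero_left]
  have hp : ∀ y : E4, ∑ m, inner ℝ (n m) y • p m = y := fun y => by
    have h1 := hx y
    have h0 := hx 0
    simp only [add_smul, Finset.sum_add_distrib, inner_zero_right, zero_add] at h1 h0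
    rw [h0, add_zero] at h1
    exact h1
  have hpi : ∀ (y z : E4), ∑ m, inner ℝ (n m) y * inner ℝ (p m) z = inner ℝ y z := fun y z => by
    conv_rhs => rw [← hp y, sum_inner]
    exact Finset.sum_congr rfl fun m _ => by rw [inner_smul_left]; simp
  have hpA : ∀ (y z : E4), ∑ m, inner ℝ (n m) y * inner ℝ z (A (p m)) = inner ℝ z (A y) :=
      fun y z => by
    conv_rhs => rw [← hp y, map_sum, inner_sum]
    exact Finset.sum_congr rfl fun m _ => by rw [map_smul, inner_smul_right]
  have hterm : ∀ u w, (-(1 / 2) * inner ℝ (n j) (n u)) * d u w *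
      (-(1 / 2) * inner ℝ (n w) (n k)) =
      (1 / 2) * (inner ℝ (n u) (n j) * inner ℝ (p u) (A (p u))) * inner ℝ (n w) (n k)
      + (1 / 2) * inner ℝ (n u) (n j) * (inner ℝ (n w) (n k) * inner ℝ (p w) (A (p w)))
      - (1 / 2) * inner ℝ (n u) (n j) * (inner ℝ (n w) (n k) * inner ℝ (p u) (A (p w)))
      - (1 / 2) * inner ℝ (n w) (n k) * (inner ℝ (n u) (n j) * inner ℝ (p w) (A (p u))) := by
    intro u w
    have := hd u w
    simp only [map_sub, inner_sub_left, inner_sub_right] at this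
    rw [real_inner_comm (n u) (n j)]
    have e : d u w = 2 * (inner ℝ (p u) (A (p u)) - inner ℝ (p u) (A (p w)) -
      (inner ℝ (p w) (A (p u)) - inner ℝ (p w) (A (p w)))) := by linarith
    rw [e]
    ring
  simp only [hterm, Finset.sum_sub_distrib, Finset.sum_add_distrib]
  simp only [← Finset.mul_sum, hs, hpA, mul_zero]
  simp only [← Finset.sum_mul, ← Finset.mul_sum, hs]
  rw [Finset.sum_comm]
  simp only [mul_assoc, ← Finset.mul_sum, hpA, hpi]
  simp only [zero_mul, mul_zero, Finset.sum_const_zero]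
  ring

/-- The angular velocity, in the plane orthogonal to `l₁` and `l₂`, of the component of `y` in that
plane, under a deformation with velocity field `x ↦ A x`. It is scaled by the area of the
parallelogram on `l₁` and `l₂`. -/
def turnRate (l₁ l₂ y : E4) (A : E4 →ₗ[ℝ] E4) : ℝ :=
  vol l₁ l₂ (perp l₁ l₂ y) (A (perp l₁ l₂ y)) / inner ℝ (perp l₁ l₂ y) (perp l₁ l₂ y)

/-- The derivative of a dihedral angle, computed from the gradients `nj`, `nk` of the barycentric
coordinates, is the difference of the angular velocities of the two faces. -/
theorem gradient_rate_eq {l₁ l₂ hj hk nj nk : E4} (A : E4 →ₗ[ℝ] E4)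
    (h1j : inner ℝ l₁ hj = 0) (h1k : inner ℝ l₁ hk = 0) (h2j : inner ℝ l₂ hj = 0)
    (h2k : inner ℝ l₂ hk = 0) (nj1 : inner ℝ nj l₁ = 0) (nj2 : inner ℝ nj l₂ = 0)
    (nk1 : inner ℝ nk l₁ = 0) (nk2 : inner ℝ nk l₂ = 0) (njj : inner ℝ nj hj = 1)
    (njk : inner ℝ nj hk = 0) (nkj : inner ℝ nk hj = 0) (nkk : inner ℝ nk hk = 1)
    (hV : vol l₁ l₂ hj hk ≠ 0) :
    0 < inner ℝ nj nj * inner ℝ nk nk - inner ℝ nj nk ^ 2 ∧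
    (-(inner ℝ nj (A nk) + inner ℝ nk (A nj)) + inner ℝ nj nk *
      (inner ℝ nj (A nj) / inner ℝ nj nj + inner ℝ nk (A nk) / inner ℝ nk nk)) /
      √(inner ℝ nj nj * inner ℝ nk nk - inner ℝ nj nk ^ 2) =
    Real.sign (vol l₁ l₂ hj hk) / √(inner ℝ l₁ l₁ * inner ℝ l₂ l₂ - inner ℝ l₁ l₂ ^ 2) *
      (vol l₁ l₂ hk (A hk) / inner ℝ hk hk - vol l₁ l₂ hj (A hj) / inner ℝ hj hj) := by
  have vj : ∀ y, vol l₁ l₂ hj hk * inner ℝ nj y = vol l₁ l₂ y hk := fun y => by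
    have := congrArg (fun z => inner ℝ nj z) (vol_smul_eq l₁ l₂ hj hk y)
    simpa [inner_add_right, inner_smul_right, nj1, nj2, njj, njk] using this
  have vk : ∀ y, vol l₁ l₂ hj hk * inner ℝ nk y = vol l₁ l₂ hj y := fun y => by
    have := congrArg (fun z => inner ℝ nk z) (vol_smul_eq l₁ l₂ hj hk y)
    simpa [inner_add_right, inner_smul_right, nk1, nk2, nkj, nkk] using this
  -- a vector orthogonal to the triangle is a combination of `hj` and `hk`
  have hcomb : ∀ y, inner ℝ y l₁ = 0 → inner ℝ y l₂ = 0 →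
      y = inner ℝ nj y • hj + inner ℝ nk y • hk := by
    intro y y1 y2
    have e := vol_smul_eq l₁ l₂ hj hk y
    rw [← vj y, ← vk y] at e
    set t := vol y l₂ hj hk • l₁ + vol l₁ y hj hk • l₂ with ht
    have e2 : vol l₁ l₂ hj hk • (y - (inner ℝ nj y • hj + inner ℝ nk y • hk)) = t := by
      rw [smul_sub, smul_add, smul_smul, smul_smul, e]
      abel
    have e3 : inner ℝ (y - (inner ℝ nj y • hj + inner ℝ nk y • hk)) t = 0 := by
      simp only [ht, inner_sub_left, inner_add_left, inner_add_right, inner_smul_left,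
        inner_smul_right, y1, y2, real_inner_comm l₁ hj, real_inner_comm l₁ hk,
        real_inner_comm l₂ hj, real_inner_comm l₂ hk, h1j, h1k, h2j, h2k]
      simp
    rw [← e2, inner_smul_right] at e3
    have e4 := (mul_eq_zero.1 e3).resolve_left hV
    exact sub_eq_zero.1 (inner_self_eq_zero.1 e4)
  have cj := hcomb nj nj1 nj2
  have ck := hcomb nk nk1 nk2
  -- the Gram matrices of `nj, nk` and of `hj, hk` are inverse to each other
  have q1 : inner ℝ nj nj * inner ℝ hj hj + inner ℝ nj nk * inner ℝ hj hk = 1 := by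
    have := congrArg (fun z => inner ℝ z hj) cj
    simp only [inner_add_left, inner_smul_left, RCLike.conj_to_real, njj] at this
    rw [real_inner_comm nj nk, real_inner_comm hj hk] at this
    linarith
  have q2 : inner ℝ nj nj * inner ℝ hj hk + inner ℝ nj nk * inner ℝ hk hk = 0 := by
    have := congrArg (fun z => inner ℝ z hk) cj
    simp only [inner_add_left, inner_smul_left, RCLike.conj_to_real, njk] at this
    rw [real_inner_comm nj nk] at this
    linarith
  have q3 : inner ℝ nj nk * inner ℝ hj hj + inner ℝ nk nk * inner ℝ hj hk = 0 := by
    have := congrArg (fun z => inner ℝ z hj) ck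
    simp only [inner_add_left, inner_smul_left, RCLike.conj_to_real, nkj] at this
    rw [real_inner_comm hj hk] at this
    linarith
  have q4 : inner ℝ nj nk * inner ℝ hj hk + inner ℝ nk nk * inner ℝ hk hk = 1 := by
    have := congrArg (fun z => inner ℝ z hk) ck
    simp only [inner_add_left, inner_smul_left, RCLike.conj_to_real, nkk] at this
    linarith
  have hvsq := vol_sq_of_orthogonal h1j h1k h2j h2k
  have hgj : 0 < inner ℝ nj nj := real_inner_self_pos.2 fun h => by simp [h] at njj
  have hgk : 0 < inner ℝ nk nk := real_inner_self_pos.2 fun h => by simp [h] at nkk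
  have hK : (inner ℝ nj nj * inner ℝ nk nk - inner ℝ nj nk ^ 2) *
      (inner ℝ hj hj * inner ℝ hk hk - inner ℝ hj hk ^ 2) = 1 := by
    linear_combination (inner ℝ nk nk * inner ℝ hk hk) * q1
      - (inner ℝ nk nk * inner ℝ hj hk) * q2 + inner ℝ nj nk * inner ℝ hj hk * q4
      - (inner ℝ nj nk * inner ℝ hk hk) * q3 + q4
  have hQK : 0 < (inner ℝ l₁ l₁ * inner ℝ l₂ l₂ - inner ℝ l₁ l₂ ^ 2) *
      (inner ℝ hj hj * inner ℝ hk hk - inner ℝ hj hk ^ 2) := by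
    rw [← hvsq]; positivity
  have hQ : 0 < inner ℝ l₁ l₁ * inner ℝ l₂ l₂ - inner ℝ l₁ l₂ ^ 2 := by
    have h0 : 0 ≤ inner ℝ l₁ l₁ * inner ℝ l₂ l₂ - inner ℝ l₁ l₂ ^ 2 := by
      have := real_inner_mul_inner_self_le l₁ l₂
      rw [sq]; linarith
    rcases h0.lt_or_eq with h | h
    · exact h
    · rw [← h, zero_mul] at hQK; exact absurd hQK (lt_irrefl _)
  have hH : 0 < inner ℝ hj hj * inner ℝ hk hk - inner ℝ hj hk ^ 2 := pos_of_mul_pos_right hQK hQ.le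
  have hD : 0 < inner ℝ nj nj * inner ℝ nk nk - inner ℝ nj nk ^ 2 := by
    rcases lt_or_ge 0 (inner ℝ nj nj * inner ℝ nk nk - inner ℝ nj nk ^ 2) with h | h
    · exact h
    · nlinarith
  refine ⟨hD, ?_⟩
  -- the symmetric parts of the mixed terms cancel against the diagonal terms, and only the
  -- components of `A hj` and `A hk` across `hj` and `hk` remain
  have a1 : inner ℝ nj nj * inner ℝ nj (A nk) = inner ℝ nj nk * inner ℝ nj (A nj) +
      (inner ℝ nj nj * inner ℝ nk nk - inner ℝ nj nk ^ 2) * inner ℝ nj (A hk) := by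
    have ej := congrArg (fun z => inner ℝ nj (A z)) cj
    have ek := congrArg (fun z => inner ℝ nj (A z)) ck
    simp only [map_add, map_smul, inner_add_right, inner_smul_right] at ej ek
    rw [real_inner_comm nj nk] at ej
    linear_combination inner ℝ nj nj * ek - inner ℝ nj nk * ej
  have a2 : inner ℝ nk nk * inner ℝ nk (A nj) = inner ℝ nj nk * inner ℝ nk (A nk) +
      (inner ℝ nj nj * inner ℝ nk nk - inner ℝ nj nk ^ 2) * inner ℝ nk (A hj) := by
    have ej := congrArg (fun z => inner ℝ nk (A z)) cj
    have ek := congrArg (fun z => inner ℝ nk (A z)) ck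
    simp only [map_add, map_smul, inner_add_right, inner_smul_right] at ej ek
    rw [real_inner_comm nj nk] at ej
    linear_combination inner ℝ nk nk * ej - inner ℝ nj nk * ek
  have b1 : vol l₁ l₂ hk (A hk) = -(vol l₁ l₂ hj hk * inner ℝ nj (A hk)) := by
    rw [vj, vol_swap_last]
  have b2 : vol l₁ l₂ hj (A hj) = vol l₁ l₂ hj hk * inner ℝ nk (A hj) := by
    rw [vk]
  rw [b1, b2]
  have hhk : 0 < inner ℝ hk hk := real_inner_self_pos.2 fun h => by simp [h] at nkk
  have hhj : 0 < inner ℝ hj hj := real_inner_self_pos.2 fun h => by simp [h] at njj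
  have ck' : inner ℝ nj nj =
      (inner ℝ nj nj * inner ℝ nk nk - inner ℝ nj nk ^ 2) * inner ℝ hk hk := by
    linear_combination (-inner ℝ nj nj) * q4 + inner ℝ nj nk * q2
  have cj' : inner ℝ nk nk =
      (inner ℝ nj nj * inner ℝ nk nk - inner ℝ nj nk ^ 2) * inner ℝ hj hj := by
    linear_combination (-inner ℝ nk nk) * q1 + inner ℝ nj nk * q3
  -- the square root is `Q / |vol|`, with the area `Q` of the parallelogram on `l₁`, `l₂`
  have hsq : √(inner ℝ nj nj * inner ℝ nk nk - inner ℝ nj nk ^ 2) * |vol l₁ l₂ hj hk| =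
      √(inner ℝ l₁ l₁ * inner ℝ l₂ l₂ - inner ℝ l₁ l₂ ^ 2) := by
    rw [← Real.sqrt_sq_eq_abs, ← Real.sqrt_mul hD.le, hvsq]
    congr 1
    linear_combination (inner ℝ l₁ l₁ * inner ℝ l₂ l₂ - inner ℝ l₁ l₂ ^ 2) * hK
  have hab : Real.sign (vol l₁ l₂ hj hk) * |vol l₁ l₂ hj hk| = vol l₁ l₂ hj hk := by
    rcases lt_or_gt_of_ne hV with h | h
    · rw [Real.sign_of_neg h, abs_of_neg h]; ring
    · rw [Real.sign_of_pos h, abs_of_pos h]; ring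
  have hss : Real.sign (vol l₁ l₂ hj hk) * Real.sign (vol l₁ l₂ hj hk) = 1 := by
    rcases lt_or_gt_of_ne hV with h | h
    · rw [Real.sign_of_neg h]; ring
    · rw [Real.sign_of_pos h]; ring
  have hVa : 0 < |vol l₁ l₂ hj hk| := abs_pos.2 hV
  have hsD := Real.sqrt_pos.2 hD
  have hsD2 := Real.mul_self_sqrt hD.le
  rw [← hsq]
  generalize Real.sign (vol l₁ l₂ hj hk) = sg at *
  generalize |vol l₁ l₂ hj hk| = va at *
  generalize vol l₁ l₂ hj hk = V at *
  generalize √(inner ℝ nj nj * inner ℝ nk nk - inner ℝ nj nk ^ 2) = Δ at *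
  have r1 : inner ℝ nj (A nk) = (inner ℝ nj nk * inner ℝ nj (A nj) + Δ * Δ * inner ℝ nj (A hk)) /
      inner ℝ nj nj := by
    rw [eq_div_iff hgj.ne', hsD2]; linarith
  have r2 : inner ℝ nk (A nj) = (inner ℝ nj nk * inner ℝ nk (A nk) + Δ * Δ * inner ℝ nk (A hj)) /
      inner ℝ nk nk := by
    rw [eq_div_iff hgk.ne', hsD2]; linarith
  rw [r1, r2]
  rw [← hsD2] at ck' cj'
  have hL : (-((inner ℝ nj nk * inner ℝ nj (A nj) + Δ * Δ * inner ℝ nj (A hk)) / inner ℝ nj nj +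
      (inner ℝ nj nk * inner ℝ nk (A nk) + Δ * Δ * inner ℝ nk (A hj)) / inner ℝ nk nk) +
      inner ℝ nj nk * (inner ℝ nj (A nj) / inner ℝ nj nj + inner ℝ nk (A nk) / inner ℝ nk nk)) / Δ
      = -(Δ * inner ℝ nj (A hk) / inner ℝ nj nj + Δ * inner ℝ nk (A hj) / inner ℝ nk nk) := by
    field_simp
    ring
  rw [hL, ck', cj', ← hab]
  field_simp
  linear_combination (inner ℝ nj (A hk) * inner ℝ hj hj + inner ℝ nk (A hj) * inner ℝ hk hk) * hss

open Classical in
/-- A dihedral angle is a differentiable function of the squared edge lengths, and its derivative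
in the direction of a deformation with velocity field `x ↦ A x` is the difference of the angular
velocities of the two faces around the triangle. -/
theorem exists_hasFDerivAt_dihedralAngle {p : ι → E4} (hp : AffineIndependent ℝ p)
    (hc : Fintype.card ι = 5) {u v x j k : ι} (hjk : j ≠ k) (huj : u ≠ j) (huk : u ≠ k)
    (hvj : v ≠ j) (hvk : v ≠ k) (hxj : x ≠ j) (hxk : x ≠ k)
    (hV : vol (p v - p u) (p x - p u) (p j - p u) (p k - p u) ≠ 0) :
    ∃ F : (ι → ι → ℝ) →L[ℝ] ℝ,
      HasFDerivAt (fun D => dihedralAngle D j k) F (fun a b => ‖p a - p b‖ ^ 2) ∧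
      ∀ (A : E4 →ₗ[ℝ] E4) (d : ι → ι → ℝ),
        (∀ a b, inner ℝ (p a - p b) (A (p a - p b)) = d a b / 2) →
        F d = Real.sign (vol (p v - p u) (p x - p u) (p j - p u) (p k - p u)) /
          √(inner ℝ (p v - p u) (p v - p u) * inner ℝ (p x - p u) (p x - p u) -
            inner ℝ (p v - p u) (p x - p u) ^ 2) *
          (turnRate (p v - p u) (p x - p u) (p k - p u) A -
            turnRate (p v - p u) (p x - p u) (p j - p u) A) := by
  obtain ⟨n, c, h1, h2, h3, h4⟩ := exists_barycentric p hp hc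
  obtain ⟨hdet, hinv⟩ := cayleyMenger_inv p n c h1 h2 h3 h4
  set D₀ : ι → ι → ℝ := fun a b => ‖p a - p b‖ ^ 2
  obtain ⟨Fjk, Hjk, hFjk⟩ := hasFDerivAt_cayleyMenger_inv D₀ hdet (some j) (some k)
  obtain ⟨Fjj, Hjj, hFjj⟩ := hasFDerivAt_cayleyMenger_inv D₀ hdet (some j) (some j)
  obtain ⟨Fkk, Hkk, hFkk⟩ := hasFDerivAt_cayleyMenger_inv D₀ hdet (some k) (some k)
  have hdiff : ∀ m a b, inner ℝ (n m) (p a - p b) =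
      (if m = a then 1 else 0) - (if m = b then (1 : ℝ) else 0) := fun m a b => by
    rw [inner_sub_right]; linarith [h4 m a, h4 m b]
  set l₁ := p v - p u with hl₁
  set l₂ := p x - p u with hl₂
  obtain ⟨aj, bj, ej⟩ := exists_perp_eq l₁ l₂ (p j - p u)
  obtain ⟨ak, bk, ek⟩ := exists_perp_eq l₁ l₂ (p k - p u)
  have nj1 : inner ℝ (n j) l₁ = 0 := by rw [hdiff]; simp [hvj.symm, huj.symm]
  have nj2 : inner ℝ (n j) l₂ = 0 := by rw [hdiff]; simp [hxj.symm, huj.symm]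
  have nk1 : inner ℝ (n k) l₁ = 0 := by rw [hdiff]; simp [hvk.symm, huk.symm]
  have nk2 : inner ℝ (n k) l₂ = 0 := by rw [hdiff]; simp [hxk.symm, huk.symm]
  have njj : inner ℝ (n j) (perp l₁ l₂ (p j - p u)) = 1 := by
    rw [ej, inner_sub_right, inner_sub_right, inner_smul_right, inner_smul_right, nj1, nj2, hdiff]
    simp [huj.symm]
  have njk : inner ℝ (n j) (perp l₁ l₂ (p k - p u)) = 0 := by
    rw [ek, inner_sub_right, inner_sub_right, inner_smul_right, inner_smul_right, nj1, nj2, hdiff]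
    simp [huj.symm, hjk]
  have nkj : inner ℝ (n k) (perp l₁ l₂ (p j - p u)) = 0 := by
    rw [ej, inner_sub_right, inner_sub_right, inner_smul_right, inner_smul_right, nk1, nk2, hdiff]
    simp [huk.symm, hjk.symm]
  have nkk : inner ℝ (n k) (perp l₁ l₂ (p k - p u)) = 1 := by
    rw [ek, inner_sub_right, inner_sub_right, inner_smul_right, inner_smul_right, nk1, nk2, hdiff]
    simp [huk.symm]
  have hVp : vol l₁ l₂ (perp l₁ l₂ (p j - p u)) (perp l₁ l₂ (p k - p u)) =
      vol l₁ l₂ (p j - p u) (p k - p u) := by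
    rw [ej, ek]
    simp only [vol_eq, PiLp.sub_apply, PiLp.smul_apply, smul_eq_mul]
    ring
  -- the gradients see only the components of the edges orthogonal to the triangle
  have main := fun A => gradient_rate_eq (l₁ := l₁) (l₂ := l₂) A (inner_left_perp _ _ _)
    (inner_left_perp _ _ _) (inner_right_perp _ _ _) (inner_right_perp _ _ _) nj1 nj2 nk1 nk2 njj
    njk nkj nkk (by rw [hVp]; exact hV)
  have hD := (main 0).1
  have hgj : 0 < inner ℝ (n j) (n j) := real_inner_self_pos.2 fun h => by simp [h] at njj
  have hgk : 0 < inner ℝ (n k) (n k) := real_inner_self_pos.2 fun h => by simp [h] at nkk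
  have hG := mul_pos hgj hgk
  have hr : √((cayleyMenger D₀)⁻¹ (some j) (some j) * (cayleyMenger D₀)⁻¹ (some k) (some k)) =
      √(inner ℝ (n j) (n j) * inner ℝ (n k) (n k)) / 2 := by
    rw [hinv, hinv, show -(1 / 2) * inner ℝ (n j) (n j) * (-(1 / 2) * inner ℝ (n k) (n k)) =
      inner ℝ (n j) (n j) * inner ℝ (n k) (n k) / 2 ^ 2 by ring,
      Real.sqrt_div hG.le, Real.sqrt_sq (by norm_num)]
  have hsG := Real.sqrt_pos.2 hG
  have hsG2 := Real.mul_self_sqrt hG.le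
  have hr0 : √((cayleyMenger D₀)⁻¹ (some j) (some j) *
      (cayleyMenger D₀)⁻¹ (some k) (some k)) ≠ 0 := by
    rw [hr]; positivity
  -- the derivative of `arccos (N j k / √(N j j * N k k))`, with the inverse matrix `N`
  have Hprod := Hjj.mul Hkk
  have Hr := Hprod.sqrt (by
    intro h0
    apply hr0
    rw [Pi.mul_apply] at h0
    rw [h0, Real.sqrt_zero])
  have Hinv := (hasDerivAt_inv hr0).comp_hasFDerivAt D₀ Hr
  have Hx := Hjk.mul Hinv
  set G := √(inner ℝ (n j) (n j) * inner ℝ (n k) (n k)) with hGdef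
  have hxval : (cayleyMenger D₀)⁻¹ (some j) (some k) *
      (√((cayleyMenger D₀)⁻¹ (some j) (some j) * (cayleyMenger D₀)⁻¹ (some k) (some k)))⁻¹ =
      -inner ℝ (n j) (n k) / G := by
    rw [hr, hinv]; field_simp
  have hx2 : 1 - (-inner ℝ (n j) (n k) / G) ^ 2 =
      (inner ℝ (n j) (n j) * inner ℝ (n k) (n k) - inner ℝ (n j) (n k) ^ 2) / G ^ 2 := by
    rw [div_pow, neg_sq, sq G, hsG2]; field_simp
  have hpos : 0 < 1 - (-inner ℝ (n j) (n k) / G) ^ 2 := by rw [hx2]; positivity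
  have Hacos := (Real.hasDerivAt_arccos (x := -inner ℝ (n j) (n k) / G)
    (fun h => by rw [h] at hpos; norm_num at hpos) (fun h => by rw [h] at hpos; norm_num at hpos))
  rw [← hxval] at Hacos
  have Hfin := HasDerivAt.comp_hasFDerivAt D₀ Hacos Hx
  refine ⟨_, Hfin.congr_of_eventuallyEq (Filter.Eventually.of_forall fun D => ?_), ?_⟩
  · simp only [dihedralAngle, Function.comp_apply, Pi.mul_apply, div_eq_mul_inv]
  · intro A d hd
    have hm := (main A).2
    rw [hVp] at hm
    simp only [turnRate]
    rw [← hm, hxval, hx2]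
    have djk : Fjk d = (inner ℝ (n j) (A (n k)) + inner ℝ (n k) (A (n j))) / 2 := by
      rw [hFjk]; simp only [hinv]; exact sum_gradient_mul h2 h3 A hd j k
    have djj : Fjj d = (inner ℝ (n j) (A (n j)) + inner ℝ (n j) (A (n j))) / 2 := by
      rw [hFjj]; simp only [hinv]; exact sum_gradient_mul h2 h3 A hd j j
    have dkk : Fkk d = (inner ℝ (n k) (A (n k)) + inner ℝ (n k) (A (n k))) / 2 := by
      rw [hFkk]; simp only [hinv]; exact sum_gradient_mul h2 h3 A hd k k
    simp only [smul_apply, add_apply, smul_eq_mul,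
      Function.comp_apply, Pi.mul_apply, djk, djj, dkk]
    rw [hr, hinv, hinv, hinv, Real.sqrt_div hD.le, Real.sqrt_sq hsG.le]
    have hsD := Real.sqrt_pos.2 hD
    generalize √(inner ℝ (n j) (n j) * inner ℝ (n k) (n k) - inner ℝ (n j) (n k) ^ 2) = Δ at *
    have hG3 : G ^ 2 = inner ℝ (n j) (n j) * inner ℝ (n k) (n k) := by rw [sq]; exact hsG2
    clear_value G
    field_simp
    rw [hG3]
    ring

end Dihedral

/-! ### Cocycles on simply connected posets -/

section Cocycle

variable {X W : Type*} [PartialOrder X] [AddCommGroup W]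

open Classical in
/-- The extension of a function of pairs `x ≤ y` to all comparable pairs, by antisymmetry. -/
def stepValue (c : X → X → W) (x y : X) : W :=
  if x ≤ y then c x y else if y ≤ x then -c y x else 0

/-- The sum of the values of a cocycle along an edge path. -/
def pathSum (c : X → X → W) : List X → W
  | [] => 0
  | [_] => 0
  | x :: y :: l => stepValue c x y + pathSum c (y :: l)

theorem pathSum_append (c : X → X → W) (l₁ l₂ : List X) (x : X) :
    pathSum c (l₁ ++ x :: l₂) = pathSum c (l₁ ++ [x]) + pathSum c (x :: l₂) := by
  induction l₁ with
  | nil => simp [pathSum]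
  | cons a l ih =>
    cases l with
    | nil => simp [pathSum]
    | cons b l =>
      simp only [List.cons_append, pathSum] at ih ⊢
      rw [ih, add_assoc]

theorem cocycle_self {c : X → X → W} (hc : ∀ x y z, x ≤ y → y ≤ z → c x z = c x y + c y z)
    (x : X) : c x x = 0 := by
  simpa using hc x x x le_rfl le_rfl

theorem stepValue_of_le {c : X → X → W} {x y : X} (h : x ≤ y) : stepValue c x y = c x y :=
  if_pos h

theorem stepValue_of_ge {c : X → X → W} (hc : ∀ x y z, x ≤ y → y ≤ z → c x z = c x y + c y z)
    {x y : X} (h : y ≤ x) : stepValue c x y = -c y x := by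
  by_cases h' : x ≤ y
  · obtain rfl := le_antisymm h h'
    rw [stepValue_of_le h, cocycle_self hc, neg_zero]
  · rw [stepValue, if_neg h', if_pos h]

theorem stepValue_add {c : X → X → W} (hc : ∀ x y z, x ≤ y → y ≤ z → c x z = c x y + c y z)
    {x y z : X} (hxy : Comparable x y) (hyz : Comparable y z) (hxz : Comparable x z) :
    stepValue c x y + stepValue c y z = stepValue c x z := by
  rcases hxy with hxy | hxy <;> rcases hyz with hyz | hyz
  · rw [stepValue_of_le hxy, stepValue_of_le hyz, stepValue_of_le (hxy.trans hyz),
      hc x y z hxy hyz]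
  · rcases hxz with hxz | hxz
    · rw [stepValue_of_le hxy, stepValue_of_ge hc hyz, stepValue_of_le hxz, hc x z y hxz hyz]
      abel
    · rw [stepValue_of_le hxy, stepValue_of_ge hc hyz, stepValue_of_ge hc hxz, hc z x y hxz hxy]
      abel
  · rcases hxz with hxz | hxz
    · rw [stepValue_of_ge hc hxy, stepValue_of_le hyz, stepValue_of_le hxz, hc y x z hxy hxz]
      abel
    · rw [stepValue_of_ge hc hxy, stepValue_of_le hyz, stepValue_of_ge hc hxz, hc y z x hyz hxz]
      abel
  · rw [stepValue_of_ge hc hxy, stepValue_of_ge hc hyz, stepValue_of_ge hc (hyz.trans hxy),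
      hc z y x hyz hxy]
    abel

theorem pathSum_eq_of_pathStep {c : X → X → W}
    (hc : ∀ x y z, x ≤ y → y ≤ z → c x z = c x y + c y z) {l l' : List X} (h : PathStep l l') :
    pathSum c l = pathSum c l' := by
  cases h with
  | dup l₁ l₂ x =>
    rw [pathSum_append, pathSum_append c l₁ l₂, pathSum, stepValue_of_le le_rfl,
      cocycle_self hc, zero_add]
  | tri l₁ l₂ x y z hxy hyz hxz =>
    rw [pathSum_append, pathSum_append c l₁ (z :: l₂), pathSum, pathSum, pathSum,
      ← stepValue_add hc hxy hyz hxz, add_assoc]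

/-- Sums of a cocycle along homotopic edge paths are equal. -/
theorem pathSum_eq_of_eqvGen {c : X → X → W}
    (hc : ∀ x y z, x ≤ y → y ≤ z → c x z = c x y + c y z) {l l' : List X}
    (h : Relation.EqvGen PathStep l l') : pathSum c l = pathSum c l' := by
  induction h with
  | rel _ _ h => exact pathSum_eq_of_pathStep hc h
  | refl _ => rfl
  | symm _ _ _ ih => exact ih.symm
  | trans _ _ _ _ _ ih₁ ih₂ => exact ih₁.trans ih₂

/-- A step along an edge of the order complex, with the accumulated value of the cocycle. -/
def LiftedStep (c : X → X → W) (a b : X × W) : Prop :=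
  Comparable a.1 b.1 ∧ b.2 = a.2 + stepValue c a.1 b.1

/-- A path in the covering defined by a cocycle projects to an edge path along which the cocycle
sums to the difference of the levels. -/
theorem exists_path_of_liftedStep {c : X → X → W} {a b : X × W}
    (h : Relation.ReflTransGen (LiftedStep c) a b) :
    ∃ l, List.IsChain Comparable (a.1 :: l) ∧ (a.1 :: l).getLast? = some b.1 ∧
      pathSum c (a.1 :: l) = b.2 - a.2 := by
  induction h using Relation.ReflTransGen.head_induction_on with
  | refl => exact ⟨[], by simp, by simp, by simp [pathSum]⟩
  | head h _ ih =>
    obtain ⟨l, h1, h2, h3⟩ := ih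
    refine ⟨_ :: l, List.IsChain.cons_cons h.1 h1, by simpa using h2, ?_⟩
    rw [pathSum, h3, h.2]
    abel

theorem exists_liftedStep {c : X → X → W} {x y : X} (h : Relation.ReflTransGen Comparable x y)
    (w : W) : ∃ w', Relation.ReflTransGen (LiftedStep c) (x, w) (y, w') := by
  induction h with
  | refl => exact ⟨w, Relation.ReflTransGen.refl⟩
  | tail _ h ih =>
    obtain ⟨w', hw⟩ := ih
    exact ⟨w' + stepValue c _ _, hw.tail ⟨h, rfl⟩⟩

/-- On a simply connected poset every additive cocycle is a coboundary. -/
theorem PosetSimplyConnected.exists_potential (hX : PosetSimplyConnected X) {c : X → X → W}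
    (hc : ∀ x y z, x ≤ y → y ≤ z → c x z = c x y + c y z) :
    ∃ u : X → W, ∀ x y, x ≤ y → c x y = u y - u x := by
  obtain ⟨⟨⟨x₀⟩, hconn⟩, hloop⟩ := hX
  have loop : ∀ w, Relation.ReflTransGen (LiftedStep c) (x₀, 0) (x₀, w) → w = 0 := by
    intro w h
    obtain ⟨l, h1, h2, h3⟩ := exists_path_of_liftedStep h
    have h4 := pathSum_eq_of_eqvGen hc (hloop x₀ (x₀ :: l) h1 (by simp) h2)
    simp only [pathSum] at h4
    rw [h4, sub_zero] at h3
    exact h3.symm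
  choose u hu using fun y => exists_liftedStep (c := c) (hconn x₀ y) 0
  refine ⟨u, fun x y hxy => ?_⟩
  -- one path back from `y` closes both the path through `x` and the direct one
  have hback : ∀ w, ∃ t, ∀ w', Relation.ReflTransGen (LiftedStep c) (y, w') (x₀, t + w' - w) := by
    intro w
    obtain ⟨t, ht⟩ := exists_liftedStep (c := c) (hconn y x₀) w
    refine ⟨t, fun w' => ?_⟩
    have shift : ∀ a b, LiftedStep c a b →
        LiftedStep c (a.1, a.2 + (w' - w)) (b.1, b.2 + (w' - w)) := fun a b hab => by
      refine ⟨hab.1, ?_⟩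
      change b.2 + _ = a.2 + _ + _
      rw [hab.2]
      abel
    have := Relation.ReflTransGen.lift (p := LiftedStep c)
      (fun a : X × W => (a.1, a.2 + (w' - w))) shift _ _ ht
    simp only [Function.onFun] at this
    simp only [add_sub_cancel] at this
    rwa [← add_sub_assoc] at this
  obtain ⟨t, ht⟩ := hback 0
  have e1 := loop _ ((hu y).trans (ht (u y)))
  have e2 := loop _ (((hu x).tail (c := (y, u x + stepValue c x y)) ⟨Or.inl hxy, rfl⟩).trans
    (ht (u x + stepValue c x y)))
  rw [stepValue_of_le hxy] at e2
  have e3 := e1.trans e2.symm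
  simp only [sub_zero, add_right_inj] at e3
  rw [e3]
  abel

end Cocycle

/-- The cellular cohomology of a circle in degree one: a cochain on the vertices `F` of a cycle
with zero sum is the coboundary of a cochain on its edges `S`. -/
theorem exists_coboundary {S F W : Type*} [Fintype S] [Fintype F] [AddCommGroup W] [Module ℝ W]
    [FiniteDimensional ℝ W] (ε : F → S → ℝ) (hcard : Fintype.card S = Fintype.card F)
    (hcol : ∀ s, ∑ f, ε f s = 0)
    (hker : ∀ ξ : S → W, (∀ f, ∑ s, ε f s • ξ s = 0) → ∀ s t, ξ s = ξ t)
    (m : F → W) (hm : ∑ f, m f = 0) : ∃ ξ : S → W, ∀ f, ∑ s, ε f s • ξ s = m f := by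
  classical
  rcases isEmpty_or_nonempty F with hF | hF
  · exact ⟨0, fun f => hF.elim f⟩
  let δ : (S → W) →ₗ[ℝ] (F → W) :=
    LinearMap.pi fun f => ∑ s, ε f s • LinearMap.proj s
  have hδ : ∀ ξ f, δ ξ f = ∑ s, ε f s • ξ s := fun ξ f => by simp [δ]
  let σ : (F → W) →ₗ[ℝ] W := ∑ f, LinearMap.proj f
  have hσ : ∀ m, σ m = ∑ f, m f := fun m => by simp [σ]
  have hle : LinearMap.range δ ≤ LinearMap.ker σ := by
    rintro _ ⟨ξ, rfl⟩
    rw [LinearMap.mem_ker, hσ]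
    simp only [hδ]
    rw [Finset.sum_comm]
    simp only [← Finset.sum_smul, hcol, zero_smul, Finset.sum_const_zero]
  have hsurj : Function.Surjective σ := by
    intro w
    obtain ⟨f⟩ := hF
    exact ⟨Pi.single f w, by rw [hσ]; simp⟩
  obtain ⟨s₀⟩ : Nonempty S := Fintype.card_pos_iff.1 (hcard ▸ Fintype.card_pos)
  -- the kernel of `δ` consists of constants, so by a dimension count its range is all of `ker σ`
  have hk : Module.finrank ℝ (LinearMap.ker δ) ≤ Module.finrank ℝ W := by
    refine LinearMap.finrank_le_finrank_of_injective
      (f := (LinearMap.proj s₀ : (S → W) →ₗ[ℝ] W) ∘ₗ (LinearMap.ker δ).subtype) ?_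
    rw [← LinearMap.ker_eq_bot, LinearMap.ker_eq_bot']
    intro ξ h
    apply Subtype.ext
    funext s
    rw [hker ξ.1 (fun f => by rw [← hδ, LinearMap.mem_ker.1 ξ.2]; rfl) s s₀]
    exact h
  have h1 := LinearMap.finrank_range_add_finrank_ker δ
  have h2 := LinearMap.finrank_range_add_finrank_ker σ
  rw [LinearMap.range_eq_top.2 hsurj, finrank_top] at h2
  rw [Module.finrank_pi_fintype] at h1 h2
  simp only [Finset.sum_const, Finset.card_univ, smul_eq_mul, hcard] at h1 h2
  have h3 := Submodule.eq_of_le_of_finrank_le hle (by omega)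
  have h4 : m ∈ LinearMap.range δ := by
    rw [h3, LinearMap.mem_ker, hσ, hm]
  obtain ⟨ξ, hξ⟩ := h4
  exact ⟨ξ, fun f => by rw [← hδ, hξ]⟩

variable {Γ V P : Type*} [Group Γ] [MulAction Γ V] [PartialOrder P] [MulAction Γ P]

namespace Triangulation

variable (T : Triangulation Γ V P)

/-! ### Faces of simplices -/

theorem eq_of_le_of_verts {p q r : P} (hq : q ≤ p) (hr : r ≤ p) (h : T.verts q = T.verts r) :
    q = r :=
  (T.existsUnique_face p (T.verts r) (T.verts_mono p r hr) (T.verts_nonempty r)).unique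
    ⟨hq, h⟩ ⟨hr, rfl⟩

theorem face_le (p : P) (S : Finset V) (h : S ⊆ T.verts p) (hS : S.Nonempty) :
    T.face p S h hS ≤ p :=
  (Classical.choose_spec (T.existsUnique_face p S h hS)).1.1

theorem le_of_verts_subset {p q r : P} (hq : q ≤ p) (hr : r ≤ p) (h : T.verts q ⊆ T.verts r) :
    q ≤ r := by
  have h1 := T.face_le r (T.verts q) h (T.verts_nonempty q)
  have h2 := T.verts_face r (T.verts q) h (T.verts_nonempty q)
  rw [← T.eq_of_le_of_verts (h1.trans hr) hq h2]
  exact h1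

theorem card_lt_of_lt {p q : P} (h : q < p) : (T.verts q).card < (T.verts p).card := by
  refine Finset.card_lt_card ⟨T.verts_mono p q h.le, fun h' => ?_⟩
  exact h.ne (T.eq_of_le_of_verts h.le le_rfl (Finset.Subset.antisymm (T.verts_mono p q h.le) h'))

theorem lt_of_le_of_card {p q : P} (h : q ≤ p) (hc : (T.verts q).card < (T.verts p).card) :
    q < p :=
  lt_of_le_of_ne h fun e => by rw [e] at hc; exact lt_irrefl _ hc

theorem eq_of_le_of_card {p q : P} (h : q ≤ p) (hc : (T.verts p).card ≤ (T.verts q).card) :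
    q = p :=
  T.eq_of_le_of_verts h le_rfl (Finset.eq_of_subset_of_card_le (T.verts_mono p q h) hc)

open Classical in
/-- A vertex of `p` outside `q`. It is used when `q` is a face of `p` of codimension one, and then
it is the vertex opposite to `q`. -/
def apex (p q : P) : V :=
  if h : ∃ v, v ∈ T.verts p ∧ v ∉ T.verts q then h.choose else (T.verts_nonempty p).choose

open Classical in
theorem exists_insert_verts {p q : P} (h : q ≤ p)
    (hc : (T.verts p).card = (T.verts q).card + 1) :
    ∃ v, v ∉ T.verts q ∧ T.verts p = insert v (T.verts q) := by
  obtain ⟨v, hv⟩ := Finset.card_eq_one.1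
    (show (T.verts p \ T.verts q).card = 1 by
      rw [Finset.card_sdiff_of_subset (T.verts_mono p q h)]; omega)
  have hv' : v ∈ T.verts p \ T.verts q := by rw [hv]; simp
  refine ⟨v, (Finset.mem_sdiff.1 hv').2, ?_⟩
  rw [← Finset.sdiff_union_of_subset (T.verts_mono p q h), hv]
  rfl

open Classical in
theorem apex_eq {p q : P} {v : V} (hv : v ∉ T.verts q) (h : T.verts p = insert v (T.verts q)) :
    T.apex p q = v := by
  have hex : ∃ v, v ∈ T.verts p ∧ v ∉ T.verts q := ⟨v, by rw [h]; simp, hv⟩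
  rw [apex, dif_pos hex]
  obtain ⟨h1, h2⟩ := hex.choose_spec
  exact (Finset.mem_insert.1 ((Finset.ext_iff.1 h _).1 h1)).resolve_right h2

open Classical in
theorem verts_eq_insert_apex {p q : P} (h : q ≤ p)
    (hc : (T.verts p).card = (T.verts q).card + 1) :
    T.apex p q ∉ T.verts q ∧ T.verts p = insert (T.apex p q) (T.verts q) := by
  obtain ⟨v, h1, h2⟩ := T.exists_insert_verts h hc
  rw [T.apex_eq h1 h2]
  exact ⟨h1, h2⟩

open Classical in
/-- A face `q` of codimension two of `p` is contained in exactly two facets of `p`. -/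
theorem exists_between {k : ℕ} {p q : P} (h : q ≤ p) (hq : (T.verts q).card = k + 1)
    (hp : (T.verts p).card = k + 3) :
    ∃ (x y : V) (r s : T.Cell (k + 1)), x ≠ y ∧ x ∉ T.verts q ∧ y ∉ T.verts q ∧
      T.verts p = insert x (insert y (T.verts q)) ∧ r ≠ s ∧
      T.verts r.1 = insert x (T.verts q) ∧ T.verts s.1 = insert y (T.verts q) ∧
      ∀ t : T.Cell (k + 1), q < t.1 ∧ t.1 < p ↔ t = r ∨ t = s := by
  obtain ⟨x, y, hxy, hd⟩ := Finset.card_eq_two.1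
    (show (T.verts p \ T.verts q).card = 2 by
      rw [Finset.card_sdiff_of_subset (T.verts_mono p q h)]; omega)
  have hx : x ∈ T.verts p \ T.verts q := by rw [hd]; simp
  have hy : y ∈ T.verts p \ T.verts q := by rw [hd]; simp
  rw [Finset.mem_sdiff] at hx hy
  have hv : T.verts p = insert x (insert y (T.verts q)) := by
    rw [← Finset.sdiff_union_of_subset (T.verts_mono p q h), hd]
    ext z
    simp
  have hsx : insert x (T.verts q) ⊆ T.verts p :=
    Finset.insert_subset hx.1 (T.verts_mono p q h)
  have hsy : insert y (T.verts q) ⊆ T.verts p :=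
    Finset.insert_subset hy.1 (T.verts_mono p q h)
  have vr := T.verts_face p _ hsx (Finset.insert_nonempty _ _)
  have vs := T.verts_face p _ hsy (Finset.insert_nonempty _ _)
  have lr := T.face_le p _ hsx (Finset.insert_nonempty _ _)
  have ls := T.face_le p _ hsy (Finset.insert_nonempty _ _)
  have cr : (T.verts (T.face p _ hsx (Finset.insert_nonempty _ _))).card = (k + 1) + 1 := by
    rw [vr, Finset.card_insert_of_notMem hx.2, hq]
  have cs : (T.verts (T.face p _ hsy (Finset.insert_nonempty _ _))).card = (k + 1) + 1 := by
    rw [vs, Finset.card_insert_of_notMem hy.2, hq]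
  refine ⟨x, y, ⟨_, cr⟩, ⟨_, cs⟩, hxy, hx.2, hy.2, hv, ?_, vr, vs, fun t => ⟨?_, ?_⟩⟩
  · intro e
    have e2 := congrArg (fun t : T.Cell (k + 1) => T.verts t.1) e
    simp only [vr, vs] at e2
    have : x ∈ insert y (T.verts q) := by rw [← e2]; simp
    rcases Finset.mem_insert.1 this with h' | h'
    · exact hxy h'
    · exact hx.2 h'
  · rintro ⟨h1, h2⟩
    obtain ⟨z, hz, hz'⟩ := T.exists_insert_verts h1.le (by rw [t.2, hq])
    have hzp : z ∈ T.verts p := T.verts_mono p t.1 h2.le (by rw [hz']; simp)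
    rw [hv] at hzp
    simp only [Finset.mem_insert, hz, or_false] at hzp
    rcases hzp with rfl | rfl
    · exact Or.inl (Subtype.ext (T.eq_of_le_of_verts h2.le lr (by rw [hz', vr])))
    · exact Or.inr (Subtype.ext (T.eq_of_le_of_verts h2.le ls (by rw [hz', vs])))
  · have hqr : q ≤ T.face p _ hsx (Finset.insert_nonempty _ _) :=
      T.le_of_verts_subset h lr (by rw [vr]; exact Finset.subset_insert _ _)
    have hqs : q ≤ T.face p _ hsy (Finset.insert_nonempty _ _) :=
      T.le_of_verts_subset h ls (by rw [vs]; exact Finset.subset_insert _ _)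
    rintro (rfl | rfl)
    · exact ⟨T.lt_of_le_of_card hqr (by rw [cr, hq]; omega),
        T.lt_of_le_of_card lr (by rw [cr, hp]; omega)⟩
    · exact ⟨T.lt_of_le_of_card hqs (by rw [cs, hq]; omega),
        T.lt_of_le_of_card ls (by rw [cs, hp]; omega)⟩

variable {T} (hT : T.IsClosedManifold)

/-- The `k`-dimensional simplices that properly contain `p`. -/
def IsClosedManifold.above (k : ℕ) (p : P) : Finset (T.Cell k) :=
  (((hT.finite_star p).subset Set.Ioi_subset_Ici_self).preimage
    (f := fun s : T.Cell k => s.1) Subtype.val_injective.injOn).toFinset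

theorem IsClosedManifold.mem_above {k : ℕ} {p : P} {s : T.Cell k} :
    s ∈ hT.above k p ↔ p < s.1 := by
  simp [IsClosedManifold.above]

open Classical in
/-- The `k`-dimensional simplices strictly between `p` and `q`. -/
def IsClosedManifold.between (k : ℕ) (p q : P) : Finset (T.Cell k) :=
  (hT.above k p).filter fun r => r.1 < q

theorem IsClosedManifold.mem_between {k : ℕ} {p q : P} {s : T.Cell k} :
    s ∈ hT.between k p q ↔ p < s.1 ∧ s.1 < q := by
  simp [IsClosedManifold.between, hT.mem_above]

/-- Summation over the flags `p < r < s` in the two possible orders. -/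
theorem IsClosedManifold.sum_above_above {W : Type*} [AddCommMonoid W] {j k : ℕ} (p : P)
    (F : T.Cell j → T.Cell k → W) :
    ∑ r ∈ hT.above j p, ∑ s ∈ hT.above k r.1, F r s =
      ∑ s ∈ hT.above k p, ∑ r ∈ hT.between j p s.1, F r s := by
  refine Finset.sum_comm' fun r s => ?_
  rw [hT.mem_above, hT.mem_above, hT.mem_above, hT.mem_between]
  exact ⟨fun h => ⟨h, h.1.trans h.2⟩, fun h => h.1⟩

open Classical in
/-- The two simplices between a simplex and a face of codimension two. -/
theorem IsClosedManifold.exists_between_eq {k : ℕ} {p q : P} (h : q ≤ p)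
    (hq : (T.verts q).card = k + 1) (hp : (T.verts p).card = k + 3) :
    ∃ (x y : V) (r s : T.Cell (k + 1)), x ≠ y ∧ x ∉ T.verts q ∧ y ∉ T.verts q ∧
      T.verts p = insert x (insert y (T.verts q)) ∧ r ≠ s ∧
      T.apex r.1 q = x ∧ T.apex s.1 q = y ∧ T.apex p r.1 = y ∧ T.apex p s.1 = x ∧
      hT.between (k + 1) q p = {r, s} := by
  obtain ⟨x, y, r, s, hxy, hx, hy, hv, hrs, vr, vs, hb⟩ := T.exists_between h hq hp
  refine ⟨x, y, r, s, hxy, hx, hy, hv, hrs, T.apex_eq hx vr, T.apex_eq hy vs, ?_, ?_, ?_⟩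
  · refine T.apex_eq ?_ (by rw [hv, vr, Finset.insert_comm])
    rw [vr, Finset.mem_insert, not_or]
    exact ⟨hxy.symm, hy⟩
  · refine T.apex_eq ?_ (by rw [hv, vs])
    rw [vs, Finset.mem_insert, not_or]
    exact ⟨hxy, hx⟩
  · ext t
    rw [hT.mem_between, hb]
    simp

open Classical in
theorem IsClosedManifold.exists_above_eq (f : T.Cell 3) :
    ∃ s t : T.Cell 4, s ≠ t ∧ hT.above 4 f.1 = {s, t} := by
  obtain ⟨s, t, hst, h⟩ := Set.ncard_eq_two.1 (hT.two_sided f)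
  refine ⟨s, t, hst, ?_⟩
  ext r
  have : r ∈ {s : T.Cell 4 | f.1 < s.1} ↔ r = s ∨ r = t := by rw [h]; rfl
  rw [hT.mem_above, Finset.mem_insert, Finset.mem_singleton]
  exact this

/-! ### Connectivity of stars and gluing of local data -/

/-- Two 4-simplices with a common tetrahedron in the set `Q`. -/
def Adjacent (Q : Set P) (s t : T.Cell 4) : Prop :=
  ∃ f : T.Cell 3, f.1 ∈ Q ∧ f.1 < s.1 ∧ f.1 < t.1

theorem adjacent_mono {Q Q' : Set P} (h : Q ⊆ Q') {s t : T.Cell 4} (hst : Adjacent Q s t) :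
    Adjacent Q' s t := by
  obtain ⟨f, h1, h2⟩ := hst
  exact ⟨f, h h1, h2⟩

/-- The 4-simplices over a connected family of simplices with strongly connected stars form a
strongly connected family. -/
theorem reflTransGen_adjacent_of_connected (hT : T.IsClosedManifold) {X : Type*}
    [PartialOrder X] (e : X ↪o P) (Q : Set P) (hQ : ∀ x, Set.Ici (e x) ⊆ Q) (hX : PosetConnected X)
    (hstar : ∀ (x : X) (s t : T.Cell 4), e x ≤ s.1 → e x ≤ t.1 →
      Relation.ReflTransGen (Adjacent (Set.Ici (e x))) s t)
    (x y : X) (s t : T.Cell 4) (hs : e x ≤ s.1) (ht : e y ≤ t.1) :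
    Relation.ReflTransGen (Adjacent Q) s t := by
  have hstar' : ∀ (x : X) (s t : T.Cell 4), e x ≤ s.1 → e x ≤ t.1 →
      Relation.ReflTransGen (Adjacent Q) s t := fun x s t h1 h2 =>
    Relation.ReflTransGen.mono (fun _ _ => adjacent_mono (hQ x)) _ _ (hstar x s t h1 h2)
  have hpath := hX.2 x y
  induction hpath generalizing t with
  | refl => exact hstar' x s t hs ht
  | @tail y z _ hyz ih =>
    obtain ⟨r, hry, hrz⟩ : ∃ r : T.Cell 4, e y ≤ r.1 ∧ e z ≤ r.1 := by
      rcases hyz with h | h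
      · obtain ⟨r, hr⟩ := hT.pure (e z)
        exact ⟨r, (e.monotone h).trans hr, hr⟩
      · obtain ⟨r, hr⟩ := hT.pure (e y)
        exact ⟨r, hr, (e.monotone h).trans hr⟩
    exact (ih r hry).trans (hstar' z r t hrz ht)

theorem connected_link (hT : T.IsClosedManifold) {p : P} (hp : (T.verts p).card ≤ 3) :
    PosetConnected (Set.Ioi p) := by
  have h1 := Finset.card_pos.2 (T.verts_nonempty p)
  obtain h | h | h : (T.verts p).card = 1 ∨ (T.verts p).card = 2 ∨ (T.verts p).card = 3 := by omega
  · exact (hT.link_vertex ⟨p, h⟩).1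
  · exact (hT.link_edge ⟨p, h⟩).1
  · exact hT.link_triangle ⟨p, h⟩

/-- The 4-simplices that contain a given simplex form a strongly connected family. -/
theorem star_connected (hT : T.IsClosedManifold) (p : P) (s t : T.Cell 4) (hs : p ≤ s.1)
    (ht : p ≤ t.1) : Relation.ReflTransGen (Adjacent (Set.Ici p)) s t := by
  induction hn : 5 - (T.verts p).card using Nat.strong_induction_on generalizing p s t with
  | _ n ih =>
    have hcard := hT.card_le p
    rcases eq_or_ne (T.verts p).card 5 with h5 | h5
    · have e1 := T.eq_of_le_of_card hs (by rw [s.2, h5])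
      have e2 := T.eq_of_le_of_card ht (by rw [t.2, h5])
      rw [show s = t from Subtype.ext (e1.symm.trans e2)]
    have hps : p < s.1 := T.lt_of_le_of_card hs (by rw [s.2]; omega)
    have hpt : p < t.1 := T.lt_of_le_of_card ht (by rw [t.2]; omega)
    rcases eq_or_ne (T.verts p).card 4 with h4 | h4
    · exact Relation.ReflTransGen.single ⟨⟨p, h4⟩, Set.mem_Ici.2 le_rfl, hps, hpt⟩
    · refine reflTransGen_adjacent_of_connected hT (OrderEmbedding.subtype (· ∈ Set.Ioi p))
        (Set.Ici p) (fun x q hq => (le_of_lt x.2).trans hq) (connected_link hT (by omega))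
        (fun x s t hs ht => ?_) ⟨s.1, hps⟩ ⟨t.1, hpt⟩ s t le_rfl le_rfl
      have := T.card_lt_of_lt (show p < x.1 from x.2)
      exact ih _ (by omega) x.1 s t hs ht rfl

/-- All the 4-simplices of the covering form a strongly connected family. -/
theorem adjacent_connected (hT : T.IsClosedManifold) (s t : T.Cell 4) :
    Relation.ReflTransGen (Adjacent (T := T) Set.univ) s t :=
  reflTransGen_adjacent_of_connected hT (RelEmbedding.refl _) _ (fun _ => Set.subset_univ _)
    T.simplyConnected.1 (fun x s t hs ht => star_connected hT x s t hs ht) s.1 t.1 s t le_rfl le_rfl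

section Gluing

variable {W : Type*} [AddCommGroup W] (m : T.Cell 3 → T.Cell 4 → W)

/-- The values `ξ` at the 4-simplices have the prescribed jumps at all the tetrahedra in `Q`. -/
def HasJumps (Q : Set P) (ξ : T.Cell 4 → W) : Prop :=
  ∀ (f : T.Cell 3) (s t : T.Cell 4), f.1 ∈ Q → f.1 < s.1 → f.1 < t.1 →
    ξ s + m f s = ξ t + m f t

variable {m}

theorem HasJumps.mono {Q Q' : Set P} (h : Q' ⊆ Q) {ξ : T.Cell 4 → W} (hξ : HasJumps m Q ξ) :
    HasJumps m Q' ξ := fun f s t hf => hξ f s t (h hf)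

/-- Two solutions with the same jumps differ by a constant on a strongly connected family. -/
theorem HasJumps.sub_eq_sub {Q : Set P} {ξ η : T.Cell 4 → W} (hξ : HasJumps m Q ξ)
    (hη : HasJumps m Q η) {s t : T.Cell 4} (h : Relation.ReflTransGen (Adjacent Q) s t) :
    ξ s - η s = ξ t - η t := by
  induction h with
  | refl => rfl
  | @tail r t _ h ih =>
    obtain ⟨f, hf, h1, h2⟩ := h
    have e1 := hξ f r t hf h1 h2
    have e2 := hη f r t hf h1 h2
    rw [ih, sub_eq_sub_iff_add_eq_add]
    have e3 : ξ r + m f r + (η t + m f t) = ξ t + m f t + (η r + m f r) := by rw [e1, e2]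
    have e4 : ξ r + η t + (m f r + m f t) = ξ t + η r + (m f r + m f t) := by
      rw [show ξ r + η t + (m f r + m f t) = ξ r + m f r + (η t + m f t) by abel, e3]
      abel
    rw [add_right_cancel e4]

/-- Values with prescribed jumps that exist locally exist globally over a simply connected
family of simplices. -/
theorem exists_hasJumps_of_simplyConnected (hT : T.IsClosedManifold) {X : Type*} [PartialOrder X]
    (e : X ↪o P) (Q : Set P) (hQ : ∀ p ∈ Q, ∃ x, e x = p) (hup : ∀ x p, e x ≤ p → p ∈ Q)
    (hX : PosetSimplyConnected X) (hloc : ∀ x, ∃ ξ : T.Cell 4 → W, HasJumps m (Set.Ici (e x)) ξ) :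
    ∃ ξ : T.Cell 4 → W, HasJumps m Q ξ := by
  classical
  choose η hη using hloc
  choose top htop using fun x => hT.pure (e x)
  have hdiff : ∀ x y, x ≤ y → ∀ s t : T.Cell 4, e y ≤ s.1 → e y ≤ t.1 →
      η x s - η y s = η x t - η y t := fun x y hxy s t hs ht =>
    ((hη x).mono (Set.Ici_subset_Ici.2 (e.monotone hxy))).sub_eq_sub (hη y)
      (star_connected hT _ s t hs ht)
  obtain ⟨u, hu⟩ := hX.exists_potential (c := fun x y => η x (top y) - η y (top y))
    (fun x y z hxy hyz => by
      rw [hdiff x y hxy (top y) (top z) (htop y) ((e.monotone hyz).trans (htop z))]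
      abel)
  refine ⟨fun s => if h : ∃ x, e x = s.1 then η h.choose s + u h.choose else 0, ?_⟩
  intro f s t hf hs ht
  obtain ⟨x, hx⟩ := hQ _ hf
  -- over the star of a tetrahedron the glued values differ from the local ones by a constant
  have key : ∀ s : T.Cell 4, f.1 < s.1 →
      (if h : ∃ x, e x = s.1 then η h.choose s + u h.choose else 0) = η x s + u x := by
    intro s hs
    have h : ∃ x, e x = s.1 := hQ _ (hup x _ (hx ▸ hs.le))
    rw [dif_pos h]
    have h1 := h.choose_spec
    have hle : x ≤ h.choose := e.le_iff_le.1 (by rw [h1, hx]; exact hs.le)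
    have h2 := hu _ _ hle
    rw [hdiff x _ hle (top h.choose) s (htop _) h1.le, sub_eq_sub_iff_add_eq_add] at h2
    rw [h2, add_comm]
  simp only [key s hs, key t ht]
  have := hη x f s t (by rw [hx]; exact Set.mem_Ici.2 le_rfl) hs ht
  rw [add_right_comm, this, add_right_comm]

/-- Values with prescribed jumps exist on the whole covering if they exist around each triangle:
the links of edges and vertices and the covering itself are simply connected. -/
theorem exists_hasJumps (hT : T.IsClosedManifold)
    (htri : ∀ i : T.Cell 2, ∃ ξ : T.Cell 4 → W, HasJumps m (Set.Ici i.1) ξ) :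
    ∃ ξ : T.Cell 4 → W, HasJumps m Set.univ ξ := by
  have hloc : ∀ p : P, ∃ ξ : T.Cell 4 → W, HasJumps m (Set.Ici p) ξ := by
    intro p
    induction hn : 5 - (T.verts p).card using Nat.strong_induction_on generalizing p with
    | _ n ih =>
      have hpos := Finset.card_pos.2 (T.verts_nonempty p)
      have hcard := hT.card_le p
      rcases eq_or_ne (T.verts p).card 5 with h5 | h5
      · refine ⟨0, fun f s t hf => ?_⟩
        have := Finset.card_le_card (T.verts_mono f.1 p hf)
        rw [f.2, h5] at this
        omega
      rcases eq_or_ne (T.verts p).card 4 with h4 | h4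
      · refine ⟨fun s => -m ⟨p, h4⟩ s, fun f s t hf _ _ => ?_⟩
        have hfp : f = ⟨p, h4⟩ :=
          (Subtype.ext (T.eq_of_le_of_card (show p ≤ f.1 from hf) (by rw [f.2, h4]))).symm
        rw [hfp, neg_add_cancel, neg_add_cancel]
      rcases eq_or_ne (T.verts p).card 3 with h3 | h3
      · exact htri ⟨p, h3⟩
      have hsc : PosetSimplyConnected (Set.Ioi p) := by
        obtain h | h : (T.verts p).card = 1 ∨ (T.verts p).card = 2 := by omega
        · exact hT.link_vertex ⟨p, h⟩
        · exact hT.link_edge ⟨p, h⟩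
      obtain ⟨ξ, hξ⟩ := exists_hasJumps_of_simplyConnected hT
        (OrderEmbedding.subtype (· ∈ Set.Ioi p)) (Set.Ioi p) (fun q hq => ⟨⟨q, hq⟩, rfl⟩)
        (fun x q hq => lt_of_lt_of_le (show p < x.1 from x.2) hq) hsc
        (fun x => by
          have := T.card_lt_of_lt (show p < x.1 from x.2)
          exact ih _ (by omega) x.1 rfl)
      refine ⟨ξ, fun f s t hf => hξ f s t (lt_of_le_of_ne hf fun e => ?_)⟩
      have := f.2
      rw [← e] at this
      exact h4 this
  exact exists_hasJumps_of_simplyConnected hT (RelEmbedding.refl _) _ (fun p _ => ⟨p, rfl⟩)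
    (fun _ _ _ => Set.mem_univ _) T.simplyConnected hloc

end Gluing

end Triangulation

/-! ### Orientations of simplices -/

/-- The signed volume (up to a constant factor) of a 4-simplex with given ordered vertices. -/
def volSimplex (x : Fin 5 → E4) : ℝ := vol (x 1 - x 0) (x 2 - x 0) (x 3 - x 0) (x 4 - x 0)

theorem volSimplex_eq_det (x : Fin 5 → E4) :
    volSimplex x = Matrix.det (Matrix.of fun i : Fin 5 => (Fin.cons 1 (x i) : Fin 5 → ℝ)) := by
  have h := Matrix.det_eq_of_forall_row_eq_smul_add_const
    (A := Matrix.of fun i : Fin 5 => if i = 0 then (Fin.cons 1 (x 0) : Fin 5 → ℝ) else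
      Fin.cons 0 (x i - x 0))
    (B := Matrix.of fun i : Fin 5 => (Fin.cons 1 (x i) : Fin 5 → ℝ))
    (fun i => if i = 0 then 0 else -1) 0 (by simp) (by
      intro i j
      by_cases hi : i = 0
      · subst hi; simp
      · simp only [Matrix.of_apply, if_neg hi]
        refine Fin.cases ?_ (fun j => ?_) j
        · simp
        · simp [sub_eq_add_neg])
  rw [← h, Matrix.det_succ_column_zero, Finset.sum_eq_single 0]
  · rw [volSimplex, vol]
    simp only [Fin.val_zero, pow_zero, one_mul, Matrix.of_apply, if_pos, Fin.cons_zero]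
    congr 1
    ext i j
    fin_cases i <;> simp
  · intro i _ hi
    simp [hi]
  · simp

theorem volSimplex_comp (x : Fin 5 → E4) (σ : Equiv.Perm (Fin 5)) :
    volSimplex (x ∘ σ) = (Equiv.Perm.sign σ : ℝ) * volSimplex x := by
  rw [volSimplex_eq_det, volSimplex_eq_det, ← Matrix.det_permute]
  rfl

theorem volSimplex_ne_zero {x : Fin 5 → E4} (hx : AffineIndependent ℝ x) : volSimplex x ≠ 0 := by
  have h1 := (affineIndependent_iff_linearIndependent_vsub ℝ x 0).1 hx
  have h2 := h1.comp (fun i : Fin 4 => (⟨i.succ, Fin.succ_ne_zero i⟩ : {i : Fin 5 // i ≠ 0}))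
    (fun i j h => by simpa using h)
  have h3 := h2.map' (WithLp.linearEquiv 2 ℝ (Fin 4 → ℝ)).toLinearMap (LinearEquiv.ker _)
  let M : Matrix (Fin 4) (Fin 4) ℝ :=
    Matrix.of ![(x 1 - x 0).ofLp, (x 2 - x 0).ofLp, (x 3 - x 0).ofLp, (x 4 - x 0).ofLp]
  have e : M.row = ⇑(WithLp.linearEquiv 2 ℝ (Fin 4 → ℝ)).toLinearMap ∘
      (fun i : {i : Fin 5 // i ≠ 0} => x i -ᵥ x 0) ∘
        fun i : Fin 4 => (⟨i.succ, Fin.succ_ne_zero i⟩ : {i : Fin 5 // i ≠ 0}) := by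
    funext i
    fin_cases i <;> rfl
  have h4 : IsUnit M := Matrix.linearIndependent_rows_iff_isUnit.1 (by rw [e]; exact h3)
  exact ((Matrix.isUnit_iff_isUnit_det _).1 h4).ne_zero

theorem vol_map (f : E4 →ₗ[ℝ] E4) (a b c d : E4) :
    vol (f a) (f b) (f c) (f d) = LinearMap.det f * vol a b c d := by
  have h : ∀ w : Fin 4 → E4, (EuclideanSpace.basisFun (Fin 4) ℝ).toBasis.det w =
      Matrix.det (Matrix.of fun i => (w i).ofLp) := fun w => by
    rw [Module.Basis.det_apply, ← Matrix.det_transpose]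
    rfl
  have h2 : ∀ a b c d : E4, vol a b c d =
      (EuclideanSpace.basisFun (Fin 4) ℝ).toBasis.det ![a, b, c, d] := fun a b c d => by
    rw [h, vol]
    congr 1
    ext i j
    fin_cases i <;> rfl
  rw [h2, h2, ← Module.Basis.det_comp]
  congr 1
  ext i j
  fin_cases i <;> rfl

theorem sign_mul_sign_self {r : ℝ} (h : r ≠ 0) : Real.sign r * Real.sign r = 1 := by
  rcases lt_or_gt_of_ne h with h | h
  · rw [Real.sign_of_neg h]; ring
  · rw [Real.sign_of_pos h]; ring

theorem units_cast_eq_neg {a b : ℤˣ} (h : b * a = -1) :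
    ((a : ℤ) : ℝ) = -((b : ℤ) : ℝ) ∧ ((b : ℤ) : ℝ) ≠ 0 := by
  rcases Int.units_eq_one_or a with rfl | rfl <;> rcases Int.units_eq_one_or b with rfl | rfl <;>
    revert h <;> simp

theorem vec_five_eq {α : Type*} (a b c d e e' : α) {m : Fin 5} (hm : m ≠ 4) :
    ![a, b, c, d, e] m = ![a, b, c, d, e'] m := by
  fin_cases m <;> first | rfl | exact absurd rfl hm

theorem sign_permSign_mul (σ : Equiv.Perm (Fin 5)) (r : ℝ) :
    Real.sign ((Equiv.Perm.sign σ : ℝ) * r) = (Equiv.Perm.sign σ : ℝ) * Real.sign r := by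
  rcases Int.units_eq_one_or (Equiv.Perm.sign σ) with h | h <;> rw [h] <;> simp [Real.sign_neg]

namespace Triangulation

variable {T : Triangulation Γ V P}

theorem exists_smul_eq_lift {k : ℕ} (p : T.Cell k) : ∃ g : Γ, g • p = T.lift (T.proj p) := by
  have h : (T.proj (T.lift (T.proj p))) = T.proj p := Quotient.out_eq _
  obtain ⟨g, hg⟩ : (MulAction.orbitRel Γ (T.Cell k)).r (T.lift (T.proj p)) p := Quotient.exact h
  exact ⟨g, hg⟩

theorem proj_lift {k : ℕ} (p : T.Face k) : T.proj (T.lift p) = p := Quotient.out_eq p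

theorem proj_smul {k : ℕ} (g : Γ) (p : T.Cell k) : T.proj (g • p) = T.proj p :=
  Quotient.sound ⟨g, rfl⟩

theorem smul_cell_val {k : ℕ} (g : Γ) (p : T.Cell k) : (g • p).1 = g • p.1 := rfl

theorem smul_le_smul_iff (T : Triangulation Γ V P) (g : Γ) (p q : P) : g • p ≤ g • q ↔ p ≤ q := by
  refine ⟨fun h => ?_, T.smul_mono g q p⟩
  have := T.smul_mono g⁻¹ _ _ h
  simpa using this

theorem smul_lt_smul_iff (T : Triangulation Γ V P) (g : Γ) (p q : P) : g • p < g • q ↔ p < q := by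
  rw [lt_iff_le_not_ge, lt_iff_le_not_ge, T.smul_le_smul_iff, T.smul_le_smul_iff]

open Classical in
theorem verts_edge {k : ℕ} (s : T.Cell k) (u w : T.verts s.1) (h : u ≠ w) :
    T.verts (T.edge s u w h).1 = {u.1, w.1} := by
  rw [edge, T.verts_face]

open Classical in
theorem edge_le {k : ℕ} (s : T.Cell k) (u w : T.verts s.1) (h : u ≠ w) :
    (T.edge s u w h).1 ≤ s.1 := by
  have hu : ({u.1, w.1} : Finset V) ⊆ T.verts s.1 := by
    simp [Finset.insert_subset_iff]
  exact T.face_le s.1 {u.1, w.1} hu (Finset.insert_nonempty _ _)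

/-- Translation of the vertices of a simplex by a deck transformation. -/
def smulVerts {k : ℕ} (g : Γ) (s : T.Cell k) : T.verts s.1 ≃ T.verts (g • s).1 where
  toFun v := ⟨g • v.1, (T.smul_mem_verts g s.1 v.1).2 v.2⟩
  invFun w := ⟨g⁻¹ • w.1, (T.smul_mem_verts g s.1 _).1 (by rw [smul_inv_smul]; exact w.2)⟩
  left_inv v := Subtype.ext (inv_smul_smul g v.1)
  right_inv w := Subtype.ext (smul_inv_smul g w.1)

open Classical in
theorem edge_smul {k : ℕ} (g : Γ) (s : T.Cell k) (u w : T.verts s.1) (h : u ≠ w) :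
    T.edge (g • s) (smulVerts g s u) (smulVerts g s w) ((smulVerts g s).injective.ne h) =
      g • T.edge s u w h := by
  refine Subtype.ext (T.eq_of_le_of_verts (T.edge_le _ _ _ _)
    (T.smul_mono g _ _ (T.edge_le s u w h)) ?_)
  rw [verts_edge]
  change _ = T.verts (g • (T.edge s u w h).1)
  rw [T.verts_smul, verts_edge, Finset.image_insert, Finset.image_singleton]
  rfl

theorem sqDist_smul (L : T.Face 1 → ℝ) (g : Γ) (s : T.Cell 4) (u w : T.verts s.1) :
    T.sqDist L (g • s) (smulVerts g s u) (smulVerts g s w) = T.sqDist L s u w := by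
  by_cases h : u = w
  · subst h; rw [sqDist, sqDist, dif_pos rfl, dif_pos rfl]
  · rw [sqDist, sqDist, dif_neg h, dif_neg ((smulVerts g s).injective.ne h), edge_smul, proj_smul]

open Classical in
theorem _root_.EuclComplex.dihedralAngle_equiv {ι ι' : Type*} [Fintype ι] [Fintype ι']
    (e : ι ≃ ι') (D : ι' → ι' → ℝ) (j k : ι) :
    dihedralAngle (fun a b => D (e a) (e b)) j k = dihedralAngle D (e j) (e k) := by
  have h : cayleyMenger (fun a b => D (e a) (e b)) =
      (cayleyMenger D).submatrix (Equiv.optionCongr e) (Equiv.optionCongr e) := by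
    ext (_ | a) (_ | b) <;> rfl
  have h2 : ∀ a b, (cayleyMenger (fun a b => D (e a) (e b)))⁻¹ (some a) (some b) =
      (cayleyMenger D)⁻¹ (some (e a)) (some (e b)) := fun a b => by
    rw [h, Matrix.inv_submatrix_equiv]
    rfl
  rw [dihedralAngle, dihedralAngle, h2, h2, h2]

theorem angleAt_smul (L : T.Face 1 → ℝ) (g : Γ) (s : T.Cell 4) (i : T.Cell 2) :
    T.angleAt L (g • s) (g • i) = T.angleAt L s i := by
  classical
  rw [angleAt, angleAt]
  congr 1
  symm
  refine Finset.sum_equiv (Equiv.prodCongr (smulVerts g s) (smulVerts g s)) ?_ ?_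
  · rintro ⟨a, b⟩
    have h : ∀ a : T.verts s.1, (smulVerts g s a).1 ∉ T.verts (g • i).1 ↔ a.1 ∉ T.verts i.1 :=
      fun a => not_congr (T.smul_mem_verts g i.1 a.1)
    simp only [Finset.mem_offDiag, Finset.mem_filter, Finset.mem_univ, true_and,
      Equiv.prodCongr_apply, Prod.map_apply, h, ne_eq, (smulVerts g s).injective.eq_iff]
  · rintro ⟨a, b⟩ _
    simp only [Equiv.prodCongr_apply, Prod.map_apply]
    rw [← dihedralAngle_equiv (smulVerts g s)]
    simp only [sqDist_smul]

namespace Placement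

variable (R : T.Placement)

theorem affineIndependent (hT : T.IsClosedManifold) (q : P) :
    AffineIndependent ℝ (fun v : T.verts q => R.pos v) := by
  obtain ⟨s, hs⟩ := hT.pure q
  exact (R.nondegenerate s).comp_embedding
    ⟨fun v : T.verts q => (⟨v.1, T.verts_mono _ _ hs v.2⟩ : T.verts s.1),
      fun a b h => Subtype.ext (congrArg (fun z : T.verts s.1 => z.1) h)⟩

theorem pos_smul_sub (g : Γ) (a b : V) :
    R.pos (g • a) - R.pos (g • b) = R.rot g (R.pos a - R.pos b) := by
  rw [R.equivariant, R.equivariant, ← vsub_eq_sub, ← vsub_eq_sub]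
  exact ((R.rep g).map_vsub _ _).symm

open Classical in
theorem sqLength_proj (a : T.Cell 1) {u w : V} (h : T.verts a.1 = {u, w}) :
    R.sqLength (T.proj a) = ‖R.pos u - R.pos w‖ ^ 2 := by
  have huw : u ≠ w := by
    rintro rfl
    have := a.2
    rw [h] at this
    simp at this
  obtain ⟨g, hg⟩ := exists_smul_eq_lift a
  rw [sqLength, ← hg, smul_cell_val, T.verts_smul, h, Finset.image_insert, Finset.image_singleton,
    Finset.sum_pair ((MulAction.injective g).ne huw),
    Finset.sum_pair ((MulAction.injective g).ne huw),
    Finset.sum_pair ((MulAction.injective g).ne huw)]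
  simp only [pos_smul_sub, LinearIsometryEquiv.norm_map]
  rw [norm_sub_rev (R.pos w)]
  simp

theorem sqDist_sqLength (s : T.Cell 4) (u w : T.verts s.1) :
    T.sqDist R.sqLength s u w = ‖R.pos u - R.pos w‖ ^ 2 := by
  classical
  by_cases h : u = w
  · subst h; simp [sqDist]
  · rw [sqDist, dif_neg h, R.sqLength_proj _ (T.verts_edge s u w h)]

theorem simplexSign_eq (o : T.Orientation) (s : T.Cell 4) :
    R.simplexSign o s = Real.sign (volSimplex fun i => R.pos (o.ord s i)) := by
  rw [simplexSign, volSimplex, vol]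
  congr 2
  ext i j
  fin_cases i <;> rfl

theorem det_rot (g : Γ) : LinearMap.det ((R.rot g).toLinearEquiv : E4 →ₗ[ℝ] E4) = 1 := R.rep_det g

theorem ord_equiv (o : T.Orientation) (s : T.Cell 4) :
    ∃ e : Fin 5 ≃ T.verts s.1, ∀ i, (e i).1 = o.ord s i := by
  let f : Fin 5 → T.verts s.1 := fun i => ⟨o.ord s i, o.mem_verts s i⟩
  have hf : Function.Bijective f := by
    rw [Fintype.bijective_iff_injective_and_card]
    refine ⟨fun i j h => o.injective s (congrArg (fun z : T.verts s.1 => z.1) h), ?_⟩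
    rw [Fintype.card_fin, Fintype.card_coe, s.2]
  exact ⟨Equiv.ofBijective f hf, fun i => rfl⟩

theorem simplexSign_smul (o : T.Orientation) (g : Γ) (s : T.Cell 4) :
    R.simplexSign o (g • s) = R.simplexSign o s := by
  obtain ⟨e, he⟩ := ord_equiv o s
  obtain ⟨e', he'⟩ := ord_equiv o (g • s)
  let τ : Equiv.Perm (Fin 5) := (e.trans (smulVerts g s)).trans e'.symm
  have hτ : ∀ i, o.ord (g • s) (τ i) = g • o.ord s i := fun i => by
    rw [← he', ← he]
    simp [τ, smulVerts]
  have hsign := o.invariant g s τ hτ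
  rw [simplexSign_eq, simplexSign_eq]
  have h1 := volSimplex_comp (fun i => R.pos (o.ord (g • s) i)) τ
  rw [hsign] at h1
  simp only [Units.val_one, Int.cast_one, one_mul] at h1
  rw [← h1]
  congr 1
  have h2 := vol_map ((R.rot g).toLinearEquiv : E4 →ₗ[ℝ] E4)
  simp only [det_rot, one_mul, LinearEquiv.coe_coe, LinearIsometryEquiv.coe_toLinearEquiv] at h2
  simp only [volSimplex, Function.comp_apply, hτ, pos_smul_sub]
  exact h2 _ _ _ _

open Classical in
theorem exists_equiv_of_verts {s : T.Cell 4} {u v x j k : V}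
    (h : T.verts s.1 = {k, j, u, v, x}) :
    ∃ e : Fin 5 ≃ T.verts s.1, ∀ i, (e i).1 = ![u, v, x, j, k] i := by
  have hm : ∀ i, ![u, v, x, j, k] i ∈ T.verts s.1 := fun i => by
    rw [h]; fin_cases i <;> simp
  let f : Fin 5 → T.verts s.1 := fun i => ⟨_, hm i⟩
  have hf : Function.Bijective f := by
    rw [Fintype.bijective_iff_surjective_and_card]
    refine ⟨?_, by rw [Fintype.card_fin, Fintype.card_coe, s.2]⟩
    rintro ⟨z, hz⟩
    have hz' := hz
    rw [h] at hz'
    simp only [Finset.mem_insert, Finset.mem_singleton] at hz'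
    rcases hz' with rfl | rfl | rfl | rfl | rfl
    · exact ⟨4, rfl⟩
    · exact ⟨3, rfl⟩
    · exact ⟨0, rfl⟩
    · exact ⟨1, rfl⟩
    · exact ⟨2, rfl⟩
  exact ⟨Equiv.ofBijective f hf, fun i => rfl⟩

/-- The sign of the ordering `u, v, x, j, k` of the vertices of a 4-simplex `s`, where `u, v, x` is
an ordering of the vertices of a triangle `i`, `j` is the remaining vertex of a tetrahedron `f`
containing `i`, and `k` is the remaining vertex of `s`. -/
def flagSign (o : T.Orientation) (u v x : V) (i : P) (f : T.Cell 3) (s : T.Cell 4) : ℝ :=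
  R.simplexSign o s *
    Real.sign (volSimplex fun m => R.pos (![u, v, x, T.apex f.1 i, T.apex s.1 f.1] m))

open Classical in
theorem verts_of_flag {u v x : V} {i : T.Cell 2} (hi : T.verts i.1 = {u, v, x}) {f : T.Cell 3}
    (hf : i.1 ≤ f.1) {s : T.Cell 4} (hs : f.1 ≤ s.1) :
    T.verts f.1 = {T.apex f.1 i.1, u, v, x} ∧
      T.verts s.1 = {T.apex s.1 f.1, T.apex f.1 i.1, u, v, x} := by
  have h1 := (T.verts_eq_insert_apex hf (by rw [f.2, i.2])).2
  have h2 := (T.verts_eq_insert_apex hs (by rw [s.2, f.2])).2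
  rw [hi] at h1
  exact ⟨h1, by rw [h2, ← h1]⟩

/-- The sign of a 4-simplex times the sign of its volume in another ordering is the sign of the
permutation that relates this ordering to the positive one. -/
theorem simplexSign_mul_sign (o : T.Orientation) (s : T.Cell 4) (y : Fin 5 → V)
    (e : Fin 5 ≃ T.verts s.1) (he : ∀ i, (e i).1 = y i) :
    ∃ α : Equiv.Perm (Fin 5), (∀ i, o.ord s i = y (α i)) ∧
      R.simplexSign o s * Real.sign (volSimplex fun m => R.pos (y m)) =
        (Equiv.Perm.sign α : ℝ) := by
  obtain ⟨e', he'⟩ := ord_equiv o s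
  have hα : ∀ i, o.ord s i = y ((e'.trans e.symm) i) := fun i => by
    rw [← he', ← he]; simp
  refine ⟨e'.trans e.symm, hα, ?_⟩
  have hne : volSimplex (fun m => R.pos (y m)) ≠ 0 := by
    refine volSimplex_ne_zero ?_
    have := (R.nondegenerate s).comp_embedding e.toEmbedding
    convert this using 1
    funext m
    simp [he]
  have h1 := volSimplex_comp (fun m => R.pos (y m)) (e'.trans e.symm)
  rw [simplexSign_eq]
  have h2 : (fun i => R.pos (o.ord s i)) = (fun m => R.pos (y m)) ∘ (e'.trans e.symm) := by
    funext i
    rw [Function.comp_apply, hα]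
  rw [h2, h1, sign_permSign_mul, mul_assoc, sign_mul_sign_self hne, mul_one]

open Classical in
/-- The two 4-simplices at a tetrahedron induce opposite orientations of it. -/
theorem flagSign_coherent (o : T.Orientation) {u v x : V} {i : T.Cell 2}
    (hi : T.verts i.1 = {u, v, x}) {f : T.Cell 3} (hf : i.1 ≤ f.1) {s t : T.Cell 4} (hst : s ≠ t)
    (hs : f.1 < s.1) (ht : f.1 < t.1) :
    R.flagSign o u v x i.1 f s = -R.flagSign o u v x i.1 f t ∧
      R.flagSign o u v x i.1 f t ≠ 0 := by
  obtain ⟨e, he⟩ := exists_equiv_of_verts (verts_of_flag hi hf hs.le).2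
  obtain ⟨e', he'⟩ := exists_equiv_of_verts (verts_of_flag hi hf ht.le).2
  obtain ⟨α, hα, h1⟩ := R.simplexSign_mul_sign o s _ e he
  obtain ⟨β, hβ, h2⟩ := R.simplexSign_mul_sign o t _ e' he'
  rw [flagSign, flagSign, h1, h2]
  have hc := o.coherent s t f hst hs ht (α.trans β.symm) (by
    intro m hm
    rw [hβ, hα]
    simp only [Equiv.trans_apply, Equiv.apply_symm_apply]
    rw [hα] at hm
    have h4 : α m ≠ 4 := by
      intro h4
      rw [h4] at hm
      exact (T.verts_eq_insert_apex hs.le (by rw [s.2, f.2])).1 hm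
    exact vec_five_eq _ _ _ _ _ _ h4)
  rw [Equiv.Perm.sign_trans, Equiv.Perm.sign_symm] at hc
  exact units_cast_eq_neg hc

end Placement

end Triangulation

/-! ### The differential of the deficit angles -/

/-- The area of the parallelogram on two vectors. -/
def parallelogramArea (l₁ l₂ : E4) : ℝ :=
  √(inner ℝ l₁ l₁ * inner ℝ l₂ l₂ - inner ℝ l₁ l₂ ^ 2)

namespace Triangulation

variable {T : Triangulation Γ V P}

theorem volSimplex_vec (r : V → E4) (u v x j k : V) :
    (volSimplex fun m => r (![u, v, x, j, k] m)) =
      vol (r v - r u) (r x - r u) (r j - r u) (r k - r u) :=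
  rfl

/-- The squared edge lengths of a 4-simplex as a linear function of all the squared edge lengths. -/
def sqDistLinear (T : Triangulation Γ V P) (s : T.Cell 4) :
    (T.Face 1 → ℝ) →L[ℝ] (T.verts s.1 → T.verts s.1 → ℝ) :=
  LinearMap.toContinuousLinearMap
    { toFun := fun L => T.sqDist L s
      map_add' := fun L M => by
        funext a b
        by_cases h : a = b <;> simp [sqDist, h]
      map_smul' := fun r L => by
        funext a b
        by_cases h : a = b <;> simp [sqDist, h] }

theorem sqDistLinear_apply (s : T.Cell 4) (L : T.Face 1 → ℝ) :
    T.sqDistLinear s L = T.sqDist L s :=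
  rfl

namespace Placement

variable (R : T.Placement) (o : T.Orientation)

open Classical in
theorem vol_ne_zero_of_verts {s : T.Cell 4} {u v x j k : V} (h : T.verts s.1 = {k, j, u, v, x}) :
    vol (R.pos v - R.pos u) (R.pos x - R.pos u) (R.pos j - R.pos u) (R.pos k - R.pos u) ≠ 0 := by
  obtain ⟨e, he⟩ := exists_equiv_of_verts h
  have := (R.nondegenerate s).comp_embedding e.toEmbedding
  have h2 : AffineIndependent ℝ (fun m => R.pos (![u, v, x, j, k] m)) := by
    convert this using 1
    funext m
    simp [he]
  have h3 := volSimplex_ne_zero h2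
  rwa [volSimplex_vec] at h3

open Classical in
theorem exists_vol_ne_zero (hT : T.IsClosedManifold) {i : T.Cell 2} {u v x : V}
    (hi : T.verts i.1 = {u, v, x}) : ∃ j k : V,
      vol (R.pos v - R.pos u) (R.pos x - R.pos u) (R.pos j - R.pos u) (R.pos k - R.pos u) ≠ 0 := by
  obtain ⟨s, hs⟩ := hT.pure i.1
  obtain ⟨j, k, -, -, -, -, -, hv, -⟩ := T.exists_between hs i.2 s.2
  exact ⟨j, k, R.vol_ne_zero_of_verts (by rw [hv, hi, Finset.insert_comm])⟩

open Classical in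
/-- The dihedral angle at a triangle is differentiable; its signed derivative is the sum, over the
two tetrahedra between the triangle and the 4-simplex, of their angular velocities. -/
theorem exists_hasFDerivAt_angleAt (hT : T.IsClosedManifold) {s : T.Cell 4} {i : T.Cell 2}
    (his : i.1 < s.1) {u v x : V} (hi : T.verts i.1 = {u, v, x}) :
    ∃ F : (T.Face 1 → ℝ) →L[ℝ] ℝ, HasFDerivAt (fun L => T.angleAt L s i) F R.sqLength ∧
      ∀ (A : E4 →ₗ[ℝ] E4) (d : T.Face 1 → ℝ),
        (∀ a b : T.verts s.1, inner ℝ (R.pos a - R.pos b) (A (R.pos a - R.pos b)) =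
          T.sqDist d s a b / 2) →
        R.simplexSign o s * F d =
          -(1 / parallelogramArea (R.pos v - R.pos u) (R.pos x - R.pos u) *
            ∑ f ∈ hT.between 3 i.1 s.1, R.flagSign o u v x i.1 f s *
              turnRate (R.pos v - R.pos u) (R.pos x - R.pos u)
                (R.pos (T.apex f.1 i.1) - R.pos u) A) := by
  obtain ⟨j, k, f, g, hjk, hj, hk, hv, hfg, af, ag, asf, asg, hb⟩ :=
    hT.exists_between_eq his.le i.2 s.2
  have hsub := T.verts_mono _ _ his.le
  have hui : u ∈ T.verts i.1 := by rw [hi]; simp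
  have hvi : v ∈ T.verts i.1 := by rw [hi]; simp
  have hxi : x ∈ T.verts i.1 := by rw [hi]; simp
  let U : T.verts s.1 := ⟨u, hsub hui⟩
  let Y : T.verts s.1 := ⟨v, hsub hvi⟩
  let X : T.verts s.1 := ⟨x, hsub hxi⟩
  let J : T.verts s.1 := ⟨j, by rw [hv]; simp⟩
  let K : T.verts s.1 := ⟨k, by rw [hv]; simp⟩
  have hne : ∀ {a b : T.verts s.1}, a.1 ∈ T.verts i.1 → b.1 ∉ T.verts i.1 → a ≠ b :=
    fun ha hb e => hb (e ▸ ha)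
  have hJK : J ≠ K := fun e => hjk (congrArg (fun z : T.verts s.1 => z.1) e)
  have hfil : (Finset.univ.filter fun v : T.verts s.1 => v.1 ∉ T.verts i.1) = {J, K} := by
    ext a
    have ha := a.2
    replace ha := (Finset.ext_iff.1 hv _).1 ha
    simp only [Finset.mem_filter, Finset.mem_univ, true_and, Finset.mem_insert,
      Finset.mem_singleton, Subtype.ext_iff, J, K] at ha ⊢
    constructor
    · intro h
      rcases ha with h' | h' | h'
      · exact Or.inl h'
      · exact Or.inr h'
      · exact absurd h' h
    · rintro (h | h) <;> rw [h] <;> assumption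
  have hVne : vol (R.pos v - R.pos u) (R.pos x - R.pos u) (R.pos j - R.pos u)
      (R.pos k - R.pos u) ≠ 0 := R.vol_ne_zero_of_verts (by rw [hv, hi, Finset.insert_comm])
  have hcard : Fintype.card (T.verts s.1) = 5 := by rw [Fintype.card_coe, s.2]
  have hD : T.sqDistLinear s R.sqLength =
      fun a b : T.verts s.1 => ‖R.pos a - R.pos b‖ ^ 2 := by
    funext a b
    exact R.sqDist_sqLength s a b
  have h1 := hne (a := U) (b := J) hui hj
  have h2 := hne (a := U) (b := K) hui hk
  have h3 := hne (a := Y) (b := J) hvi hj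
  have h4 := hne (a := Y) (b := K) hvi hk
  have h5 := hne (a := X) (b := J) hxi hj
  have h6 := hne (a := X) (b := K) hxi hk
  -- `angleAt` averages the dihedral angle over the two orders of the remaining vertices
  obtain ⟨F₁, hF₁, hd₁⟩ := exists_hasFDerivAt_dihedralAngle (R.nondegenerate s) hcard
    (u := U) (v := Y) (x := X) (j := J) (k := K) hJK h1 h2 h3 h4 h5 h6 hVne
  obtain ⟨F₂, hF₂, hd₂⟩ := exists_hasFDerivAt_dihedralAngle (R.nondegenerate s) hcard
    (u := U) (v := Y) (x := X) (j := K) (k := J) hJK.symm h2 h1 h4 h3 h6 h5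
    (by rw [vol_swap_last]; exact neg_ne_zero.2 hVne)
  rw [← hD] at hF₁ hF₂
  have G₁ := HasFDerivAt.comp R.sqLength hF₁ (T.sqDistLinear s).hasFDerivAt
  have G₂ := HasFDerivAt.comp R.sqLength hF₂ (T.sqDistLinear s).hasFDerivAt
  refine ⟨_, ((G₁.add G₂).const_mul (1 / 2)).congr_of_eventuallyEq
    (Filter.Eventually.of_forall fun L => ?_), fun A d hd => ?_⟩
  · have hoff : ({J, K} : Finset (T.verts s.1)).offDiag = {(J, K), (K, J)} := by
      ext ⟨a, b⟩
      simp only [Finset.mem_offDiag, Finset.mem_insert, Finset.mem_singleton, Prod.mk.injEq]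
      constructor
      · rintro ⟨rfl | rfl, rfl | rfl, h⟩
        · exact absurd rfl h
        · exact Or.inl ⟨rfl, rfl⟩
        · exact Or.inr ⟨rfl, rfl⟩
        · exact absurd rfl h
      · rintro (⟨rfl, rfl⟩ | ⟨rfl, rfl⟩)
        · exact ⟨Or.inl rfl, Or.inr rfl, hJK⟩
        · exact ⟨Or.inr rfl, Or.inl rfl, hJK.symm⟩
    simp only [angleAt, Pi.add_apply, Function.comp_apply, sqDistLinear_apply]
    rw [hfil, hoff, Finset.sum_pair (by simp [hJK])]
    ring
  · have e₁ := hd₁ A (T.sqDist d s) hd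
    have e₂ := hd₂ A (T.sqDist d s) hd
    simp only [smul_apply, add_apply, ContinuousLinearMap.comp_apply, sqDistLinear_apply, e₁, e₂]
    rw [hb, Finset.sum_pair hfg, flagSign, flagSign, af, ag, asf, asg]
    simp only [U, Y, X, J, K, smul_eq_mul]
    rw [volSimplex_vec, volSimplex_vec, vol_swap_last _ _ (R.pos j - R.pos u) (R.pos k - R.pos u),
      Real.sign_neg, ← parallelogramArea]
    ring

theorem deficit_proj (hT : T.IsClosedManifold) (L : T.Face 1 → ℝ) (i : T.Cell 2) :
    R.deficit o L (T.proj i) =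
      -∑ s ∈ hT.above 4 i.1, R.simplexSign o s * T.angleAt L s i := by
  obtain ⟨g, hg⟩ := exists_smul_eq_lift i
  have hmem : ∀ (i : T.Cell 2) (s : T.Cell 4),
      i.1 < s.1 ↔ s ∈ ((hT.above 4 i.1 : Finset (T.Cell 4)) : Set (T.Cell 4)) := fun i s => by
    rw [Finset.mem_coe, hT.mem_above]
  rw [deficit]
  congr 1
  simp only [hmem]
  rw [finsum_mem_coe_finset, ← hg]
  symm
  refine Finset.sum_bij' (fun s _ => g • s) (fun s _ => g⁻¹ • s) ?_ ?_ ?_ ?_ ?_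
  · intro s hs
    rw [hT.mem_above] at hs ⊢
    exact (T.smul_lt_smul_iff g _ _).2 hs
  · intro s hs
    rw [hT.mem_above] at hs ⊢
    rw [← T.smul_lt_smul_iff g]
    simpa [smul_cell_val] using hs
  · intro s _
    exact inv_smul_smul g s
  · intro s _
    exact smul_inv_smul g s
  · intro s _
    rw [angleAt_smul, simplexSign_smul]

open Classical in
theorem exists_verts_eq_triple (i : T.Cell 2) : ∃ u v x : V, T.verts i.1 = {u, v, x} := by
  obtain ⟨u, v, x, _, _, _, h⟩ := Finset.card_eq_three.1 i.2
  exact ⟨u, v, x, h⟩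

open Classical in
/-- The differential of a deficit angle, as a sum over the flags of a tetrahedron and a 4-simplex
around the triangle. -/
theorem exists_hasFDerivAt_deficit (hT : T.IsClosedManifold) (i : T.Cell 2) {u v x : V}
    (hi : T.verts i.1 = {u, v, x}) :
    ∃ F : (T.Face 1 → ℝ) →L[ℝ] ℝ,
      HasFDerivAt (fun L => R.deficit o L (T.proj i)) F R.sqLength ∧
      ∀ (A : T.Cell 4 → E4 →ₗ[ℝ] E4) (d : T.Face 1 → ℝ),
        (∀ s : T.Cell 4, i.1 < s.1 → ∀ a b : T.verts s.1,
          inner ℝ (R.pos a - R.pos b) (A s (R.pos a - R.pos b)) = T.sqDist d s a b / 2) →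
        F d = 1 / parallelogramArea (R.pos v - R.pos u) (R.pos x - R.pos u) *
          ∑ f ∈ hT.above 3 i.1, ∑ s ∈ hT.above 4 f.1, R.flagSign o u v x i.1 f s *
            turnRate (R.pos v - R.pos u) (R.pos x - R.pos u)
              (R.pos (T.apex f.1 i.1) - R.pos u) (A s) := by
  have h : ∀ s : T.Cell 4, ∃ F : (T.Face 1 → ℝ) →L[ℝ] ℝ, s ∈ hT.above 4 i.1 →
      HasFDerivAt (fun L => T.angleAt L s i) F R.sqLength ∧
      ∀ (A : E4 →ₗ[ℝ] E4) (d : T.Face 1 → ℝ),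
        (∀ a b : T.verts s.1, inner ℝ (R.pos a - R.pos b) (A (R.pos a - R.pos b)) =
          T.sqDist d s a b / 2) →
        R.simplexSign o s * F d =
          -(1 / parallelogramArea (R.pos v - R.pos u) (R.pos x - R.pos u) *
            ∑ f ∈ hT.between 3 i.1 s.1, R.flagSign o u v x i.1 f s *
              turnRate (R.pos v - R.pos u) (R.pos x - R.pos u)
                (R.pos (T.apex f.1 i.1) - R.pos u) A) := fun s => by
    by_cases hs : s ∈ hT.above 4 i.1
    · obtain ⟨F, hF⟩ := R.exists_hasFDerivAt_angleAt o hT (hT.mem_above.1 hs) hi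
      exact ⟨F, fun _ => hF⟩
    · exact ⟨0, fun h => absurd h hs⟩
  choose F hF using h
  refine ⟨-∑ s ∈ hT.above 4 i.1, R.simplexSign o s • F s, ?_, fun A d hd => ?_⟩
  · refine HasFDerivAt.congr_of_eventuallyEq ?_
      (Filter.Eventually.of_forall fun L => R.deficit_proj o hT L i)
    exact (HasFDerivAt.fun_sum fun s hs => ((hF s hs).1.const_mul (R.simplexSign o s))).fun_neg
  · rw [hT.sum_above_above]
    simp only [neg_apply, sum_apply, smul_apply, smul_eq_mul]
    rw [Finset.sum_congr rfl fun s hs => (hF s hs).2 (A s) d (hd s (hT.mem_above.1 hs)),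
      Finset.sum_neg_distrib, neg_neg, Finset.mul_sum]

theorem differentiableAt_deficit (hT : T.IsClosedManifold) :
    DifferentiableAt ℝ (R.deficit o) R.sqLength := by
  classical
  refine differentiableAt_pi.2 fun i => ?_
  obtain ⟨u, v, x, h⟩ := exists_verts_eq_triple (T.lift i)
  obtain ⟨F, hF, -⟩ := R.exists_hasFDerivAt_deficit o hT (T.lift i) h
  rw [proj_lift] at hF
  exact hF.differentiableAt

open Classical in
theorem lengthToDeficit_apply (hT : T.IsClosedManifold) (i : T.Cell 2) {u v x : V}
    (hi : T.verts i.1 = {u, v, x}) (A : T.Cell 4 → E4 →ₗ[ℝ] E4) (d : T.Face 1 → ℝ)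
    (hd : ∀ s : T.Cell 4, i.1 < s.1 → ∀ a b : T.verts s.1,
      inner ℝ (R.pos a - R.pos b) (A s (R.pos a - R.pos b)) = T.sqDist d s a b / 2) :
    R.lengthToDeficit o d (T.proj i) =
      1 / parallelogramArea (R.pos v - R.pos u) (R.pos x - R.pos u) *
        ∑ f ∈ hT.above 3 i.1, ∑ s ∈ hT.above 4 f.1, R.flagSign o u v x i.1 f s *
          turnRate (R.pos v - R.pos u) (R.pos x - R.pos u)
            (R.pos (T.apex f.1 i.1) - R.pos u) (A s) := by
  obtain ⟨F, hF, h⟩ := R.exists_hasFDerivAt_deficit o hT i hi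
  rw [← h A d hd, lengthToDeficit]
  have h1 := (hasFDerivAt_pi'.1 (R.differentiableAt_deficit o hT).hasFDerivAt) (T.proj i)
  have h2 := h1.unique hF
  rw [← h2]
  rfl

end Placement

end Triangulation

/-! ### The differentials of the areas -/

theorem gram_pos_of_vol_ne_zero {a b c d : E4} (h : vol a b c d ≠ 0) :
    0 < inner ℝ a a * inner ℝ b b - inner ℝ a b ^ 2 := by
  have h0 : 0 ≤ inner ℝ a a * inner ℝ b b - inner ℝ a b ^ 2 := by
    have := real_inner_mul_inner_self_le a b
    rw [sq]; linarith
  rcases h0.lt_or_eq with h1 | h1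
  · exact h1
  exfalso
  have ha : inner ℝ a a ≠ 0 := fun h2 => h (by
    rw [inner_self_eq_zero.1 h2]; simp [vol_eq])
  have h2 : inner ℝ a a • b - inner ℝ a b • a = 0 := by
    rw [← inner_self_eq_zero (𝕜 := ℝ)]
    simp only [inner_sub_left, inner_sub_right, inner_smul_left, inner_smul_right,
      RCLike.conj_to_real, real_inner_comm a b]
    linear_combination (-inner ℝ a a) * h1
  have h3 : vol a (inner ℝ a a • b) c d = 0 := by
    rw [sub_eq_zero.1 h2]
    generalize inner ℝ a b = t
    simp only [vol_eq, PiLp.smul_apply, smul_eq_mul]; ring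
  have h4 : vol a (inner ℝ a a • b) c d = inner ℝ a a * vol a b c d := by
    generalize inner ℝ a a = t
    simp only [vol_eq, PiLp.smul_apply, smul_eq_mul]; ring
  rw [h4] at h3
  exact (mul_ne_zero ha h) h3

theorem parallelogramArea_pos {a b c d : E4} (h : vol a b c d ≠ 0) : 0 < parallelogramArea a b :=
  Real.sqrt_pos.2 (gram_pos_of_vol_ne_zero h)

/-- Heron's formula. -/
theorem heronArea_eq {ι : Type*} [Fintype ι] {u v x : ι} (huv : u ≠ v) (hux : u ≠ x) (hvx : v ≠ x)
    (huniv : ∀ c, c = u ∨ c = v ∨ c = x) (q : ι → E4) :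
    heronArea q = parallelogramArea (q v - q u) (q x - q u) / 2 := by
  classical
  have hun : (Finset.univ : Finset ι) = {u, v, x} := by
    ext c; simpa using huniv c
  have hs : ∀ g : ι → ℝ, ∑ c, g c = g u + g v + g x := fun g => by
    rw [hun, Finset.sum_insert (by simp [huv, hux]), Finset.sum_pair hvx, add_assoc]
  have h1 : ((∑ c, ∑ w, ‖q c - q w‖ ^ 2) / 2) ^ 2 - ∑ c, ∑ w, ‖q c - q w‖ ^ 4 =
      2 ^ 2 * (inner ℝ (q v - q u) (q v - q u) * inner ℝ (q x - q u) (q x - q u)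
        - inner ℝ (q v - q u) (q x - q u) ^ 2) := by
    have e1 : ‖q v - q x‖ ^ 2 = inner ℝ (q v - q u) (q v - q u) +
        inner ℝ (q x - q u) (q x - q u) - 2 * inner ℝ (q v - q u) (q x - q u) := by
      rw [← sub_sub_sub_cancel_right (q v) (q x) (q u), norm_sub_sq_real,
        real_inner_self_eq_norm_sq,
        real_inner_self_eq_norm_sq]
      ring
    have e2 : ‖q u - q v‖ ^ 2 = inner ℝ (q v - q u) (q v - q u) := by
      rw [norm_sub_rev, real_inner_self_eq_norm_sq]
    have e3 : ‖q u - q x‖ ^ 2 = inner ℝ (q x - q u) (q x - q u) := by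
      rw [norm_sub_rev, real_inner_self_eq_norm_sq]
    have p4 : ∀ y : E4, ‖y‖ ^ 4 = (‖y‖ ^ 2) ^ 2 := fun y => by ring
    simp only [hs, p4]
    rw [norm_sub_rev (q v) (q u), norm_sub_rev (q x) (q u), norm_sub_rev (q x) (q v), e1, e2, e3]
    simp only [sub_self, norm_zero]
    ring
  rw [heronArea, h1, Real.sqrt_mul (by norm_num), Real.sqrt_sq (by norm_num), parallelogramArea]
  ring

/-- The differential of the area of a parallelogram. -/
theorem hasFDerivAt_parallelogramArea {E : Type*} [NormedAddCommGroup E] [NormedSpace ℝ E]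
    {f g : E → E4} {f' g' : E →L[ℝ] E4} {z : E} (hf : HasFDerivAt f f' z) (hg : HasFDerivAt g g' z)
    (h : 0 < parallelogramArea (f z) (g z)) :
    ∃ F : E →L[ℝ] ℝ, HasFDerivAt (fun w => parallelogramArea (f w) (g w)) F z ∧
      ∀ w, F w = (inner ℝ (f z) (f' w) * inner ℝ (g z) (g z)
        + inner ℝ (f z) (f z) * inner ℝ (g z) (g' w)
        - inner ℝ (f z) (g z) * (inner ℝ (f' w) (g z) + inner ℝ (f z) (g' w))) /
          parallelogramArea (f z) (g z) := by
  have h1 := HasFDerivAt.fun_sub (HasFDerivAt.fun_mul (hf.inner ℝ hf) (hg.inner ℝ hg))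
    (HasFDerivAt.fun_mul (hf.inner ℝ hg) (hf.inner ℝ hg))
  have h2 := h1.sqrt (fun h0 => by
    rw [parallelogramArea, sq, h0, Real.sqrt_zero] at h
    exact lt_irrefl _ h)
  have h3 : ∀ w, √(inner ℝ (f w) (f w) * inner ℝ (g w) (g w) - inner ℝ (f w) (g w) *
      inner ℝ (f w) (g w)) = parallelogramArea (f w) (g w) := fun w => by
    rw [parallelogramArea, sq]
  simp only [h3] at h2
  refine ⟨_, h2, fun w => ?_⟩
  simp only [smul_apply, sub_apply, add_apply, ContinuousLinearMap.comp_apply, fderivInnerCLM_apply,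
    ContinuousLinearMap.prod_apply, smul_eq_mul]
  rw [real_inner_comm (f z) (f' w), real_inner_comm (g z) (g' w)]
  field_simp
  ring

namespace Triangulation

variable {T : Triangulation Γ V P}

open Classical in
theorem verts_side (i : T.Cell 2) (c : T.verts i.1) :
    T.verts (T.side i c).1 = (T.verts i.1).erase c.1 := by
  rw [side, T.verts_face]

theorem side_le (i : T.Cell 2) (c : T.verts i.1) : (T.side i c).1 ≤ i.1 := by
  classical
  have h : (T.verts i.1).erase c.1 ⊆ T.verts i.1 := Finset.erase_subset _ _
  have h2 : ((T.verts i.1).erase c.1).Nonempty := by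
    rw [← Finset.card_pos, Finset.card_erase_of_mem c.2, i.2]; norm_num
  exact T.face_le i.1 _ h h2

namespace Placement

variable (R : T.Placement)

open Classical in
theorem triple_ne {i : T.Cell 2} {u v x : V} (hi : T.verts i.1 = {u, v, x}) :
    u ≠ v ∧ u ≠ x ∧ v ≠ x := by
  have h := i.2
  rw [hi] at h
  refine ⟨?_, ?_, ?_⟩ <;> rintro rfl
  · simp at h
    have := Finset.card_le_two (a := u) (b := x)
    omega
  · rw [Finset.insert_comm] at h
    simp at h
    have := Finset.card_le_two (a := v) (b := u)
    omega
  · simp at h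
    have := Finset.card_le_two (a := u) (b := v)
    omega

open Classical in
theorem sideMidpoint_eq {i : T.Cell 2} {c : T.verts i.1} {a b : V} (hab : a ≠ b)
    (h : (T.verts i.1).erase c.1 = {a, b}) :
    R.sideMidpoint i c = (1 / 2 : ℝ) • (R.pos a + R.pos b) := by
  rw [sideMidpoint, h, Finset.sum_pair hab]

open Classical in
/-- The area of a triangle is a differentiable function of the deviations of its sides, and a
deviation `w` orthogonal to a side contributes the product of the squared length of the side and
the scalar product of `w` with the vector from the side to the opposite vertex, divided by minus
twice the area. -/
theorem exists_hasFDerivAt_deviatedArea (hT : T.IsClosedManifold) {i : T.Cell 2} {u v x : V}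
    (hi : T.verts i.1 = {u, v, x}) (U Y X : T.verts i.1) (hU : U.1 = u) (hY : Y.1 = v)
    (hX : X.1 = x) :
    ∃ F : (T.verts i.1 → E4) →L[ℝ] ℝ, HasFDerivAt (R.deviatedArea i) F 0 ∧
      ∀ w : T.verts i.1 → E4, inner ℝ (w U) (R.pos x - R.pos v) = 0 →
        inner ℝ (w Y) (R.pos x - R.pos u) = 0 → inner ℝ (w X) (R.pos v - R.pos u) = 0 →
        F w = -(‖R.pos x - R.pos v‖ ^ 2 * inner ℝ (R.pos u - R.pos v) (w U) +
          ‖R.pos x - R.pos u‖ ^ 2 * inner ℝ (R.pos v - R.pos u) (w Y) +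
          ‖R.pos v - R.pos u‖ ^ 2 * inner ℝ (R.pos x - R.pos u) (w X)) /
            parallelogramArea (R.pos v - R.pos u) (R.pos x - R.pos u) := by
  obtain ⟨huv, hux, hvx⟩ := triple_ne hi
  obtain ⟨j, k, hV⟩ := R.exists_vol_ne_zero hT hi
  have hQ := parallelogramArea_pos hV
  have mU : R.sideMidpoint i U = (1 / 2 : ℝ) • (R.pos v + R.pos x) :=
    R.sideMidpoint_eq hvx (by rw [hU, hi, Finset.erase_insert (by simp [huv, hux])])
  have mY : R.sideMidpoint i Y = (1 / 2 : ℝ) • (R.pos u + R.pos x) :=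
    R.sideMidpoint_eq hux (by
      rw [hY, hi, Finset.insert_comm, Finset.erase_insert (by simp [huv.symm, hvx])])
  have mX : R.sideMidpoint i X = (1 / 2 : ℝ) • (R.pos u + R.pos v) :=
    R.sideMidpoint_eq huv (by
      rw [hX, hi, show ({u, v, x} : Finset V) = {x, u, v} by ext; simp; tauto,
        Finset.erase_insert (by simp [hux.symm, hvx.symm])])
  have hne : ∀ {a b : T.verts i.1}, a.1 ≠ b.1 → a ≠ b := fun h e => h (congrArg Subtype.val e)
  have hheron : ∀ q : T.verts i.1 → E4,
      heronArea q = parallelogramArea (q Y - q U) (q X - q U) / 2 :=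
    heronArea_eq (hne (by rwa [hU, hY])) (hne (by rwa [hU, hX])) (hne (by rwa [hY, hX]))
      fun c => by
        have := (Finset.ext_iff.1 hi _).1 c.2
        simp only [Finset.mem_insert, Finset.mem_singleton] at this
        simpa only [Subtype.ext_iff, hU, hY, hX] using this
  -- up to a translation, the triangle of the midpoints is the given one scaled by `-1/2`
  let pr : T.verts i.1 → ((T.verts i.1 → E4) →L[ℝ] E4) := fun c => ContinuousLinearMap.proj c
  have hf : ∀ c, HasFDerivAt (fun w : T.verts i.1 → E4 =>
      (R.sideMidpoint i c + w c) - (R.sideMidpoint i U + w U)) (pr c - pr U) 0 := fun c =>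
    (((pr c).hasFDerivAt).const_add _).fun_sub (((pr U).hasFDerivAt).const_add _)
  have fY : (R.sideMidpoint i Y + (0 : T.verts i.1 → E4) Y) -
      (R.sideMidpoint i U + (0 : T.verts i.1 → E4) U) = (-(1 / 2) : ℝ) • (R.pos v - R.pos u) := by
    rw [mU, mY, Pi.zero_apply, Pi.zero_apply]
    module
  have fX : (R.sideMidpoint i X + (0 : T.verts i.1 → E4) X) -
      (R.sideMidpoint i U + (0 : T.verts i.1 → E4) U) = (-(1 / 2) : ℝ) • (R.pos x - R.pos u) := by
    rw [mU, mX, Pi.zero_apply, Pi.zero_apply]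
    module
  have hscale : ∀ a b : E4, parallelogramArea ((-(1 / 2) : ℝ) • a) ((-(1 / 2) : ℝ) • b) =
      parallelogramArea a b / 4 := fun a b => by
    simp only [parallelogramArea, inner_smul_left, inner_smul_right, RCLike.conj_to_real]
    rw [show -(1 / 2) * (-(1 / 2) * inner ℝ a a) * (-(1 / 2) * (-(1 / 2) * inner ℝ b b)) -
      (-(1 / 2) * (-(1 / 2) * inner ℝ a b)) ^ 2 =
      (inner ℝ a a * inner ℝ b b - inner ℝ a b ^ 2) / 4 ^ 2 by ring,
      Real.sqrt_div' _ (by norm_num), Real.sqrt_sq (by norm_num)]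
  obtain ⟨F, hF, hFw⟩ := hasFDerivAt_parallelogramArea (hf Y) (hf X) (by
    rw [fY, fX, hscale]; positivity)
  simp only [fY, fX, hscale] at hFw
  refine ⟨(2 : ℝ) • F, (hF.const_mul 2).congr_of_eventuallyEq
    (Filter.Eventually.of_forall fun w => ?_), fun w wU wY wX => ?_⟩
  · simp only [deviatedArea, hheron]
    ring
  · simp only [smul_apply, hFw, sub_apply, smul_eq_mul]
    simp only [pr, ContinuousLinearMap.proj_apply]
    have n1 : ‖R.pos x - R.pos v‖ ^ 2 = inner ℝ (R.pos v - R.pos u) (R.pos v - R.pos u) +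
        inner ℝ (R.pos x - R.pos u) (R.pos x - R.pos u) -
        2 * inner ℝ (R.pos v - R.pos u) (R.pos x - R.pos u) := by
      rw [← sub_sub_sub_cancel_right (R.pos x) (R.pos v) (R.pos u), norm_sub_sq_real,
        real_inner_self_eq_norm_sq, real_inner_self_eq_norm_sq, real_inner_comm]
      ring
    rw [n1, ← real_inner_self_eq_norm_sq, ← real_inner_self_eq_norm_sq,
      ← neg_sub (R.pos v) (R.pos u), inner_neg_left]
    rw [← sub_sub_sub_cancel_right (R.pos x) (R.pos v) (R.pos u), inner_sub_right] at wU
    rw [real_inner_comm] at wX wY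
    have wU1 : inner ℝ (R.pos x - R.pos u) (w U) = inner ℝ (R.pos v - R.pos u) (w U) := by
      rw [real_inner_comm, real_inner_comm (w U)]
      linarith
    generalize R.pos v - R.pos u = A at *
    generalize R.pos x - R.pos u = B at *
    simp only [inner_smul_left, inner_smul_right, RCLike.conj_to_real, inner_sub_right,
      inner_sub_left, real_inner_comm B (w Y), real_inner_comm B (w U)]
    rw [wX, wY, wU1]
    field_simp
    ring

theorem differentiableAt_deviatedArea (hT : T.IsClosedManifold) (i : T.Cell 2) :
    DifferentiableAt ℝ (R.deviatedArea i) 0 := by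
  classical
  obtain ⟨u, v, x, h⟩ := exists_verts_eq_triple i
  obtain ⟨F, hF, -⟩ := R.exists_hasFDerivAt_deviatedArea hT h ⟨u, by rw [h]; simp⟩
    ⟨v, by rw [h]; simp⟩ ⟨x, by rw [h]; simp⟩ rfl rfl rfl
  exact hF.differentiableAt

end Placement

end Triangulation

/-! ### Vertex and edge deviations -/

/-- The bilinear form with a given matrix. -/
def tensorForm (M : Matrix (Fin 4) (Fin 4) ℝ) (x y : E4) : ℝ := ∑ β, y β * ∑ α, x α * M α β

theorem tensorForm_sub_left (M : Matrix (Fin 4) (Fin 4) ℝ) (x z y : E4) :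
    tensorForm M (x - z) y = tensorForm M x y - tensorForm M z y := by
  simp only [tensorForm, PiLp.sub_apply, sub_mul, mul_sub, Finset.sum_sub_distrib]

theorem tensorForm_sub_right (M : Matrix (Fin 4) (Fin 4) ℝ) (x y z : E4) :
    tensorForm M x (y - z) = tensorForm M x y - tensorForm M x z := by
  simp only [tensorForm, PiLp.sub_apply, sub_mul, Finset.sum_sub_distrib]

theorem tensorForm_neg_left (M : Matrix (Fin 4) (Fin 4) ℝ) (x y : E4) :
    tensorForm M (-x) y = -tensorForm M x y := by
  rw [← zero_sub, tensorForm_sub_left]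
  simp [tensorForm]

theorem tensorForm_neg_right (M : Matrix (Fin 4) (Fin 4) ℝ) (x y : E4) :
    tensorForm M x (-y) = -tensorForm M x y := by
  rw [← zero_sub, tensorForm_sub_right]
  simp [tensorForm]

theorem tensorForm_swap {M : Matrix (Fin 4) (Fin 4) ℝ} (h : M.transpose = -M) (x y : E4) :
    tensorForm M x y = -tensorForm M y x := by
  have hM : ∀ α β, M α β = -M β α := fun α β => by
    have := congrFun (congrFun h β) α
    simpa using this
  simp only [tensorForm, Finset.mul_sum]
  rw [Finset.sum_comm, ← Finset.sum_neg_distrib]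
  refine Finset.sum_congr rfl fun α _ => ?_
  rw [← Finset.sum_neg_distrib]
  refine Finset.sum_congr rfl fun β _ => ?_
  rw [hM α β]
  ring

theorem tensorForm_add (M N : Matrix (Fin 4) (Fin 4) ℝ) (x y : E4) :
    tensorForm (M + N) x y = tensorForm M x y + tensorForm N x y := by
  simp only [tensorForm, Matrix.add_apply, mul_add, Finset.sum_add_distrib]

theorem leviCivita_eq_vol (a b c d : Fin 4) : leviCivita a b c d =
    vol (EuclideanSpace.single a 1) (EuclideanSpace.single b 1) (EuclideanSpace.single c 1)
      (EuclideanSpace.single d 1) := by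
  rw [leviCivita, vol]
  congr 1
  ext i j
  fin_cases i <;> simp [Pi.single_apply, eq_comm]

theorem vol_eq_sum_first (a b c d : E4) :
    vol a b c d = ∑ i, a i * vol (EuclideanSpace.single i 1) b c d := by
  simp only [Fin.sum_univ_four, vol_eq]
  simp
  ring

theorem vol_eq_sum_second (a b c d : E4) :
    vol a b c d = ∑ i, b i * vol a (EuclideanSpace.single i 1) c d := by
  simp only [Fin.sum_univ_four, vol_eq]
  simp
  ring

theorem vol_eq_sum_third (a b c d : E4) :
    vol a b c d = ∑ i, c i * vol a b (EuclideanSpace.single i 1) d := by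
  simp only [Fin.sum_univ_four, vol_eq]
  simp
  ring

theorem vol_eq_sum_fourth (a b c d : E4) :
    vol a b c d = ∑ i, d i * vol a b c (EuclideanSpace.single i 1) := by
  simp only [Fin.sum_univ_four, vol_eq]
  simp
  ring

theorem tensorForm_leviCivita (r s x y : E4) :
    tensorForm (Matrix.of fun α β => ∑ γ, ∑ δ, leviCivita α β γ δ * r γ * s δ) x y =
      vol x y r s := by
  simp only [tensorForm, Matrix.of_apply, leviCivita_eq_vol]
  rw [vol_eq_sum_second]
  refine Finset.sum_congr rfl fun β _ => ?_
  rw [vol_eq_sum_first]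
  congr 1
  refine Finset.sum_congr rfl fun α _ => ?_
  rw [vol_eq_sum_third]
  congr 1
  refine Finset.sum_congr rfl fun γ _ => ?_
  rw [vol_eq_sum_fourth, Finset.mul_sum]
  exact Finset.sum_congr rfl fun δ _ => by ring

/-- A vector is zero if its exterior products with all edges of a frame vanish. -/
theorem eq_zero_of_forall_vol_eq_zero {a b c d s : E4} (hV : vol a b c d ≠ 0)
    (ha : ∀ x y, vol x y a s = 0) (hb : ∀ x y, vol x y b s = 0) : s = 0 := by
  have h1 : vol s b c d = 0 := by
    have := hb c d
    simp only [vol_eq] at this ⊢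
    linear_combination -this
  have h2 : vol a s c d = 0 := by
    have := ha c d
    simp only [vol_eq] at this ⊢
    linear_combination this
  have h3 : vol a b s d = 0 := by
    have := ha b d
    simp only [vol_eq] at this ⊢
    linear_combination -this
  have h4 : vol a b c s = 0 := by
    have := ha b c
    simp only [vol_eq] at this ⊢
    linear_combination this
  have h := vol_smul_eq a b c d s
  rw [h1, h2, h3, h4] at h
  simpa [hV] using h

namespace Triangulation.Placement

variable {T : Triangulation Γ V P} (R : T.Placement)

open Classical in
/-- The component along `y` of the edge deviation generated by vertex deviations. -/
theorem inner_edgeFormula (σ : V → Matrix (Fin 4) (Fin 4) ℝ) {a : T.Cell 1} {A B : V}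
    (hAB : A ≠ B) (ha : T.verts a.1 = {A, B}) (y : E4) :
    ‖R.pos B - R.pos A‖ ^ 2 * inner ℝ y (R.edgeFormula σ a) =
      tensorForm (σ A) (R.pos B - R.pos A) y - tensorForm (σ B) (R.pos B - R.pos A) y := by
  have hterm : ∀ (M : Matrix (Fin 4) (Fin 4) ℝ) (l : E4),
      inner ℝ y (WithLp.toLp 2 fun β => 1 / ‖l‖ ^ 2 * ∑ α, l α * M α β : E4) =
        1 / ‖l‖ ^ 2 * tensorForm M l y := fun M l => by
    simp only [PiLp.inner_apply, RCLike.inner_apply, conj_trivial, tensorForm, Finset.mul_sum]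
    refine Finset.sum_congr rfl fun β _ => ?_
    rw [Finset.sum_mul]
    exact Finset.sum_congr rfl fun α _ => by ring
  have h0 : ∀ M : Matrix (Fin 4) (Fin 4) ℝ, tensorForm M 0 y = 0 := fun M => by
    simp [tensorForm]
  rw [edgeFormula, ha]
  simp only [Finset.sum_pair hAB, inner_add_right, hterm, sub_self, h0]
  rw [norm_sub_rev (R.pos A) (R.pos B), ← neg_sub (R.pos B) (R.pos A), tensorForm_neg_left]
  rcases eq_or_ne (R.pos B - R.pos A) 0 with h | h
  · rw [h]
    simp [h0]
  · have := norm_ne_zero_iff.2 h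
    field_simp
    ring

/-- Edge deviations generated by vertex deviations do not change the areas: the bivector at each
vertex of the triangle enters through its two sides there, and the two contributions cancel by
antisymmetry. -/
theorem edgeToArea_comp_vertexToEdge (hT : T.IsClosedManifold) :
    R.edgeToArea ∘ₗ R.vertexToEdge = 0 := by
  classical
  refine LinearMap.ext fun σ => funext fun j => ?_
  obtain ⟨u, v, x, hi⟩ := exists_verts_eq_triple (T.lift j)
  obtain ⟨huv, hux, hvx⟩ := triple_ne hi
  obtain ⟨U, hU⟩ : ∃ c : T.verts (T.lift j).1, c.1 = u := ⟨⟨u, by rw [hi]; simp⟩, rfl⟩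
  obtain ⟨Y, hY⟩ : ∃ c : T.verts (T.lift j).1, c.1 = v := ⟨⟨v, by rw [hi]; simp⟩, rfl⟩
  obtain ⟨X, hX⟩ : ∃ c : T.verts (T.lift j).1, c.1 = x := ⟨⟨x, by rw [hi]; simp⟩, rfl⟩
  obtain ⟨F, hF, hFw⟩ := R.exists_hasFDerivAt_deviatedArea hT hi U Y X hU hY hX
  have sU : T.verts (T.side (T.lift j) U).1 = {v, x} := by
    rw [verts_side, hU, hi, Finset.erase_insert (by simp [huv, hux])]
  have sY : T.verts (T.side (T.lift j) Y).1 = {u, x} := by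
    rw [verts_side, hY, hi, Finset.insert_comm,
      Finset.erase_insert (by simp [huv.symm, hvx])]
  have sX : T.verts (T.side (T.lift j) X).1 = {u, v} := by
    rw [verts_side, hX, hi,
      show ({u, v, x} : Finset V) = {x, u, v} by ext; simp; tauto,
      Finset.erase_insert (by simp [hux.symm, hvx.symm])]
  have hmem := (R.edgeFormula_mem σ.2).1
  have hval : (R.edgeToArea ∘ₗ R.vertexToEdge) σ j = fderiv ℝ (R.deviatedArea (T.lift j)) 0
      (fun c => R.edgeFormula σ.1 (T.side (T.lift j) c)) := rfl
  rw [hval, LinearMap.zero_apply, Pi.zero_apply, hF.fderiv,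
    hFw _ (hmem _ v (by rw [sU]; simp) x (by rw [sU]; simp))
    (hmem _ u (by rw [sY]; simp) x (by rw [sY]; simp))
    (hmem _ u (by rw [sX]; simp) v (by rw [sX]; simp)), R.inner_edgeFormula _ hvx sU,
    R.inner_edgeFormula _ hux sY, R.inner_edgeFormula _ huv sX, neg_div, neg_eq_zero,
    div_eq_zero_iff]
  left
  have su := tensorForm_swap (σ.2.1 u) (R.pos x - R.pos u) (R.pos v - R.pos u)
  have sv := tensorForm_swap (σ.2.1 v) (R.pos x - R.pos u) (R.pos v - R.pos u)
  have sx := tensorForm_swap (σ.2.1 x) (R.pos x - R.pos u) (R.pos v - R.pos u)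
  have pp : ∀ w, tensorForm (σ.1 w) (R.pos v - R.pos u) (R.pos v - R.pos u) = 0 := fun w => by
    have := tensorForm_swap (σ.2.1 w) (R.pos v - R.pos u) (R.pos v - R.pos u)
    linarith
  rw [← sub_sub_sub_cancel_right (R.pos x) (R.pos v) (R.pos u), ← neg_sub (R.pos v) (R.pos u)]
  simp only [tensorForm_sub_left, tensorForm_neg_right, tensorForm_sub_right] at *
  linarith [pp u, pp v, pp x]

theorem tensorForm_trivialFamily (y : Matrix (Fin 4) (Fin 4) ℝ × E4) (A : V) (l m : E4) :
    tensorForm (R.trivialFamily y A) l m = tensorForm y.1 l m + vol l m (R.pos A) y.2 := by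
  rw [← tensorForm_leviCivita, ← tensorForm_add]
  rfl

open Classical in
theorem exists_verts_eq_pair (a : T.Cell 1) : ∃ A B : V, A ≠ B ∧ T.verts a.1 = {A, B} :=
  Finset.card_eq_two.1 a.2

/-- For a bivector field `τ + ε(r, s)`, the difference of the values at the ends of an edge
`l` is `ε(l, s)`, which vanishes when contracted with `l`. -/
theorem vertexToEdge_comp_trivialToVertex (hT : T.IsClosedManifold) :
    R.vertexToEdge ∘ₗ R.trivialToVertex = 0 := by
  classical
  refine LinearMap.ext fun y => Subtype.ext (funext fun a => ?_)
  obtain ⟨A, B, hAB, ha⟩ := exists_verts_eq_pair a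
  change R.edgeFormula (R.trivialFamily y.1) a = 0
  refine ext_inner_left ℝ fun z => ?_
  have h := R.inner_edgeFormula (R.trivialFamily y.1) hAB ha z
  rw [R.tensorForm_trivialFamily, R.tensorForm_trivialFamily] at h
  have hne : ‖R.pos B - R.pos A‖ ^ 2 ≠ 0 := by
    rw [pow_ne_zero_iff two_ne_zero, norm_ne_zero_iff, sub_ne_zero]
    intro e
    have := (R.affineIndependent hT a.1).injective
      (a₁ := ⟨B, by rw [ha]; simp⟩) (a₂ := ⟨A, by rw [ha]; simp⟩) e
    exact hAB (congrArg Subtype.val this).symm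
  rw [inner_zero_right]
  refine (mul_eq_zero.1 (h.trans ?_)).resolve_left hne
  simp only [vol_eq, PiLp.sub_apply]
  ring

/-- If `τ + ε(r, s)` vanishes at all vertices, then so does `ε(l, s)` for the edges `l` of a
4-simplex; they span the space, hence `s = 0` and then `τ = 0`. -/
theorem injective_trivialToVertex (hT : T.IsClosedManifold) :
    Function.Injective R.trivialToVertex := by
  classical
  rw [injective_iff_map_eq_zero]
  intro y hy
  have h0 : ∀ A l m, tensorForm y.1.1 l m + vol l m (R.pos A) y.1.2 = 0 := fun A l m => by
    have h1 : R.trivialFamily y.1 A = 0 := congrFun (congrArg Subtype.val hy) A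
    rw [← R.tensorForm_trivialFamily, h1]
    simp [tensorForm]
  have hd : ∀ A B l m, vol l m (R.pos A - R.pos B) y.1.2 = 0 := fun A B l m => by
    have h1 := h0 A l m
    have h2 := h0 B l m
    simp only [vol_eq, PiLp.sub_apply] at h1 h2 ⊢
    linear_combination h1 - h2
  obtain ⟨⟨⟨p⟩, -⟩, -⟩ := T.simplyConnected
  obtain ⟨s, -⟩ := hT.pure p
  obtain ⟨S, hS, hcard⟩ := Finset.exists_subset_card_eq (s := T.verts s.1) (n := 3)
    (by rw [s.2]; norm_num)
  have hne : S.Nonempty := by rw [← Finset.card_pos, hcard]; norm_num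
  let i : T.Cell 2 := ⟨T.face s.1 S hS hne, by rw [T.verts_face, hcard]⟩
  obtain ⟨u, v, x, hi⟩ := exists_verts_eq_triple i
  obtain ⟨j, k, hV⟩ := R.exists_vol_ne_zero hT hi
  have hs : y.1.2 = 0 := eq_zero_of_forall_vol_eq_zero hV (hd _ _) (hd _ _)
  refine Subtype.ext (Prod.ext (Matrix.ext fun α β => ?_) hs)
  have h1 := h0 u (EuclideanSpace.single α 1) (EuclideanSpace.single β 1)
  rw [hs] at h1
  simpa [tensorForm, vol_eq, Pi.single_apply] using h1

end Triangulation.Placement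

/-! ### Infinitesimal motions and rigidity -/

theorem mem_motions_of_inner {ξ : E4 →ᵃ[ℝ] E4} (h : ∀ x y, inner ℝ (x - y) (ξ x - ξ y) = 0) :
    ξ ∈ motions := fun x => by
  have h1 := h x 0
  rwa [affineMap_sub, sub_zero, real_inner_comm] at h1

namespace Triangulation

variable {T : Triangulation Γ V P}

theorem exists_cell_four (hT : T.IsClosedManifold) (v : V) : ∃ s : T.Cell 4, v ∈ T.verts s.1 := by
  obtain ⟨p, hp, -⟩ := T.existsUnique_vertex v
  obtain ⟨s, hs⟩ := hT.pure p
  exact ⟨s, T.verts_mono _ _ hs (by rw [hp]; simp)⟩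

theorem nonempty_cell_four (hT : T.IsClosedManifold) : Nonempty (T.Cell 4) := by
  obtain ⟨⟨⟨p⟩, -⟩, -⟩ := T.simplyConnected
  obtain ⟨s, -⟩ := hT.pure p
  exact ⟨s⟩

namespace Placement

variable (R : T.Placement)

theorem motion_ext_pos (hT : T.IsClosedManifold) {ξ η : E4 →ᵃ[ℝ] E4} (hξ : ξ ∈ motions)
    (hη : η ∈ motions) (h : ∀ v, ξ (R.pos v) = η (R.pos v)) : ξ = η := by
  obtain ⟨s⟩ := nonempty_cell_four hT
  refine motion_ext (R.affineIndependent hT s.1) ?_ hξ hη fun u => h u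
  rw [Fintype.card_coe, s.2]
  norm_num

/-- Infinitesimal rigidity: velocities of all vertices of the covering that do not change the
lengths of the edges come from one infinitesimal motion of the space. -/
theorem exists_motion_eq_pos (hT : T.IsClosedManifold) {x : V → E4}
    (hx : ∀ (a : T.Cell 1), ∀ u ∈ T.verts a.1, ∀ w ∈ T.verts a.1,
      inner ℝ (R.pos u - R.pos w) (x u - x w) = 0) :
    ∃ ξ ∈ motions, ∀ v, x v = ξ (R.pos v) := by
  classical
  have hs : ∀ s : T.Cell 4, ∃ ξ ∈ motions, ∀ u : T.verts s.1, ξ (R.pos u) = x u := fun s => by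
    have := (T.verts_nonempty s.1).to_subtype
    refine exists_motion (R.affineIndependent hT s.1) (fun u => x u) fun u w => ?_
    by_cases h : u = w
    · subst h; simp
    · exact hx (T.edge s u w h) _ (by rw [T.verts_edge]; simp) _ (by rw [T.verts_edge]; simp)
  choose ξ hξ hξx using hs
  have hadj : ∀ s t, Adjacent (T := T) Set.univ s t → ξ s = ξ t := by
    rintro s t ⟨f, -, hfs, hft⟩
    refine motion_ext (R.affineIndependent hT f.1) ?_ (hξ s) (hξ t) fun u => ?_
    · rw [Fintype.card_coe, f.2]
    · exact (hξx s ⟨u, T.verts_mono _ _ hfs.le u.2⟩).trans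
        (hξx t ⟨u, T.verts_mono _ _ hft.le u.2⟩).symm
  obtain ⟨s₀⟩ := nonempty_cell_four hT
  have hall : ∀ s, ξ s₀ = ξ s := fun s => by
    induction adjacent_connected hT s₀ s with
    | refl => rfl
    | tail _ h ih => exact ih.trans (hadj _ _ h)
  refine ⟨ξ s₀, hξ s₀, fun v => ?_⟩
  obtain ⟨s, hs⟩ := exists_cell_four hT v
  rw [hall s]
  exact (hξx s ⟨v, hs⟩).symm

/-- The infinitesimal motion obtained by transporting `ξ` with the motion assigned to `g`. -/
def transport (g : Γ) (ξ : E4 →ᵃ[ℝ] E4) : E4 →ᵃ[ℝ] E4 :=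
  (R.rot g).toLinearEquiv.toLinearMap.toAffineMap.comp
    (ξ.comp (R.rep g).symm.toAffineEquiv.toAffineMap)

theorem transport_rep (g : Γ) (ξ : E4 →ᵃ[ℝ] E4) (x : E4) :
    R.transport g ξ (R.rep g x) = R.rot g (ξ x) := by
  change R.rot g (ξ ((R.rep g).symm (R.rep g x))) = _
  rw [AffineIsometryEquiv.symm_apply_apply]

theorem rep_sub (g : Γ) (x y : E4) : R.rep g x - R.rep g y = R.rot g (x - y) :=
  ((R.rep g).map_vsub x y).symm

theorem transport_mem (g : Γ) {ξ : E4 →ᵃ[ℝ] E4} (hξ : ξ ∈ motions) :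
    R.transport g ξ ∈ motions := by
  refine mem_motions_of_inner fun x y => ?_
  obtain ⟨x, rfl⟩ := (R.rep g).surjective x
  obtain ⟨y, rfl⟩ := (R.rep g).surjective y
  rw [transport_rep, transport_rep, rep_sub, ← map_sub, LinearIsometryEquiv.inner_map_map]
  exact inner_motion_sub hξ x y

/-! ### Displacements of the vertices and lengths of the edges -/

variable {G : Submodule ℝ (Γ → E4 →ᵃ[ℝ] E4)}

theorem mem_motions_of_mem (hG : R.IsParameterSpace G) {c : Γ → E4 →ᵃ[ℝ] E4} (hc : c ∈ G) (g : Γ) :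
    c g ∈ motions :=
  (hG.2 ▸ Submodule.mem_sup_left hc : c ∈ R.deformations).1 g

open Classical in
theorem positionToLength_proj (hG : R.IsParameterSpace G) (y : R.positionSpace G) (a : T.Cell 1)
    {u w : V} (h : T.verts a.1 = {u, w}) :
    R.positionToLength G y (T.proj a) = 2 * inner ℝ (R.pos u - R.pos w) (y.1.1 u - y.1.1 w) := by
  have huw : u ≠ w := by
    rintro rfl
    have := a.2
    rw [h] at this
    simp at this
  obtain ⟨g, hg⟩ := exists_smul_eq_lift a
  have hinv : ∀ v z : V, inner ℝ (R.pos (g • v) - R.pos (g • z)) (y.1.1 (g • v) - y.1.1 (g • z)) =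
      inner ℝ (R.pos v - R.pos z) (y.1.1 v - y.1.1 z) := fun v z => by
    rw [y.2.2, y.2.2, add_sub_add_comm, inner_add_right,
      inner_motion_sub (R.mem_motions_of_mem hG y.2.1 g), add_zero, pos_smul_sub, ← map_sub,
      LinearIsometryEquiv.inner_map_map]
  have hval : R.positionToLength G y (T.proj a) =
      ∑ u ∈ T.verts (T.lift (T.proj a)).1, ∑ w ∈ T.verts (T.lift (T.proj a)).1,
        inner ℝ (R.pos u - R.pos w) (y.1.1 u - y.1.1 w) := rfl
  rw [hval, ← hg, smul_cell_val, T.verts_smul, h, Finset.image_insert, Finset.image_singleton,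
    Finset.sum_pair ((MulAction.injective g).ne huw),
    Finset.sum_pair ((MulAction.injective g).ne huw),
    Finset.sum_pair ((MulAction.injective g).ne huw)]
  simp only [hinv]
  rw [← neg_sub (R.pos u) (R.pos w), ← neg_sub (y.1.1 u) (y.1.1 w), inner_neg_neg]
  simp
  ring

theorem sqDist_positionToLength (hG : R.IsParameterSpace G) (y : R.positionSpace G) (s : T.Cell 4)
    (u w : T.verts s.1) : T.sqDist (R.positionToLength G y) s u w =
      2 * inner ℝ (R.pos u - R.pos w) (y.1.1 u - y.1.1 w) := by
  classical
  by_cases h : u = w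
  · subst h; simp [sqDist]
  · rw [sqDist, dif_neg h, R.positionToLength_proj hG y _ (T.verts_edge s u w h)]

theorem injective_motionToPosition (hT : T.IsClosedManifold) :
    Function.Injective (R.motionToPosition G) := fun ξ η h =>
  Subtype.ext <| R.motion_ext_pos hT ξ.2.1 η.2.1 fun v =>
    congrFun (congrArg (fun y : R.positionSpace G => y.1.1) h) v

theorem positionToLength_comp_motionToPosition (hG : R.IsParameterSpace G) :
    R.positionToLength G ∘ₗ R.motionToPosition G = 0 := by
  refine LinearMap.ext fun ξ => funext fun a => ?_
  obtain ⟨u, w, -, h⟩ := exists_verts_eq_pair (T.lift a)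
  rw [← proj_lift a, LinearMap.comp_apply, R.positionToLength_proj hG _ _ h]
  change 2 * inner ℝ (R.pos u - R.pos w) (ξ.1 (R.pos u) - ξ.1 (R.pos w)) = 0
  rw [inner_motion_sub ξ.2.1, mul_zero]

/-- Displacements that preserve the edge lengths come from one infinitesimal motion, and the
deformation of the representation is then its conjugation; being in the complement `G`, it is
zero, so that the motion commutes with the representation. -/
theorem exact_motionToPosition (hT : T.IsClosedManifold) (hG : R.IsParameterSpace G) :
    Function.Exact (R.motionToPosition G) (R.positionToLength G) := by
  classical
  intro y
  refine ⟨fun hy => ?_, ?_⟩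
  · obtain ⟨ξ, hξ, hx⟩ := R.exists_motion_eq_pos hT (x := y.1.1) fun a u hu w hw => by
      by_cases huw : u = w
      · subst huw; simp
      have h : T.verts a.1 = {u, w} := by
        symm
        refine Finset.eq_of_subset_of_card_le ?_ ?_
        · intro z hz
          rcases Finset.mem_insert.1 hz with rfl | hz
          · exact hu
          · rwa [Finset.mem_singleton.1 hz]
        · rw [a.2, Finset.card_pair huw]
      have h1 := R.positionToLength_proj hG y a h
      rw [hy, Pi.zero_apply] at h1
      linarith
    have hc : ∀ g, y.1.2 g = ξ - R.transport g ξ := fun g => by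
      refine R.motion_ext_pos hT (R.mem_motions_of_mem hG y.2.1 g)
        (motions.sub_mem hξ (R.transport_mem g hξ)) fun v => ?_
      obtain ⟨v, rfl⟩ := MulAction.surjective g v
      have h1 := y.2.2 g v
      rw [hx, hx] at h1
      rw [AffineMap.coe_sub, Pi.sub_apply, h1, R.equivariant, transport_rep, add_sub_cancel_left]
    have hc0 : y.1.2 = 0 := by
      have : y.1.2 ∈ G ⊓ R.conjugations := ⟨y.2.1, ξ, hξ, fun g x => by
        rw [hc, AffineMap.coe_sub, Pi.sub_apply, transport_rep]⟩
      rwa [hG.1, Submodule.mem_bot] at this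
    have hcomm : ξ ∈ R.commutant := ⟨hξ, fun g x => by
      have h1 := hc g
      rw [hc0, Pi.zero_apply, eq_comm, sub_eq_zero] at h1
      rw [← transport_rep, ← h1]⟩
    exact ⟨⟨ξ, hcomm⟩, Subtype.ext (Prod.ext (funext fun v => (hx v).symm) hc0.symm)⟩
  · rintro ⟨ξ, rfl⟩
    exact congrArg (fun F => F ξ) (R.positionToLength_comp_motionToPosition hG)

theorem turnRate_congr {l₁ l₂ y : E4} {A B : E4 →ₗ[ℝ] E4} (h₁ : A l₁ = B l₁) (h₂ : A l₂ = B l₂)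
    (hy : A y = B y) : turnRate l₁ l₂ y A = turnRate l₁ l₂ y B := by
  obtain ⟨a, b, h⟩ := exists_perp_eq l₁ l₂ y
  have : A (perp l₁ l₂ y) = B (perp l₁ l₂ y) := by
    rw [h]
    simp only [map_sub, map_smul, h₁, h₂, hy]
  rw [turnRate, this, turnRate]

/-- Deformations of edge lengths that come from displacements of the vertices do not change the
deficit angles: the faces around a triangle turn by well-defined angles, and each of them occurs
twice, with opposite signs. -/
theorem lengthToDeficit_comp_positionToLength (hT : T.IsClosedManifold) (o : T.Orientation)
    (hG : R.IsParameterSpace G) : R.lengthToDeficit o ∘ₗ R.positionToLength G = 0 := by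
  classical
  refine LinearMap.ext fun y => funext fun j => ?_
  obtain ⟨u, v, x, hi⟩ := exists_verts_eq_triple (T.lift j)
  have hA : ∀ s : T.Cell 4, ∃ A : E4 →ₗ[ℝ] E4, ∀ a ∈ T.verts s.1, ∀ b ∈ T.verts s.1,
      A (R.pos a - R.pos b) = y.1.1 a - y.1.1 b := fun s => by
    have := (T.verts_nonempty s.1).to_subtype
    obtain ⟨A, hA⟩ := exists_linearMap_eq (R.affineIndependent hT s.1) fun a => y.1.1 a
    exact ⟨A, fun a ha b hb => hA ⟨a, ha⟩ ⟨b, hb⟩⟩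
  choose A hA using hA
  rw [← proj_lift j, LinearMap.comp_apply, R.lengthToDeficit_apply o hT _ hi A _ fun s _ a b => by
    rw [R.sqDist_positionToLength hG, hA s _ a.2 _ b.2]
    ring]
  rw [Finset.sum_eq_zero, mul_zero]
  · rfl
  intro f hf
  have hif := hT.mem_above.1 hf
  obtain ⟨s, t, hst, hab⟩ := hT.exists_above_eq f
  have hs : f.1 < s.1 := hT.mem_above.1 (by rw [hab]; simp)
  have ht : f.1 < t.1 := hT.mem_above.1 (by rw [hab]; simp)
  have hvf := (verts_of_flag hi hif.le hs.le).1
  have hmem : ∀ w ∈ T.verts f.1, A s (R.pos w - R.pos u) = A t (R.pos w - R.pos u) := fun w hw => by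
    have hu : u ∈ T.verts f.1 := by rw [hvf]; simp
    rw [hA s _ (T.verts_mono _ _ hs.le hw) _ (T.verts_mono _ _ hs.le hu),
      hA t _ (T.verts_mono _ _ ht.le hw) _ (T.verts_mono _ _ ht.le hu)]
  rw [hab, Finset.sum_pair hst, (R.flagSign_coherent o hi hif.le hst hs ht).1,
    turnRate_congr (hmem v (by rw [hvf]; simp)) (hmem x (by rw [hvf]; simp))
      (hmem _ (by rw [hvf]; simp))]
  ring

end Placement

end Triangulation

/-! ### Deficit angles and the motions of tetrahedra -/

/-- The value of an infinitesimal motion at a point. -/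
def motionEval (p : E4) : motions →ₗ[ℝ] E4 where
  toFun ξ := ξ.1 p
  map_add' _ _ := rfl
  map_smul' _ _ := rfl

theorem motionEval_apply (p : E4) (ξ : motions) : motionEval p ξ = ξ.1 p := rfl

/-- The component of the linear part of an infinitesimal motion along the plane orthogonal to `l₁`
and `l₂`. -/
def motionRate (l₁ l₂ : E4) : motions →ₗ[ℝ] ℝ where
  toFun ξ := normalRate l₁ l₂ ξ.1.linear
  map_add' ξ η := by
    simp only [normalRate, Submodule.coe_add, AffineMap.add_linear, LinearMap.add_apply,
      ← volLast_apply, map_add, Finset.sum_add_distrib]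
    ring
  map_smul' r ξ := by
    simp only [normalRate, Submodule.coe_smul, AffineMap.smul_linear, LinearMap.smul_apply,
      ← volLast_apply, map_smul, smul_eq_mul, RingHom.id_apply, ← Finset.mul_sum]
    ring

theorem motionRate_apply (l₁ l₂ : E4) (ξ : motions) :
    motionRate l₁ l₂ ξ = normalRate l₁ l₂ ξ.1.linear := rfl

theorem turnRate_sub (l₁ l₂ y : E4) (A B : E4 →ₗ[ℝ] E4) :
    turnRate l₁ l₂ y (A - B) = turnRate l₁ l₂ y A - turnRate l₁ l₂ y B := by
  simp only [turnRate, LinearMap.sub_apply, ← volLast_apply, map_sub, sub_div]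

theorem perp_ne_zero {l₁ l₂ y z : E4} (h : vol l₁ l₂ y z ≠ 0) : perp l₁ l₂ y ≠ 0 := by
  intro h0
  obtain ⟨a, b, hab⟩ := exists_perp_eq l₁ l₂ y
  have hy : y = a • l₁ + b • l₂ := by
    rw [h0] at hab
    rw [← sub_eq_zero, hab]
    abel
  refine h ?_
  rw [hy]
  simp only [vol_eq, PiLp.add_apply, PiLp.smul_apply, smul_eq_mul]
  ring

theorem IsSkew.turnRate_eq {X : E4 →ₗ[ℝ] E4} (hX : IsSkew X) {l₁ l₂ y : E4}
    (h : perp l₁ l₂ y ≠ 0) : turnRate l₁ l₂ y X = normalRate l₁ l₂ X := by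
  rw [turnRate, hX.vol_apply (inner_left_perp _ _ _) (inner_right_perp _ _ _),
    mul_div_cancel_left₀ _ (inner_self_ne_zero.2 h)]

namespace Triangulation

variable {T : Triangulation Γ V P}

theorem sqDist_comm (d : T.Face 1 → ℝ) (s : T.Cell 4) (u w : T.verts s.1) :
    T.sqDist d s u w = T.sqDist d s w u := by
  classical
  by_cases h : u = w
  · rw [h]
  · rw [sqDist, sqDist, dif_neg h, dif_neg (Ne.symm h)]
    congr 2
    refine Subtype.ext (T.eq_of_le_of_verts (T.edge_le s u w h) (T.edge_le s w u (Ne.symm h)) ?_)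
    rw [T.verts_edge, T.verts_edge, Finset.pair_comm]

theorem sqDist_self (d : T.Face 1 → ℝ) (s : T.Cell 4) (u : T.verts s.1) :
    T.sqDist d s u u = 0 := by
  classical
  exact dif_pos rfl

namespace Placement

variable (R : T.Placement)

/-- Every deformation of the edge lengths of a 4-simplex is realized by an affine velocity
field. -/
theorem exists_strain (d : T.Face 1 → ℝ) (s : T.Cell 4) : ∃ A : E4 →ₗ[ℝ] E4,
    ∀ a b : T.verts s.1, inner ℝ (R.pos a - R.pos b) (A (R.pos a - R.pos b)) =
      T.sqDist d s a b / 2 := by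
  classical
  obtain ⟨n, c, -, -, -, hn'⟩ := exists_barycentric _ (R.nondegenerate s) (by
    rw [Fintype.card_coe, s.2])
  have hn : ∀ m i : T.verts s.1, inner ℝ (n m) (R.pos i) + c m = if m = i then 1 else 0 :=
    fun m i => by convert hn' m i
  let D := T.sqDist d s
  -- `⟨x, A x⟩ = -(1/4) ∑ D j k ⟨n j, x⟩ ⟨n k, x⟩`, and `⟨n j, p a - p b⟩ = δ j a - δ j b`
  refine ⟨∑ j, ∑ k, (-(1 / 4) * D j k) • ((innerₗ E4 (n j)).smulRight (n k)), fun a b => ?_⟩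
  have hd : ∀ m, inner ℝ (n m) (R.pos a - R.pos b) =
      (if m = a then 1 else 0) - (if m = b then 1 else 0) := fun m => by
    rw [← hn m a, ← hn m b, inner_sub_right]
    ring
  have hd' : ∀ m, inner ℝ (R.pos a - R.pos b) (n m) =
      (if m = a then 1 else 0) - (if m = b then 1 else 0) := fun m => by
    rw [real_inner_comm, hd]
  simp only [LinearMap.sum_apply, LinearMap.smul_apply, LinearMap.smulRight_apply,
    innerₗ_apply_apply, inner_sum, inner_smul_right, hd, hd']
  have e : ∀ j k, -(1 / 4) * D j k * (((if j = a then 1 else 0) - (if j = b then 1 else 0)) *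
      ((if k = a then 1 else 0) - (if k = b then 1 else 0))) =
      -(1 / 4) * ((if j = a then 1 else 0) - (if j = b then 1 else 0)) *
        ((if k = a then D j k else 0) - (if k = b then D j k else 0)) := fun j k => by
    split_ifs <;> ring
  simp only [e, ← Finset.mul_sum, Finset.sum_sub_distrib, Finset.sum_ite_eq', Finset.mem_univ,
    if_true]
  have e' : ∀ j, -(1 / 4) * ((if j = a then 1 else 0) - (if j = b then 1 else 0)) *
      (D j a - D j b) = -(1 / 4) * ((if j = a then D j a - D j b else 0) -
        (if j = b then D j a - D j b else 0)) := fun j => by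
    split_ifs <;> ring
  simp only [e', ← Finset.mul_sum, Finset.sum_sub_distrib, Finset.sum_ite_eq', Finset.mem_univ,
    if_true]
  have h1 : D a a = 0 := sqDist_self d s a
  have h2 : D b b = 0 := sqDist_self d s b
  have h3 : D b a = D a b := sqDist_comm d s b a
  rw [h1, h2, h3]
  ring

theorem flagSign_eq (o : T.Orientation) (u v x : V) (i : P) (f : T.Cell 3) (s : T.Cell 4) :
    R.flagSign o u v x i f s = R.simplexSign o s * Real.sign (vol (R.pos v - R.pos u)
      (R.pos x - R.pos u) (R.pos (T.apex f.1 i) - R.pos u) (R.pos (T.apex s.1 f.1) - R.pos u)) := by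
  rw [flagSign, volSimplex_vec]

open Classical in
theorem sum_above_flagSign (hT : T.IsClosedManifold) (o : T.Orientation) {u v x : V}
    {i : T.Cell 2} (hi : T.verts i.1 = {u, v, x}) {f : T.Cell 3} (hf : i.1 < f.1) :
    ∑ s ∈ hT.above 4 f.1, R.flagSign o u v x i.1 f s = 0 := by
  classical
  obtain ⟨s, t, hst, h⟩ := hT.exists_above_eq f
  rw [h, Finset.sum_pair hst, (R.flagSign_coherent o hi hf.le hst
    (hT.mem_above.1 (by rw [h]; simp)) (hT.mem_above.1 (by rw [h]; simp))).1, neg_add_cancel]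

theorem sum_between_flagSign (hT : T.IsClosedManifold) (o : T.Orientation) (u v x : V)
    {i : T.Cell 2} {s : T.Cell 4} (hs : i.1 < s.1) :
    ∑ f ∈ hT.between 3 i.1 s.1, R.flagSign o u v x i.1 f s = 0 := by
  classical
  obtain ⟨j, k, f, g, -, -, -, -, hfg, e1, e2, e3, e4, h⟩ := hT.exists_between_eq hs.le i.2 s.2
  rw [h, Finset.sum_pair hfg, flagSign_eq, flagSign_eq, e1, e2, e3, e4, vol_swap_last,
    Real.sign_neg]
  ring

theorem sum_between_flagSign_edge (hT : T.IsClosedManifold) (o : T.Orientation) (u v : V)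
    {a : T.Cell 1} {f : T.Cell 3} (hf : a.1 < f.1) (s : T.Cell 4) :
    ∑ i ∈ hT.between 2 a.1 f.1, R.flagSign o u v (T.apex i.1 a.1) i.1 f s = 0 := by
  classical
  obtain ⟨j, k, i, i', -, -, -, -, hii, e1, e2, e3, e4, h⟩ := hT.exists_between_eq hf.le a.2 f.2
  rw [h, Finset.sum_pair hii, flagSign_eq, flagSign_eq, e1, e2, e3, e4, vol_swap_middle,
    Real.sign_neg]
  ring

/-- Velocity fields `A s` realizing a deformation `d` of the edge lengths inside every 4-simplex,
together with a comparison field `B f` on every tetrahedron; since the fields change the lengths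
of the edges of `f` in the same way, they differ on `f` by infinitesimal motions `m f s`. -/
structure LocalFields (d : T.Face 1 → ℝ) where
  /-- the field on a 4-simplex -/
  A : T.Cell 4 → E4 →ₗ[ℝ] E4
  /-- the field on a tetrahedron -/
  B : T.Cell 3 → E4 →ₗ[ℝ] E4
  /-- the difference of the fields -/
  m : T.Cell 3 → T.Cell 4 → motions
  inner_A : ∀ (s : T.Cell 4) (a b : T.verts s.1),
    inner ℝ (R.pos a - R.pos b) (A s (R.pos a - R.pos b)) = T.sqDist d s a b / 2
  m_apply : ∀ (f : T.Cell 3) (s : T.Cell 4), f.1 < s.1 → ∀ u ∈ T.verts f.1,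
    (m f s).1 (R.pos u) = A s (R.pos u) - B f (R.pos u)

theorem exists_localFields (hT : T.IsClosedManifold) (d : T.Face 1 → ℝ) :
    Nonempty (R.LocalFields d) := by
  classical
  choose A hA using R.exists_strain d
  have href : ∀ f : T.Cell 3, ∃ t : T.Cell 4, f.1 < t.1 := fun f => by
    obtain ⟨s, t, -, h⟩ := hT.exists_above_eq f
    exact ⟨s, hT.mem_above.1 (by rw [h]; simp)⟩
  choose t ht using href
  have hm : ∀ (f : T.Cell 3) (s : T.Cell 4), ∃ ξ : motions, f.1 < s.1 → ∀ u ∈ T.verts f.1,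
      ξ.1 (R.pos u) = A s (R.pos u) - A (t f) (R.pos u) := fun f s => by
    by_cases hfs : f.1 < s.1
    · have := (T.verts_nonempty f.1).to_subtype
      obtain ⟨ξ, hξ, h⟩ := exists_motion (R.affineIndependent hT f.1)
        (fun u => A s (R.pos u) - A (t f) (R.pos u)) fun u w => by
          have h1 := hA s ⟨u, T.verts_mono _ _ hfs.le u.2⟩ ⟨w, T.verts_mono _ _ hfs.le w.2⟩
          have h2 := hA (t f) ⟨u, T.verts_mono _ _ (ht f).le u.2⟩
            ⟨w, T.verts_mono _ _ (ht f).le w.2⟩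
          have h3 : T.sqDist d s ⟨u, T.verts_mono _ _ hfs.le u.2⟩
              ⟨w, T.verts_mono _ _ hfs.le w.2⟩ = T.sqDist d (t f)
              ⟨u, T.verts_mono _ _ (ht f).le u.2⟩ ⟨w, T.verts_mono _ _ (ht f).le w.2⟩ := by
            by_cases huw : u = w
            · subst huw
              rw [sqDist_self, sqDist_self]
            · have huw' : u.1 ≠ w.1 := fun e => huw (Subtype.ext e)
              have key : ∀ (r : T.Cell 4) (hr : f.1 < r.1),
                  T.sqDist d r ⟨u, T.verts_mono _ _ hr.le u.2⟩ ⟨w, T.verts_mono _ _ hr.le w.2⟩ =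
                    d (T.proj (T.edge f u w huw)) := fun r hr => by
                have hne : (⟨u, T.verts_mono _ _ hr.le u.2⟩ : T.verts r.1) ≠
                    ⟨w, T.verts_mono _ _ hr.le w.2⟩ := fun e => huw' (Subtype.mk.inj e)
                rw [sqDist, dif_neg hne]
                congr 2
                exact Subtype.ext <| T.eq_of_le_of_verts (T.edge_le r _ _ hne)
                  ((T.edge_le f u w huw).trans hr.le) (by rw [T.verts_edge, T.verts_edge])
              rw [key s hfs, key (t f) (ht f)]
          rw [h3, ← h2] at h1
          rw [sub_sub_sub_comm, ← map_sub, ← map_sub, inner_sub_right, h1, sub_self]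
      exact ⟨⟨ξ, hξ⟩, fun _ u hu => h ⟨u, hu⟩⟩
    · exact ⟨0, fun h => absurd h hfs⟩
  choose m hm using hm
  exact ⟨⟨A, fun f => A (t f), m, hA, hm⟩⟩

namespace LocalFields

variable {R} {d : T.Face 1 → ℝ} (D : R.LocalFields d) (hT : T.IsClosedManifold)
  (o : T.Orientation)

/-- The sum around a triangle of the differences of the fields, with signs. -/
def jumpSum (u v x : V) (i : P) : motions :=
  ∑ f ∈ hT.above 3 i, ∑ s ∈ hT.above 4 f.1, R.flagSign o u v x i f s • D.m f s

open Classical in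
/-- The sum of jumps around a triangle fixes its vertices, since it telescopes there. -/
theorem jumpSum_apply_pos {u v x : V} {i : T.Cell 2} (hi : T.verts i.1 = {u, v, x}) {w : V}
    (hw : w ∈ T.verts i.1) : (D.jumpSum hT o u v x i.1).1 (R.pos w) = 0 := by
  rw [← motionEval_apply, jumpSum, map_sum]
  have h1 : ∀ f ∈ hT.above 3 i.1,
      motionEval (R.pos w) (∑ s ∈ hT.above 4 f.1, R.flagSign o u v x i.1 f s • D.m f s) =
        ∑ s ∈ hT.above 4 f.1, R.flagSign o u v x i.1 f s • D.A s (R.pos w) := by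
    intro f hf
    have hf := hT.mem_above.1 hf
    rw [map_sum, ← sub_eq_zero, ← Finset.sum_sub_distrib]
    have h2 : ∀ s ∈ hT.above 4 f.1, motionEval (R.pos w) (R.flagSign o u v x i.1 f s • D.m f s) -
        R.flagSign o u v x i.1 f s • D.A s (R.pos w) =
        R.flagSign o u v x i.1 f s • -D.B f (R.pos w) := fun s hs => by
      rw [map_smul, motionEval_apply, D.m_apply f s (hT.mem_above.1 hs) w
        (T.verts_mono _ _ hf.le hw), ← smul_sub]
      congr 1
      abel
    rw [Finset.sum_congr rfl h2, ← Finset.sum_smul, R.sum_above_flagSign hT o hi hf, zero_smul]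
  rw [Finset.sum_congr rfl h1, hT.sum_above_above]
  refine Finset.sum_eq_zero fun s hs => ?_
  rw [← Finset.sum_smul, R.sum_between_flagSign hT o u v x (hT.mem_above.1 hs), zero_smul]

open Classical in
theorem jumpSum_linear {u v x : V} {i : T.Cell 2} (hi : T.verts i.1 = {u, v, x}) {w z : V}
    (hw : w ∈ T.verts i.1) (hz : z ∈ T.verts i.1) :
    (D.jumpSum hT o u v x i.1).1.linear (R.pos w - R.pos z) = 0 := by
  rw [← affineMap_sub, D.jumpSum_apply_pos hT o hi hw, D.jumpSum_apply_pos hT o hi hz, sub_zero]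

open Classical in
/-- The differential of the deficit angle at a triangle is the rotation around the triangle
contained in the sum of jumps. -/
theorem lengthToDeficit_eq {u v x : V} {i : T.Cell 2} (hi : T.verts i.1 = {u, v, x}) :
    R.lengthToDeficit o d (T.proj i) =
      1 / parallelogramArea (R.pos v - R.pos u) (R.pos x - R.pos u) *
        normalRate (R.pos v - R.pos u) (R.pos x - R.pos u)
          (D.jumpSum hT o u v x i.1).1.linear := by
  rw [R.lengthToDeficit_apply o hT i hi D.A d fun s _ => D.inner_A s, ← motionRate_apply, jumpSum,
    map_sum]
  congr 1
  refine Finset.sum_congr rfl fun f hf => ?_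
  have hf := hT.mem_above.1 hf
  have hvf : ∀ s : T.Cell 4, f.1 < s.1 → _ := fun s hs => verts_of_flag hi hf.le hs.le
  rw [map_sum, ← sub_eq_zero, ← Finset.sum_sub_distrib]
  have h2 : ∀ s ∈ hT.above 4 f.1, R.flagSign o u v x i.1 f s *
      turnRate (R.pos v - R.pos u) (R.pos x - R.pos u) (R.pos (T.apex f.1 i.1) - R.pos u) (D.A s) -
      motionRate (R.pos v - R.pos u) (R.pos x - R.pos u) (R.flagSign o u v x i.1 f s • D.m f s) =
      R.flagSign o u v x i.1 f s *
        turnRate (R.pos v - R.pos u) (R.pos x - R.pos u) (R.pos (T.apex f.1 i.1) - R.pos u)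
          (D.B f) := fun s hs => by
    have hs := hT.mem_above.1 hs
    obtain ⟨vf, vs⟩ := hvf s hs
    have hm : ∀ w ∈ T.verts f.1, (D.m f s).1.linear (R.pos w - R.pos u) =
        (D.A s - D.B f) (R.pos w - R.pos u) := fun w hw => by
      rw [← affineMap_sub, D.m_apply f s hs w hw, D.m_apply f s hs u (by rw [vf]; simp),
        map_sub, LinearMap.sub_apply, LinearMap.sub_apply]
    rw [map_smul, motionRate_apply, ← (isSkew_of_mem_motions (D.m f s).2).turnRate_eq
      (perp_ne_zero (R.vol_ne_zero_of_verts vs)), turnRate_congr (hm v (by rw [vf]; simp))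
      (hm x (by rw [vf]; simp)) (hm _ (by rw [vf]; simp)), turnRate_sub, smul_eq_mul]
    ring
  rw [Finset.sum_congr rfl h2, ← Finset.sum_mul, R.sum_above_flagSign hT o hi hf, zero_mul]

open Classical in
/-- The sum of jumps around a triangle is an infinitesimal rotation around the plane of the
triangle, proportional to the differential of the deficit angle. -/
theorem inner_jumpSum {u v x : V} {i : T.Cell 2} (hi : T.verts i.1 = {u, v, x}) (y z : E4) :
    inner ℝ ((D.jumpSum hT o u v x i.1).1.linear y) z =
      R.lengthToDeficit o d (T.proj i) /
        parallelogramArea (R.pos v - R.pos u) (R.pos x - R.pos u) *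
          vol (R.pos v - R.pos u) (R.pos x - R.pos u) y z := by
  obtain ⟨j, k, hV⟩ := R.exists_vol_ne_zero hT hi
  have hQ := parallelogramArea_pos hV
  have hQ2 : parallelogramArea (R.pos v - R.pos u) (R.pos x - R.pos u) ^ 2 = _ :=
    Real.sq_sqrt (gram_pos_of_vol_ne_zero hV).le
  have h := (isSkew_of_mem_motions (D.jumpSum hT o u v x i.1).2).inner_apply_eq hV
    (D.jumpSum_linear hT o hi (by rw [hi]; simp) (by rw [hi]; simp))
    (D.jumpSum_linear hT o hi (by rw [hi]; simp) (by rw [hi]; simp)) y z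
  rw [← hQ2] at h
  rw [D.lengthToDeficit_eq hT o hi]
  field_simp
  linear_combination h

/-- The sums of jumps around the triangles that contain a given edge cancel. -/
theorem sum_jumpSum (a : T.Cell 1) (u v : V) :
    ∑ i ∈ hT.above 2 a.1, D.jumpSum hT o u v (T.apex i.1 a.1) i.1 = 0 := by
  simp only [jumpSum]
  rw [hT.sum_above_above]
  refine Finset.sum_eq_zero fun f hf => ?_
  rw [Finset.sum_comm]
  refine Finset.sum_eq_zero fun s _ => ?_
  rw [← Finset.sum_smul, R.sum_between_flagSign_edge hT o u v (hT.mem_above.1 hf), zero_smul]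

end LocalFields

end Placement

end Triangulation

/-! ### Areas and deficit angles -/

namespace Triangulation

variable {T : Triangulation Γ V P}

theorem apex_smul {g : Γ} {p q : P} (h : q ≤ p) (hc : (T.verts p).card = (T.verts q).card + 1) :
    T.apex (g • p) (g • q) = g • T.apex p q := by
  classical
  obtain ⟨h1, h2⟩ := T.verts_eq_insert_apex h hc
  refine T.apex_eq (fun h3 => h1 ((T.smul_mem_verts g q _).1 h3)) ?_
  rw [T.verts_smul, T.verts_smul, h2, Finset.image_insert]

open Classical in
/-- The sides of a triangle. -/
def sides (i : T.Cell 2) : Finset (T.Cell 1) := Finset.univ.image (T.side i)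

theorem side_injective (i : T.Cell 2) : Function.Injective (T.side i) := by
  classical
  intro c c' h
  by_contra hne
  have h1 : c.1 ∈ T.verts (T.side i c').1 := by
    rw [verts_side, Finset.mem_erase]
    exact ⟨fun e => hne (Subtype.ext e), c.2⟩
  rw [← h, verts_side, Finset.mem_erase] at h1
  exact h1.1 rfl

theorem mem_sides {i : T.Cell 2} {a : T.Cell 1} : a ∈ sides i ↔ a.1 < i.1 := by
  classical
  simp only [sides, Finset.mem_image, Finset.mem_univ, true_and]
  constructor
  · rintro ⟨c, rfl⟩
    exact T.lt_of_le_of_card (side_le i c) (by rw [(T.side i c).2, i.2]; norm_num)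
  · intro h
    obtain ⟨h1, h2⟩ := T.verts_eq_insert_apex h.le (by rw [a.2, i.2])
    refine ⟨⟨T.apex i.1 a.1, by rw [h2]; simp⟩, Subtype.ext ?_⟩
    refine T.eq_of_le_of_verts (side_le i _) h.le ?_
    rw [verts_side]
    change (T.verts i.1).erase (T.apex i.1 a.1) = _
    conv_lhs => rw [h2]
    exact Finset.erase_insert h1

theorem sum_sides (i : T.Cell 2) (F : T.Cell 1 → ℝ) :
    ∑ a ∈ sides i, F a = ∑ c, F (T.side i c) := by
  classical
  exact Finset.sum_image (side_injective i).injOn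

/-- Summation over the pairs of a triangle of `M` and one of its sides, in the two possible
orders. -/
theorem IsClosedManifold.sum_sides_eq (hT : T.IsClosedManifold) (F : T.Cell 1 → T.Cell 2 → ℝ)
    (hF : ∀ (g : Γ) (a : T.Cell 1) (i : T.Cell 2), a.1 < i.1 → F (g • a) (g • i) = F a i) :
    ∑ j : T.Face 2, ∑ a ∈ sides (T.lift j), F a (T.lift j) =
      ∑ b : T.Face 1, ∑ i ∈ hT.above 2 (T.lift b).1, F (T.lift b) i := by
  choose g hg using fun a : T.Cell 1 => exists_smul_eq_lift a
  rw [Finset.sum_sigma', Finset.sum_sigma']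
  refine Finset.sum_bij (fun (x : Σ _ : T.Face 2, T.Cell 1) _ =>
    (⟨T.proj x.2, g x.2 • T.lift x.1⟩ : Σ _ : T.Face 1, T.Cell 2)) ?_ ?_ ?_ ?_
  · rintro ⟨j, a⟩ h
    simp only [Finset.mem_sigma, Finset.mem_univ, true_and] at h ⊢
    rw [hT.mem_above, ← hg, smul_cell_val, smul_cell_val, T.smul_lt_smul_iff]
    exact mem_sides.1 h
  · rintro ⟨j, a⟩ - ⟨j', a'⟩ - h
    simp only [Sigma.mk.injEq, heq_eq_eq] at h ⊢
    obtain ⟨h1, h2⟩ := h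
    have hj : j = j' := by
      have := congrArg T.proj h2
      rwa [proj_smul, proj_smul, proj_lift, proj_lift] at this
    subst hj
    have hgg : g a = g a' := by
      have h3 : ((g a')⁻¹ * g a) • (T.lift j).1 = (T.lift j).1 := by
        rw [mul_smul, inv_smul_eq_iff]
        exact congrArg Subtype.val h2
      exact (inv_mul_eq_one.1 (T.free _ _ h3)).symm
    refine ⟨rfl, MulAction.injective (g a) ?_⟩
    change g a • a = g a • a'
    rw [hg, h1, ← hg a', hgg]
  · rintro ⟨b, i⟩ h
    simp only [Finset.mem_sigma, Finset.mem_univ, true_and] at h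
    have h := hT.mem_above.1 h
    obtain ⟨k, hk⟩ := exists_smul_eq_lift i
    refine ⟨⟨T.proj i, k • T.lift b⟩, ?_, ?_⟩
    · simp only [Finset.mem_sigma, Finset.mem_univ, true_and]
      rw [mem_sides, ← hk, smul_cell_val, smul_cell_val, T.smul_lt_smul_iff]
      exact h
    · have h1 : T.proj (k • T.lift b) = b := by rw [proj_smul, proj_lift]
      have h2 : g (k • T.lift b) * k = 1 := by
        refine T.free _ (T.lift b).1 ?_
        have h3 := hg (k • T.lift b)
        rw [h1, ← mul_smul] at h3
        exact congrArg Subtype.val h3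
      simp only [Sigma.mk.injEq, heq_eq_eq]
      refine ⟨h1, ?_⟩
      rw [← hk, ← mul_smul, h2, one_smul]
  · rintro ⟨j, a⟩ h
    simp only [Finset.mem_sigma, Finset.mem_univ, true_and] at h
    change F a (T.lift j) = F (T.lift (T.proj a)) (g a • T.lift j)
    rw [← hg a, hF _ _ _ (mem_sides.1 h)]

namespace Placement

variable (R : T.Placement)

/-- The area of the parallelogram spanned by two edges of a triangle with a common vertex. -/
def doubleArea (i : T.Cell 2) : ℝ := 2 * heronArea fun c : T.verts i.1 => R.pos c

open Classical in
/-- The area factor does not depend on the ordering of the vertices of the triangle. -/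
theorem parallelogramArea_eq {i : T.Cell 2} {u v x : V} (hi : T.verts i.1 = {u, v, x}) :
    parallelogramArea (R.pos v - R.pos u) (R.pos x - R.pos u) = R.doubleArea i := by
  obtain ⟨huv, hux, hvx⟩ := triple_ne hi
  have hne : ∀ {a b : T.verts i.1}, a.1 ≠ b.1 → a ≠ b := fun h e => h (congrArg Subtype.val e)
  have h := heronArea_eq (u := (⟨u, by rw [hi]; simp⟩ : T.verts i.1)) (v := ⟨v, by rw [hi]; simp⟩)
    (x := ⟨x, by rw [hi]; simp⟩) (hne huv) (hne hux) (hne hvx) (fun c => by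
      have := (Finset.ext_iff.1 hi _).1 c.2
      simp only [Finset.mem_insert, Finset.mem_singleton] at this
      simpa only [Subtype.ext_iff] using this) fun c => R.pos c
  rw [doubleArea, h]
  ring

theorem doubleArea_smul (g : Γ) (i : T.Cell 2) : R.doubleArea (g • i) = R.doubleArea i := by
  rw [doubleArea, doubleArea, heronArea, heronArea, ← (smulVerts g i).sum_comp,
    ← (smulVerts g i).sum_comp]
  simp only [← (smulVerts g i).sum_comp]
  have h : ∀ c c' : T.verts i.1, ‖R.pos (smulVerts g i c) - R.pos (smulVerts g i c')‖ =
      ‖R.pos c - R.pos c'‖ := fun c c' => by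
    change ‖R.pos (g • c.1) - R.pos (g • c'.1)‖ = _
    rw [pos_smul_sub, LinearIsometryEquiv.norm_map]
  simp only [h]

/-- A vertex of an edge. -/
def base (a : T.Cell 1) : V := Classical.choose (T.verts_nonempty a.1)

theorem base_mem (a : T.Cell 1) : base a ∈ T.verts a.1 :=
  Classical.choose_spec (T.verts_nonempty a.1)

/-- The component of a vector along the deviation of an edge does not depend on which point of the
edge the vector starts from. -/
theorem inner_sub_eq {w : T.Cell 1 → E4} (hw : w ∈ R.edgeDeviations) {a : T.Cell 1} {z z' : V}
    (hz : z ∈ T.verts a.1) (hz' : z' ∈ T.verts a.1) (p : E4) :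
    inner ℝ (p - R.pos z) (w a) = inner ℝ (p - R.pos z') (w a) := by
  have h := hw.1 a z hz z' hz'
  rw [real_inner_comm, inner_sub_left] at h
  rw [inner_sub_left, inner_sub_left]
  linarith

/-- The differential of the area of a triangle, as a sum over its sides. -/
theorem edgeToArea_apply (hT : T.IsClosedManifold) (w : R.edgeDeviations) (j : T.Face 2) :
    R.edgeToArea w j = -∑ a ∈ sides (T.lift j), R.sqLength (T.proj a) *
      inner ℝ (R.pos (T.apex (T.lift j).1 a.1) - R.pos (base a)) (w.1 a) /
        R.doubleArea (T.lift j) := by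
  classical
  obtain ⟨u, v, x, hi⟩ := exists_verts_eq_triple (T.lift j)
  obtain ⟨huv, hux, hvx⟩ := triple_ne hi
  obtain ⟨U, hU⟩ : ∃ c : T.verts (T.lift j).1, c.1 = u := ⟨⟨u, by rw [hi]; simp⟩, rfl⟩
  obtain ⟨Y, hY⟩ : ∃ c : T.verts (T.lift j).1, c.1 = v := ⟨⟨v, by rw [hi]; simp⟩, rfl⟩
  obtain ⟨X, hX⟩ : ∃ c : T.verts (T.lift j).1, c.1 = x := ⟨⟨x, by rw [hi]; simp⟩, rfl⟩
  obtain ⟨F, hF, hFw⟩ := R.exists_hasFDerivAt_deviatedArea hT hi U Y X hU hY hX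
  have sU : T.verts (T.side (T.lift j) U).1 = {v, x} := by
    rw [verts_side, hU, hi, Finset.erase_insert (by simp [huv, hux])]
  have sY : T.verts (T.side (T.lift j) Y).1 = {u, x} := by
    rw [verts_side, hY, hi, Finset.insert_comm,
      Finset.erase_insert (by simp [huv.symm, hvx])]
  have sX : T.verts (T.side (T.lift j) X).1 = {u, v} := by
    rw [verts_side, hX, hi,
      show ({u, v, x} : Finset V) = {x, u, v} by ext; simp; tauto,
      Finset.erase_insert (by simp [hux.symm, hvx.symm])]
  have hval : R.edgeToArea w j = fderiv ℝ (R.deviatedArea (T.lift j)) 0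
      (fun c => w.1 (T.side (T.lift j) c)) := rfl
  have hmem := w.2.1
  have hne : ∀ {a b : T.verts (T.lift j).1}, a.1 ≠ b.1 → a ≠ b :=
    fun h e => h (congrArg Subtype.val e)
  have hun : (Finset.univ : Finset (T.verts (T.lift j).1)) = {U, Y, X} := by
    ext c
    have := (Finset.ext_iff.1 hi _).1 c.2
    simp only [Finset.mem_insert, Finset.mem_singleton] at this
    simpa only [Finset.mem_univ, Finset.mem_insert, Finset.mem_singleton, true_iff,
      Subtype.ext_iff, hU, hY, hX] using this
  have hap : ∀ c : T.verts (T.lift j).1, T.apex (T.lift j).1 (T.side (T.lift j) c).1 = c.1 :=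
    fun c => T.apex_eq (by rw [verts_side]; simp) (by
      rw [verts_side, Finset.insert_erase c.2])
  rw [hval, hF.fderiv, hFw _ (hmem _ v (by rw [sU]; simp) x (by rw [sU]; simp))
    (hmem _ u (by rw [sY]; simp) x (by rw [sY]; simp))
    (hmem _ u (by rw [sX]; simp) v (by rw [sX]; simp)), sum_sides, hun,
    Finset.sum_insert (by simp [hne (a := U) (b := Y) (by rwa [hU, hY]),
      hne (a := U) (b := X) (by rwa [hU, hX])]), Finset.sum_pair (hne (by rwa [hY, hX])),
    hap, hap, hap, R.sqLength_proj _ sU, R.sqLength_proj _ sY, R.sqLength_proj _ sX,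
    R.inner_sub_eq w.2 (base_mem _) (z' := v) (by rw [sU]; simp),
    R.inner_sub_eq w.2 (base_mem _) (z' := u) (by rw [sY]; simp),
    R.inner_sub_eq w.2 (base_mem _) (z' := u) (by rw [sX]; simp), hU, hY, hX,
    R.parallelogramArea_eq hi, norm_sub_rev (R.pos v) (R.pos x), norm_sub_rev (R.pos u) (R.pos x),
    norm_sub_rev (R.pos u) (R.pos v)]
  ring

/-- For each edge, the differentials of the deficit angles at the triangles containing it satisfy
a vector relation. -/
theorem sum_lengthToDeficit_mul (hT : T.IsClosedManifold) (o : T.Orientation) (d : T.Face 1 → ℝ)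
    {w : T.Cell 1 → E4} (hw : w ∈ R.edgeDeviations) (a : T.Cell 1) :
    ∑ i ∈ hT.above 2 a.1, R.lengthToDeficit o d (T.proj i) / R.doubleArea i *
      inner ℝ (R.pos (T.apex i.1 a.1) - R.pos (base a)) (w a) = 0 := by
  classical
  obtain ⟨D⟩ := R.exists_localFields hT d
  obtain ⟨u, v, huv, ha⟩ := exists_verts_eq_pair a
  have hu : u ∈ T.verts a.1 := by rw [ha]; simp
  have hv : v ∈ T.verts a.1 := by rw [ha]; simp
  have hl : R.pos v - R.pos u ≠ 0 := by
    rw [sub_ne_zero]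
    intro e
    exact huv (congrArg Subtype.val ((R.affineIndependent hT a.1).injective
      (a₁ := ⟨v, hv⟩) (a₂ := ⟨u, hu⟩) e)).symm
  have hin : ∀ i ∈ hT.above 2 a.1, T.verts i.1 = {u, v, T.apex i.1 a.1} := fun i hi => by
    have := (T.verts_eq_insert_apex (hT.mem_above.1 hi).le (by rw [a.2, i.2])).2
    rw [this, ha]
    ext z
    simp only [Finset.mem_insert, Finset.mem_singleton]
    tauto
  have key := inner_eq_zero_of_vol_eq_zero hl (v := ∑ i ∈ hT.above 2 a.1,
    (R.lengthToDeficit o d (T.proj i) / R.doubleArea i) • (R.pos (T.apex i.1 a.1) - R.pos u))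
    (w := w a) (fun y z => ?_) ?_
  · rw [sum_inner] at key
    rw [← key]
    refine Finset.sum_congr rfl fun i _ => ?_
    rw [inner_smul_left, R.inner_sub_eq hw (base_mem a) hu, RCLike.conj_to_real]
  · have h1 : ∀ b : E4, vol (R.pos v - R.pos u) b y z = volLast y z (R.pos v - R.pos u) b :=
      fun b => by
        rw [volLast_apply]
        simp only [vol_eq]
        ring
    rw [h1, map_sum]
    have h2 : ∀ i ∈ hT.above 2 a.1, volLast y z (R.pos v - R.pos u)
        ((R.lengthToDeficit o d (T.proj i) / R.doubleArea i) •
          (R.pos (T.apex i.1 a.1) - R.pos u)) =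
        inner ℝ ((D.jumpSum hT o u v (T.apex i.1 a.1) i.1).1.linear y) z := fun i hi => by
      rw [map_smul, ← h1, D.inner_jumpSum hT o (hin i hi), R.parallelogramArea_eq (hin i hi),
        smul_eq_mul]
    have h3 : ∀ ξ : motions, inner ℝ (ξ.1.linear y) z = inner ℝ z (motionEval y ξ) -
        inner ℝ z (motionEval 0 ξ) := fun ξ => by
      rw [real_inner_comm, ← inner_sub_right, motionEval_apply, motionEval_apply, affineMap_sub,
        sub_zero]
    rw [Finset.sum_congr rfl h2]
    simp only [h3]
    rw [Finset.sum_sub_distrib, ← inner_sum, ← inner_sum, ← map_sum, ← map_sum, D.sum_jumpSum hT o,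
      map_zero, map_zero, sub_self]
  · rw [real_inner_comm]
    exact hw.1 a u hu v hv

/-- Area differentials generated by edge deviations are orthogonal to all differentials of the
deficit angles. -/
theorem dotProduct_lengthToDeficit (hT : T.IsClosedManifold) (o : T.Orientation)
    (w : R.edgeDeviations) (d : T.Face 1 → ℝ) :
    R.edgeToArea w ⬝ᵥ R.lengthToDeficit o d = 0 := by
  let F : T.Cell 1 → T.Cell 2 → ℝ := fun a i => R.sqLength (T.proj a) *
    inner ℝ (R.pos (T.apex i.1 a.1) - R.pos (base a)) (w.1 a) / R.doubleArea i *
      R.lengthToDeficit o d (T.proj i)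
  have hF : ∀ (g : Γ) (a : T.Cell 1) (i : T.Cell 2), a.1 < i.1 → F (g • a) (g • i) = F a i :=
    fun g a i h => by
      have h1 : g • base a ∈ T.verts (g • a).1 := (T.smul_mem_verts g a.1 _).2 (base_mem a)
      simp only [F]
      rw [proj_smul, proj_smul, R.doubleArea_smul, R.inner_sub_eq w.2 (base_mem _) h1, w.2.2,
        smul_cell_val, smul_cell_val, apex_smul h.le (by rw [a.2, i.2]), pos_smul_sub,
        LinearIsometryEquiv.inner_map_map]
  have h1 : R.edgeToArea w ⬝ᵥ R.lengthToDeficit o d =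
      -∑ j : T.Face 2, ∑ a ∈ sides (T.lift j), F a (T.lift j) := by
    rw [dotProduct, ← Finset.sum_neg_distrib]
    refine Finset.sum_congr rfl fun j _ => ?_
    rw [R.edgeToArea_apply hT, neg_mul, Finset.sum_mul]
    simp only [F, proj_lift]
  rw [h1, hT.sum_sides_eq F hF, neg_eq_zero]
  refine Finset.sum_eq_zero fun b _ => ?_
  have h2 : ∀ i, F (T.lift b) i = R.sqLength (T.proj (T.lift b)) *
      (R.lengthToDeficit o d (T.proj i) / R.doubleArea i *
        inner ℝ (R.pos (T.apex i.1 (T.lift b).1) - R.pos (base (T.lift b))) (w.1 (T.lift b))) :=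
    fun i => by
      simp only [F]
      ring
  simp only [h2]
  rw [← Finset.mul_sum, R.sum_lengthToDeficit_mul hT o d w.2, mul_zero]

theorem areaToDual_dotProduct (o : T.Orientation) (y : T.Face 2 → ℝ) (d : T.Face 1 → ℝ) :
    R.areaToDual o y ⬝ᵥ d = y ⬝ᵥ R.lengthToDeficit o d := by
  classical
  rw [areaToDual, Matrix.mulVecLin_apply, Matrix.mulVec_transpose, ← Matrix.dotProduct_mulVec]
  congr 1
  conv_rhs => rw [← Matrix.toLin'_toMatrix' (R.lengthToDeficit o), Matrix.toLin'_apply]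

theorem areaToDual_comp_edgeToArea (hT : T.IsClosedManifold) (o : T.Orientation) :
    R.areaToDual o ∘ₗ R.edgeToArea = 0 :=
  LinearMap.ext fun w => dotProduct_eq_zero _ fun d => by
    rw [LinearMap.comp_apply, areaToDual_dotProduct, R.dotProduct_lengthToDeficit hT]

theorem columnTranspose_comp_lengthToDeficit (hT : T.IsClosedManifold) (o : T.Orientation) :
    columnTranspose R.edgeToArea ∘ₗ R.lengthToDeficit o = 0 :=
  LinearMap.ext fun d => LinearMap.ext fun w => by
    change R.lengthToDeficit o d ⬝ᵥ R.edgeToArea w = 0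
    rw [dotProduct_comm, R.dotProduct_lengthToDeficit hT]

end Placement

end Triangulation

/-! ### Flat deformations of the edge lengths -/

namespace Triangulation

variable {T : Triangulation Γ V P}

/-- The numbers of tetrahedra and of 4-simplices around a triangle are equal. -/
theorem card_above_three_eq (hT : T.IsClosedManifold) (i : T.Cell 2) :
    (hT.above 3 i.1).card = (hT.above 4 i.1).card := by
  classical
  have h := hT.sum_above_above (j := 3) (k := 4) i.1 fun _ _ => 1
  have h1 : ∀ f ∈ hT.above 3 i.1, ∑ s ∈ hT.above 4 f.1, 1 = 2 := fun f _ => by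
    obtain ⟨s, t, hst, h⟩ := hT.exists_above_eq f
    rw [h, Finset.sum_pair hst]
  have h2 : ∀ s ∈ hT.above 4 i.1, ∑ f ∈ hT.between 3 i.1 s.1, 1 = 2 := fun s hs => by
    obtain ⟨j, k, f, g, -, -, -, -, hfg, -, -, -, -, h⟩ :=
      hT.exists_between_eq (hT.mem_above.1 hs).le i.2 s.2
    rw [h, Finset.sum_pair hfg]
  rw [Finset.sum_congr rfl h1, Finset.sum_congr rfl h2, Finset.sum_const, Finset.sum_const] at h
  simpa using h

namespace Placement

variable (R : T.Placement) {G : Submodule ℝ (Γ → E4 →ᵃ[ℝ] E4)}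

theorem rot_mul (g h : Γ) (x : E4) : R.rot (g * h) x = R.rot g (R.rot h x) := by
  have h1 : ∀ y, R.rep (g * h) y = R.rep g (R.rep h y) := fun y => by
    rw [map_mul]
    rfl
  rw [← sub_zero x, ← rep_sub, ← rep_sub, ← rep_sub, h1, h1]

theorem rep_pos (g : Γ) (v : V) : R.rep g (R.pos v) = R.pos (g • v) := (R.equivariant g v).symm

namespace LocalFields

variable {R} {d : T.Face 1 → ℝ} (D : R.LocalFields d)

theorem jumpSum_eq_zero (hT : T.IsClosedManifold) (o : T.Orientation)
    (hd : R.lengthToDeficit o d = 0) {u v x : V} {i : T.Cell 2}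
    (hu : u ∈ T.verts i.1) (hi : ∀ w, w ∈ T.verts i.1 ↔ w = u ∨ w = v ∨ w = x) :
    D.jumpSum hT o u v x i.1 = 0 := by
  classical
  have hi' : T.verts i.1 = {u, v, x} := by
    ext w
    simp [hi]
  refine Subtype.ext (AffineMap.ext fun y => ?_)
  have h1 := affineMap_sub (D.jumpSum hT o u v x i.1).1 y (R.pos u)
  rw [D.jumpSum_apply_pos hT o hi' hu, sub_zero] at h1
  rw [h1]
  refine ext_inner_right ℝ fun z => ?_
  rw [D.inner_jumpSum hT o hi', hd, Pi.zero_apply, zero_div, zero_mul]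
  exact (inner_zero_left _).symm

/-- If the deficit angle at a triangle does not change, the jumps around the triangle can be
removed by infinitesimal motions of the 4-simplices. -/
theorem exists_hasJumps_triangle (hT : T.IsClosedManifold) (o : T.Orientation)
    (hd : R.lengthToDeficit o d = 0) (i : T.Cell 2) :
    ∃ ξ : T.Cell 4 → motions, HasJumps D.m (Set.Ici i.1) ξ := by
  classical
  obtain ⟨u, v, x, hi⟩ := exists_verts_eq_triple i
  have hjump := D.jumpSum_eq_zero hT o hd (u := u) (v := v) (x := x) (i := i)
    (by rw [hi]; simp) (fun w => by rw [hi]; simp)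
  let ε : hT.above 3 i.1 → hT.above 4 i.1 → ℝ := fun f s =>
    if f.1.1 < s.1.1 then R.flagSign o u v x i.1 f.1 s.1 else 0
  have hsum : ∀ (f : hT.above 3 i.1) (η : T.Cell 4 → motions),
      ∑ s, ε f s • η s.1 = ∑ s ∈ hT.above 4 f.1.1, R.flagSign o u v x i.1 f.1 s • η s := by
    intro f η
    have hf := hT.mem_above.1 f.2
    have h1 : ∀ s, ε f s • η s.1 = (fun s : T.Cell 4 => if f.1.1 < s.1 then
        R.flagSign o u v x i.1 f.1 s • η s else 0) s.1 := fun s => by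
      simp only [ε, ite_smul, zero_smul]
    simp only [h1]
    rw [Finset.sum_coe_sort (hT.above 4 i.1) (fun s : T.Cell 4 => if f.1.1 < s.1 then
        R.flagSign o u v x i.1 f.1 s • η s else 0), ← Finset.sum_filter]
    refine Finset.sum_congr ?_ fun _ _ => rfl
    ext s
    rw [Finset.mem_filter, hT.mem_above, hT.mem_above]
    exact ⟨fun h => h.2, fun h => ⟨hf.trans h, h⟩⟩
  have hpair : ∀ (f : hT.above 3 i.1) (η : T.Cell 4 → motions),
      ∑ s ∈ hT.above 4 f.1.1, R.flagSign o u v x i.1 f.1 s • η s = 0 →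
      ∀ s t : T.Cell 4, f.1.1 < s.1 → f.1.1 < t.1 → η s = η t := by
    intro f η h s t hs ht
    obtain ⟨p, q, hpq, hab⟩ := hT.exists_above_eq f.1
    obtain ⟨hc, hne⟩ := R.flagSign_coherent o hi (hT.mem_above.1 f.2).le hpq
      (hT.mem_above.1 (by rw [hab]; simp)) (hT.mem_above.1 (by rw [hab]; simp))
    rw [hab, Finset.sum_pair hpq, hc, neg_smul, neg_add_eq_sub, ← smul_sub, smul_eq_zero,
      or_iff_right hne, sub_eq_zero] at h
    have hs' := hT.mem_above.2 hs
    have ht' := hT.mem_above.2 ht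
    rw [hab, Finset.mem_insert, Finset.mem_singleton] at hs' ht'
    rcases hs' with rfl | rfl <;> rcases ht' with rfl | rfl <;> simp [h]
  obtain ⟨ξ, hξ⟩ := exists_coboundary ε
    (by rw [Fintype.card_coe, Fintype.card_coe, card_above_three_eq])
    -- the two tetrahedra between the triangle and a 4-simplex have opposite signs
    (fun s => by
      have hs := hT.mem_above.1 s.2
      rw [← R.sum_between_flagSign hT o u v x hs]
      have h1 : ∀ f : hT.above 3 i.1, ε f s = (fun f : T.Cell 3 => if f.1 < s.1.1 then
          R.flagSign o u v x i.1 f s.1 else 0) f.1 := fun f => rfl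
      simp only [h1]
      rw [Finset.sum_coe_sort (hT.above 3 i.1) (fun f : T.Cell 3 => if f.1 < s.1.1 then
          R.flagSign o u v x i.1 f s.1 else 0), ← Finset.sum_filter]
      refine Finset.sum_congr ?_ fun _ _ => rfl
      ext f
      rw [Finset.mem_filter, hT.mem_above, hT.mem_between])
    -- a solution of the homogeneous equation is constant, since the star is strongly connected
    (fun ξ h => by
      let η : T.Cell 4 → motions := fun s => if hs : s ∈ hT.above 4 i.1 then ξ ⟨s, hs⟩ else 0
      have hη : ∀ s : hT.above 4 i.1, η s.1 = ξ s := fun s => dif_pos s.2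
      have hadj : ∀ s t, Adjacent (Set.Ici i.1) s t → η s = η t := by
        rintro s t ⟨f, hf, hs, ht⟩
        have hf' : f ∈ hT.above 3 i.1 :=
          hT.mem_above.2 (T.lt_of_le_of_card hf (by rw [i.2, f.2]; norm_num))
        refine hpair ⟨f, hf'⟩ η ?_ s t hs ht
        rw [← hsum, ← h ⟨f, hf'⟩]
        exact Finset.sum_congr rfl fun s _ => by rw [hη]
      intro s t
      rw [← hη s, ← hη t]
      obtain ⟨t, ht⟩ := t
      induction star_connected hT i.1 s.1 t (hT.mem_above.1 s.2).le
        (hT.mem_above.1 ht).le with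
      | refl => rfl
      | @tail r t' _ h ih =>
        refine (ih (hT.mem_above.2 ?_)).trans (hadj _ _ h)
        obtain ⟨f, hf, hr, -⟩ := h
        exact lt_of_le_of_lt hf hr)
    (fun f => -∑ s ∈ hT.above 4 f.1.1, R.flagSign o u v x i.1 f.1 s • D.m f.1 s)
    (by
      rw [Finset.sum_neg_distrib, neg_eq_zero, Finset.sum_coe_sort (hT.above 3 i.1) (fun f =>
        ∑ s ∈ hT.above 4 f.1, R.flagSign o u v x i.1 f s • D.m f s)]
      exact hjump)
  let η : T.Cell 4 → motions := fun s => if hs : s ∈ hT.above 4 i.1 then ξ ⟨s, hs⟩ else 0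
  have hη : ∀ s : hT.above 4 i.1, η s.1 = ξ s := fun s => dif_pos s.2
  refine ⟨η, fun f s t hf hs ht => ?_⟩
  have hf' : f ∈ hT.above 3 i.1 :=
    hT.mem_above.2 (T.lt_of_le_of_card hf (by rw [i.2, f.2]; norm_num))
  refine hpair ⟨f, hf'⟩ (fun s => η s + D.m f s) ?_ s t hs ht
  simp only [smul_add]
  rw [Finset.sum_add_distrib, ← hsum ⟨f, hf'⟩, ← eq_neg_iff_add_eq_zero, ← hξ ⟨f, hf'⟩]
  exact Finset.sum_congr rfl fun s _ => by rw [hη]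

end LocalFields

open Classical in
/-- A deformation of the edge lengths that does not change the deficit angles comes from
displacements of the vertices of the covering. -/
theorem exists_displacement (hT : T.IsClosedManifold) (o : T.Orientation) {d : T.Face 1 → ℝ}
    (hd : R.lengthToDeficit o d = 0) : ∃ y : V → E4, ∀ (a : T.Cell 1) (u w : V),
      T.verts a.1 = {u, w} → d (T.proj a) = 2 * inner ℝ (R.pos u - R.pos w) (y u - y w) := by
  obtain ⟨D⟩ := R.exists_localFields hT d
  obtain ⟨ξ, hξ⟩ := exists_hasJumps hT (D.exists_hasJumps_triangle hT o hd)
  let Y : T.Cell 4 → V → E4 := fun s v => (ξ s).1 (R.pos v) + D.A s (R.pos v)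
  have hadj : ∀ (f : T.Cell 3) (s t : T.Cell 4), f.1 < s.1 → f.1 < t.1 → ∀ v ∈ T.verts f.1,
      Y s v = Y t v := fun f s t hs ht v hv => by
    have h1 := congrArg (motionEval (R.pos v)) (hξ f s t (Set.mem_univ _) hs ht)
    simp only [map_add, motionEval_apply] at h1
    rw [D.m_apply f s hs v hv, D.m_apply f t ht v hv, ← add_sub_assoc, ← add_sub_assoc,
      sub_left_inj] at h1
    exact h1
  have hwell : ∀ (v : V) (s t : T.Cell 4), v ∈ T.verts s.1 → v ∈ T.verts t.1 →
      Y s v = Y t v := by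
    intro v s t hs ht
    obtain ⟨p, hp, huniq⟩ := T.existsUnique_vertex v
    have hle : ∀ r : T.Cell 4, v ∈ T.verts r.1 → p ≤ r.1 := fun r hr => by
      obtain ⟨q, ⟨hq, hq'⟩, -⟩ := T.existsUnique_face r.1 {v} (by simpa using hr) (by simp)
      rwa [← huniq q hq']
    induction star_connected hT p s t (hle s hs) (hle t ht) with
    | refl => rfl
    | @tail r t' hst h ih =>
      obtain ⟨f, hf, hfr, hft⟩ := h
      have hv : v ∈ T.verts f.1 := T.verts_mono _ _ hf (by rw [hp]; simp)
      exact (ih (T.verts_mono _ _ hfr.le hv)).trans (hadj f _ _ hfr hft v hv)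
  -- the corrected fields `A s + ξ s` agree at a vertex for all 4-simplices containing it
  choose S hS using exists_cell_four hT
  refine ⟨fun v => Y (S v) v, fun a u w ha => ?_⟩
  obtain ⟨s, hs⟩ := hT.pure a.1
  have hu : u ∈ T.verts s.1 := T.verts_mono _ _ hs (by rw [ha]; simp)
  have hw : w ∈ T.verts s.1 := T.verts_mono _ _ hs (by rw [ha]; simp)
  have huw : u ≠ w := by
    rintro rfl
    have := a.2
    rw [ha] at this
    simp at this
  have hne : (⟨u, hu⟩ : T.verts s.1) ≠ ⟨w, hw⟩ := fun e => huw (Subtype.mk.inj e)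
  have he : T.edge s ⟨u, hu⟩ ⟨w, hw⟩ hne = a :=
    Subtype.ext (T.eq_of_le_of_verts (T.edge_le s _ _ hne) hs (by rw [T.verts_edge, ha]))
  have h1 := D.inner_A s ⟨u, hu⟩ ⟨w, hw⟩
  rw [sqDist, dif_neg hne, he] at h1
  beta_reduce
  rw [hwell u (S u) s (hS u) hu, hwell w (S w) s (hS w) hw]
  simp only [Y]
  rw [add_sub_add_comm, inner_add_right, inner_motion_sub (ξ s).2, ← map_sub, h1]
  ring

/-- Displacements of the vertices that change the edge lengths invariantly are equivariant with
respect to a deformation of the representation. -/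
theorem exists_deformation (hT : T.IsClosedManifold) {d : T.Face 1 → ℝ} {y : V → E4}
    (hy : ∀ (a : T.Cell 1), ∀ u ∈ T.verts a.1, ∀ w ∈ T.verts a.1, u ≠ w →
      d (T.proj a) = 2 * inner ℝ (R.pos u - R.pos w) (y u - y w)) :
    ∃ c ∈ R.deformations, ∀ (g : Γ) (v : V),
      y (g • v) = R.rot g (y v) + c g (R.pos (g • v)) := by
  have hg : ∀ g : Γ, ∃ c ∈ motions, ∀ v : V, y v - R.rot g (y (g⁻¹ • v)) = c (R.pos v) := by
    intro g
    refine R.exists_motion_eq_pos hT (x := fun v => y v - R.rot g (y (g⁻¹ • v)))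
      fun a u hu w hw => ?_
    by_cases huw : u = w
    · subst huw; simp
    have h1 := hy a u hu w hw huw
    have h2 := hy (g⁻¹ • a) (g⁻¹ • u) ((T.smul_mem_verts _ _ _).2 hu) (g⁻¹ • w)
      ((T.smul_mem_verts _ _ _).2 hw) ((MulAction.injective _).ne huw)
    rw [proj_smul] at h2
    have h3 : inner ℝ (R.pos u - R.pos w) (R.rot g (y (g⁻¹ • u)) - R.rot g (y (g⁻¹ • w))) =
        inner ℝ (R.pos (g⁻¹ • u) - R.pos (g⁻¹ • w)) (y (g⁻¹ • u) - y (g⁻¹ • w)) := by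
      conv_lhs => rw [← smul_inv_smul g u, ← smul_inv_smul g w, pos_smul_sub, inv_smul_smul,
        inv_smul_smul, ← map_sub, LinearIsometryEquiv.inner_map_map]
    rw [sub_sub_sub_comm, inner_sub_right, h3]
    linarith
  choose c hc hcy using hg
  have hcy' : ∀ (g : Γ) (v : V), c g (R.pos (g • v)) = y (g • v) - R.rot g (y v) := fun g v => by
    rw [← hcy, inv_smul_smul]
  refine ⟨c, ⟨hc, fun g h x => ?_⟩, fun g v => by rw [hcy']; abel⟩
  have key : c (g * h) = c g + R.transport g (c h) := by
    refine R.motion_ext_pos hT (hc _) (motions.add_mem (hc g) (R.transport_mem g (hc h)))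
      fun v => ?_
    obtain ⟨v, rfl⟩ := MulAction.surjective (g * h) v
    beta_reduce
    rw [hcy', AffineMap.coe_add, Pi.add_apply, mul_smul, hcy', ← rep_pos, transport_rep, hcy',
      map_sub, rot_mul]
    abel
  rw [key, AffineMap.coe_add, Pi.add_apply, transport_rep]

/-- Every deformation of the edge lengths that preserves the deficit angles comes from `(dx)` and
`(dg)`. -/
theorem exact_positionToLength (hT : T.IsClosedManifold) (o : T.Orientation)
    (hG : R.IsParameterSpace G) :
    Function.Exact (R.positionToLength G) (R.lengthToDeficit o) := by
  classical
  intro d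
  refine ⟨fun hd => ?_, ?_⟩
  · obtain ⟨y, hy⟩ := R.exists_displacement hT o hd
    obtain ⟨c, hc, hyc⟩ := R.exists_deformation hT (d := d) (y := y) fun a u hu w hw huw => by
      refine hy a u w ?_
      symm
      refine Finset.eq_of_subset_of_card_le ?_ ?_
      · intro z hz
        rcases Finset.mem_insert.1 hz with rfl | hz
        · exact hu
        · rwa [Finset.mem_singleton.1 hz]
      · rw [a.2, Finset.card_pair huw]
    rw [← hG.2] at hc
    obtain ⟨c₁, h₁, c₂, ⟨η, hη, h₂⟩, rfl⟩ := Submodule.mem_sup.1 hc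
    -- the conjugating motion is subtracted from the displacements
    refine ⟨⟨(fun v => y v - η (R.pos v), c₁), h₁, fun g v => ?_⟩, funext fun j => ?_⟩
    · have h3 := h₂ g (R.pos v)
      rw [rep_pos] at h3
      simp only [hyc, Pi.add_apply, AffineMap.coe_add, h3, map_sub]
      abel
    · obtain ⟨u, w, -, ha⟩ := exists_verts_eq_pair (T.lift j)
      rw [← proj_lift j, R.positionToLength_proj hG _ _ ha, hy _ _ _ ha]
      simp only
      rw [sub_sub_sub_comm, inner_sub_right, inner_motion_sub hη, sub_zero]
  · rintro ⟨y, rfl⟩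
    exact congrArg (fun F => F y) (R.lengthToDeficit_comp_positionToLength hT o hG)

end Placement

end Triangulation

/-! ### Transposition of exact sequences -/

section Transpose

variable {U W ι : Type*} [AddCommGroup U] [Module ℝ U] [AddCommGroup W] [Module ℝ W] [Fintype ι]

theorem columnTranspose_apply (φ : W →ₗ[ℝ] (ι → ℝ)) (y : ι → ℝ) (w : W) :
    columnTranspose φ y w = y ⬝ᵥ φ w := rfl

/-- A functional that vanishes on the kernel of a map to columns factors through this map. -/
theorem exists_dotProduct_eq (φ : W →ₗ[ℝ] (ι → ℝ)) (f : Module.Dual ℝ W)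
    (h : ∀ w, φ w = 0 → f w = 0) : ∃ t : ι → ℝ, ∀ w, t ⬝ᵥ φ w = f w := by
  classical
  have h1 : f ∈ LinearMap.range φ.dualMap := by
    rw [LinearMap.range_dualMap_eq_dualAnnihilator_ker, Submodule.mem_dualAnnihilator]
    exact fun w hw => h w hw
  obtain ⟨ψ, rfl⟩ := h1
  refine ⟨fun a => ψ (Pi.single a 1), fun w => ?_⟩
  rw [LinearMap.dualMap_apply]
  conv_rhs => rw [← (Pi.basisFun ℝ ι).sum_repr (φ w), map_sum]
  refine Finset.sum_congr rfl fun a _ => ?_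
  rw [map_smul, Pi.basisFun_repr, Pi.basisFun_apply, smul_eq_mul, mul_comm]

theorem exact_columnTranspose_dualMap {α : U →ₗ[ℝ] W} {φ : W →ₗ[ℝ] (ι → ℝ)}
    (h : Function.Exact α φ) : Function.Exact (columnTranspose φ) α.dualMap := by
  intro f
  constructor
  · intro hf
    obtain ⟨t, ht⟩ := exists_dotProduct_eq φ f fun w hw => by
      obtain ⟨u, rfl⟩ := (h w).1 hw
      exact congrArg (fun F => F u) hf
    exact ⟨t, LinearMap.ext ht⟩
  · rintro ⟨t, rfl⟩
    refine LinearMap.ext fun u => ?_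
    rw [LinearMap.dualMap_apply, columnTranspose_apply, h.apply_apply_eq_zero, dotProduct_zero]
    rfl

end Transpose

namespace Triangulation.Placement

variable {T : Triangulation Γ V P} (R : T.Placement) {G : Submodule ℝ (Γ → E4 →ᵃ[ℝ] E4)}

theorem exact_areaToDual (hT : T.IsClosedManifold) (o : T.Orientation)
    (hG : R.IsParameterSpace G) :
    Function.Exact (R.areaToDual o) (columnTranspose (R.positionToLength G)) := by
  have h := R.exact_positionToLength hT o hG
  intro z
  constructor
  · intro hz
    obtain ⟨t, ht⟩ := exists_dotProduct_eq (R.lengthToDeficit o) (dotProductBilin ℝ ℝ z)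
      fun d hd => by
        obtain ⟨y, rfl⟩ := (h d).1 hd
        exact congrArg (fun F => F y) hz
    refine ⟨t, sub_eq_zero.1 (dotProduct_eq_zero _ fun d => ?_)⟩
    rw [sub_dotProduct, areaToDual_dotProduct, ht]
    exact sub_self _
  · rintro ⟨t, rfl⟩
    refine LinearMap.ext fun y => ?_
    rw [columnTranspose_apply, areaToDual_dotProduct, h.apply_apply_eq_zero, dotProduct_zero]
    rfl

end Triangulation.Placement

theorem dualMap_comp_dualMap_eq_zero {U W X : Type*} [AddCommGroup U] [Module ℝ U]
    [AddCommGroup W] [Module ℝ W] [AddCommGroup X] [Module ℝ X] {α : U →ₗ[ℝ] W} {β : W →ₗ[ℝ] X}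
    (h : β ∘ₗ α = 0) : α.dualMap ∘ₗ β.dualMap = 0 := by
  refine LinearMap.ext fun f => LinearMap.ext fun x => ?_
  change f ((β ∘ₗ α) x) = 0
  rw [h, LinearMap.zero_apply, map_zero]

end

end EuclComplex

open EuclComplex
theorem mainTheorem2 {Γ V P : Type*} [Group Γ] [MulAction Γ V] [PartialOrder P] [MulAction Γ P]
    (T : Triangulation Γ V P) (hT : T.IsClosedManifold) (o : T.Orientation) (R : T.Placement)
    (G : Submodule ℝ (Γ → E4 →ᵃ[ℝ] E4)) (hG : R.IsParameterSpace G) :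
    -- the differentiated functions are differentiable
    DifferentiableAt ℝ (R.deficit o) R.sqLength ∧
    (∀ i : T.Cell 2, DifferentiableAt ℝ (R.deviatedArea i) 0) ∧
    -- compositions in `(dσ)₀ → (dσ) → (dv_a) → (dS_i) → (dΩ_a) → (⋯) → (⋯) → 0`
    R.vertexToEdge ∘ₗ R.trivialToVertex = 0 ∧
    R.edgeToArea ∘ₗ R.vertexToEdge = 0 ∧
    R.areaToDual o ∘ₗ R.edgeToArea = 0 ∧
    columnTranspose (R.positionToLength G) ∘ₗ R.areaToDual o = 0 ∧
    (R.motionToPosition G).dualMap ∘ₗ columnTranspose (R.positionToLength G) = 0 ∧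
    -- compositions in `0 → 𝔞 → (dx and dg) → (dL_a) → (dω_i) → (⋯) → (⋯) → (⋯) → 0`
    R.positionToLength G ∘ₗ R.motionToPosition G = 0 ∧
    R.lengthToDeficit o ∘ₗ R.positionToLength G = 0 ∧
    columnTranspose R.edgeToArea ∘ₗ R.lengthToDeficit o = 0 ∧
    R.vertexToEdge.dualMap ∘ₗ columnTranspose R.edgeToArea = 0 ∧
    R.trivialToVertex.dualMap ∘ₗ R.vertexToEdge.dualMap = 0 ∧
    -- exactness of the first sequence at `(dσ)₀` and at its last three terms
    Function.Injective R.trivialToVertex ∧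
    Function.Exact (R.areaToDual o) (columnTranspose (R.positionToLength G)) ∧
    Function.Exact (columnTranspose (R.positionToLength G)) (R.motionToPosition G).dualMap ∧
    Function.Surjective (R.motionToPosition G).dualMap ∧
    -- exactness of the second sequence at its first three terms and at its last term
    Function.Injective (R.motionToPosition G) ∧
    Function.Exact (R.motionToPosition G) (R.positionToLength G) ∧
    Function.Exact (R.positionToLength G) (R.lengthToDeficit o) ∧
    Function.Surjective R.trivialToVertex.dualMap := by
  have hσ := R.vertexToEdge_comp_trivialToVertex hT
  have hv := R.edgeToArea_comp_vertexToEdge hT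
  have hMP := R.exact_motionToPosition hT hG
  have hdual := exact_columnTranspose_dualMap hMP
  have hAD := R.exact_areaToDual hT o hG
  have hinjσ := R.injective_trivialToVertex hT
  have hinj : Function.Injective (R.motionToPosition G) := R.injective_motionToPosition hT
  exact ⟨R.differentiableAt_deficit o hT, R.differentiableAt_deviatedArea hT, hσ, hv,
    R.areaToDual_comp_edgeToArea hT o, hAD.linearMap_comp_eq_zero, hdual.linearMap_comp_eq_zero,
    R.positionToLength_comp_motionToPosition hG,
    R.lengthToDeficit_comp_positionToLength hT o hG, R.columnTranspose_comp_lengthToDeficit hT o,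
    LinearMap.ext fun y => LinearMap.ext fun σ => by
      change y ⬝ᵥ (R.edgeToArea ∘ₗ R.vertexToEdge) σ = 0
      rw [hv, LinearMap.zero_apply, dotProduct_zero],
    dualMap_comp_dualMap_eq_zero hσ, hinjσ, hAD, hdual,
    LinearMap.dualMap_surjective_of_injective hinj, hinj, hMP,
    R.exact_positionToLength hT o hG, LinearMap.dualMap_surjective_of_injective hinjσ⟩
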